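/- Functions on $(0,\infty)$ are extended to $\mathbb R$ by $0$. Let $B(0,\infty)$ be the bounded Borel functions on $(0,\infty)$, $B(0,\infty)^+$ the nonnegative ones, $\|\cdot\|$ the supremum norm, and $C^1(0,\infty)^+$ the nonnegative bounded continuously differentiable functions on $(0,\infty)$ with bounded derivative. Let $\mathfrak N(0,\infty)$ be the set of integer-valued finite Borel measures on $(0,\infty)$ with the weak topology, $\mathbf 0$ the null measure, $\mathfrak N(0,\infty)^\circ=\mathfrak N(0,\infty)\setminus\{\mathbf 0\}$, and $\langle\nu,f\rangle=\int_{(0,\infty)}f\,d\nu$. Let $\alpha\in C^1(0,\infty)^+$; for each $x>0$ let $\{p(x,i)\}_{i\ge0}$ be a probability distribution on $\mathbb N$ with $p(\cdot,i)\in C^1(0,\infty)^+$ for all $i$; put $g(x,z)=\sum_i p(x,i)z^i$, $g'(x,1-)=\sum_i i\,p(x,i)$, $g''(x,1-)=\sum_i i(i-1)p(x,i)$, and assume $\|g'(\cdot,1-)\|<\infty$. Let $G$ be a Borel probability measure on $(0,\infty)$, $G(t)=G((0,t])$, and let $L$ be a finite measure on $\mathfrak N(0,\infty)^\circ$, with $\psi(f)=\int(1-e^{-\langle\nu,f\rangle})L(d\nu)$.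 For $f\in B(0,\infty)^+$ let $u_tf(x)$ be the unique locally bounded nonnegative solution of $$u_tf(x)=f(x-t)+\int_0^t\alpha(x-s)\bigl[1-g(x-s,\langle G,e^{-u_{t-s}f}\rangle)\bigr]ds,\qquad t\ge0,\ x>0.$$ A Markov process $(Y_t)_{t\ge0}$ in $\mathfrak N(0,\infty)$ is an $(\alpha,g,G,\psi)$-process if its transition semigroup $(P_t)$ satisfies $$\int e^{-\langle\nu,f\rangle}P_t(\sigma,d\nu)=\exp\Bigl\{-\langle\sigma,u_tf\rangle-\int_0^t\psi(u_sf)\,ds\Bigr\},\qquad f\in B(0,\infty)^+,\ t\ge 0,\ \sigma\in\mathfrak N(0,\infty).$$ For $f\in B(0,\infty)$ let $\pi_tf(x)$ be the unique locally bounded solution of $$\pi_tf(x)=f(x-t)+\int_0^t\alpha(x-s)g'(x-s,1-)\langle G,\pi_{t-s}f\rangle ds,\qquad t\ge0,\ x>0,$$ and put $\Pi_\infty f(x)=\int_0^\infty\pi_sf(x)\,ds$. **Theorem.** Assume (a) $\int_0^\infty ds\int_{(s,\infty)}\alpha(x-s)g'(x-s,1-)G(dx)<1$; (b) $\alpha_1\in(0,\infty)$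 is such that $t\mapsto e^{\alpha_1t}[1-G(t)]$ is directly Riemann integrable over $[0,\infty)$ and $\int_0^\infty e^{\alpha_1s}ds\int_{(s,\infty)}\alpha(x-s)g'(x-s,1-)G(dx)=1$; (c) $\int_0^\infty e^{2\alpha_1x}G(dx)<\infty$ and $\|g''(\cdot,1-)\|<\infty$; (d) $\int L(d\nu)\bigl(\int_0^\infty e^{\alpha_1x}\nu(dx)\bigr)^2<\infty$. Here a nonnegative function $h$ on $[0,\infty)$ is directly Riemann integrable if, with $M_n(a)$ and $m_n(a)$ the supremum and infimum of $h$ over $[(n-1)a,na]$, one has $\sum_{n\ge1}aM_n(a)<\infty$ for all $a>0$ and $\lim_{a\to0}\sum_{n\ge1}aM_n(a)=\lim_{a\to0}\sum_{n\ge1}am_n(a)$. Let $\sigma\in\mathfrak N(0,\infty)$, let $(Y_t)_{t\ge0}$ be a realization with right-continuous paths (for instance a càdlàg one) of the $(\alpha,g,G,\psi)$-process with $Y_0=\sigma$ almost surely, defined under a probability measure $\mathbf P_\sigma$, and let $Z_t=\int_0^tY_s\,ds$ be its occupation time process, so that $\langle Z_t,f\rangle=\int_0^t\langle Y_s,f\rangle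 ds$. Then for every $f\in B(0,\infty)$, $\mathbf P_\sigma$-almost surely, $$\frac1t\langle Z_t,f\rangle\longrightarrow\int_{\mathfrak N(0,\infty)^\circ}\langle\nu,\Pi_\infty f\rangle\,L(d\nu)\qquad(t\to\infty),$$ where the solution $\pi_tf$ exists and all the integrals involved converge absolutely: the one defining $\Pi_\infty f(x)$ for every $x>0$, $\langle\nu,\Pi_\infty f\rangle$ for $L$-almost every $\nu$, the integral with respect to $L$, and, $\mathbf P_\sigma$-almost surely, $\langle Z_t,f\rangle$ for all $t\ge0$. -/

import Mathlib

open MeasureTheory ProbabilityTheory Filter Topology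
open scoped ENNReal NNReal

namespace AgeBranching

noncomputable section

/-- The half line `(0, ∞)` of remaining lifetimes. -/
abbrev Pos : Type := Set.Ioi (0 : ℝ)

/-- The space `𝔑(0, ∞)` of integer-valued finite Borel measures on `(0, ∞)`. It carries the
topology of weak convergence and the σ-algebra generated by the maps `ν ↦ ν B`. -/
abbrev PopMeasure : Type :=
  {ν : FiniteMeasure Pos // ∀ B : Set Pos, MeasurableSet B → ∃ n : ℕ, (ν : Measure Pos) B = n}

/-- `ν` as a measure on `(0, ∞)`. -/
def PopMeasure.toM (ν : PopMeasure) : Measure Pos := (ν.1 : Measure Pos)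

/-- The pairing `⟨μ, f⟩ = ∫_{(0, ∞)} f dμ`. Functions on `(0, ∞)` are represented throughout by
functions on `ℝ` (vanishing on `(-∞, 0]`, see `BddBorel`). -/
def pairing (μ : Measure Pos) (f : ℝ → ℝ) : ℝ := ∫ x : Pos, f x ∂μ

/-- `B(0, ∞)`: bounded Borel functions on `(0, ∞)`, extended by `0` to `ℝ`. -/
structure BddBorel (f : ℝ → ℝ) : Prop where
  measurable : Measurable f
  bounded : ∃ C : ℝ, ∀ x, |f x| ≤ C
  zero_off : ∀ x ≤ 0, f x = 0

/-- `C¹(0, ∞)⁺`: nonnegative bounded continuously differentiable functions on `(0, ∞)` with bounded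
derivative, extended by `0` to `ℝ`. -/
structure C1Nonneg (h : ℝ → ℝ) : Prop where
  nonneg : ∀ x, 0 ≤ h x
  bounded : ∃ C : ℝ, ∀ x, h x ≤ C
  differentiable : ∀ x, 0 < x → DifferentiableAt ℝ h x
  deriv_continuous : ContinuousOn (deriv h) (Set.Ioi 0)
  deriv_bounded : ∃ C : ℝ, ∀ x, 0 < x → |deriv h x| ≤ C
  zero_off : ∀ x ≤ 0, h x = 0

/-- The offspring generating function `g(x, z) = ∑ᵢ p(x, i) zⁱ`. -/
def genFun (p : ℝ → ℕ → ℝ) (x z : ℝ) : ℝ := ∑' i : ℕ, p x i * z ^ i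

/-- `g'(x, 1-) = ∑ᵢ i p(x, i)`, the mean number of offspring at a birth event. -/
def genFunDeriv (p : ℝ → ℕ → ℝ) (x : ℝ) : ℝ := ∑' i : ℕ, (i : ℝ) * p x i

/-- `‖g''(·, 1-)‖ < ∞`, where `g''(x, 1-) = ∑ᵢ i (i - 1) p(x, i)`. -/
def BddSecondMoment (p : ℝ → ℕ → ℝ) : Prop :=
  ∃ C : ℝ, ∀ x, 0 < x → Summable (fun i : ℕ => (i : ℝ) * ((i : ℝ) - 1) * p x i) ∧
    ∑' i : ℕ, (i : ℝ) * ((i : ℝ) - 1) * p x i ≤ C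

/-- Standing assumptions on the birth rate `α` and on the offspring laws `p(x, ·)`, `x > 0`. -/
structure BranchingData (α : ℝ → ℝ) (p : ℝ → ℕ → ℝ) : Prop where
  rate_C1 : C1Nonneg α
  law_C1 : ∀ i : ℕ, C1Nonneg (fun x => p x i)
  law_sum : ∀ x, 0 < x → HasSum (p x) 1
  mean_bounded : ∃ C : ℝ, ∀ x, 0 < x → Summable (fun i : ℕ => (i : ℝ) * p x i) ∧
    genFunDeriv p x ≤ C

/-- `u` is bounded on `[0, T] × (0, ∞)` for every `T`. -/
def LocBdd (u : ℝ → ℝ → ℝ) : Prop :=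
  ∀ T : ℝ, ∃ C : ℝ, ∀ t x : ℝ, 0 ≤ t → t ≤ T → 0 < x → |u t x| ≤ C

/-- `u` is a locally bounded positive Borel solution `(t, x) ↦ u_t f(x)`, on `t ≥ 0`, `x > 0`, of
`u_t f(x) = f(x-t) + ∫₀ᵗ α(x-s) [1 - g(x-s, ⟨G, exp(-u_{t-s} f)⟩)] ds`. -/
structure SolvesCumulant (α : ℝ → ℝ) (p : ℝ → ℕ → ℝ) (G : Measure Pos) (f : ℝ → ℝ)
    (u : ℝ → ℝ → ℝ) : Prop where
  measurable : Measurable (Function.uncurry u)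
  nonneg : ∀ t x : ℝ, 0 ≤ t → 0 < x → 0 ≤ u t x
  locBdd : LocBdd u
  eqn : ∀ t x : ℝ, 0 ≤ t → 0 < x →
    u t x = f (x - t) + ∫ s in (0 : ℝ)..t,
      α (x - s) * (1 - genFun p (x - s) (pairing G fun y => Real.exp (-u (t - s) y)))

/-- `u_t f(x)`, the solution of the cumulant equation (it exists for `f ∈ B(0, ∞)⁺` and is unique
on `t ≥ 0`, `x > 0`, the only arguments at which it is used). -/
def cumulant (α : ℝ → ℝ) (p : ℝ → ℕ → ℝ) (G : Measure Pos) (f : ℝ → ℝ) : ℝ → ℝ → ℝ :=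
  Classical.epsilon (SolvesCumulant α p G f)

/-- `m` is a locally bounded Borel solution `(t, x) ↦ π_t f(x)`, on `t ≥ 0`, `x > 0`, of
`π_t f(x) = f(x-t) + ∫₀ᵗ α(x-s) g'(x-s, 1-) ⟨G, π_{t-s} f⟩ ds`. -/
structure SolvesMean (α : ℝ → ℝ) (p : ℝ → ℕ → ℝ) (G : Measure Pos) (f : ℝ → ℝ)
    (m : ℝ → ℝ → ℝ) : Prop where
  measurable : Measurable (Function.uncurry m)
  locBdd : LocBdd m
  eqn : ∀ t x : ℝ, 0 ≤ t → 0 < x →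
    m t x = f (x - t) + ∫ s in (0 : ℝ)..t,
      α (x - s) * genFunDeriv p (x - s) * pairing G (m (t - s))

/-- `π_t f(x)`, the solution of the mean equation (it exists for `f ∈ B(0, ∞)` and is unique on
`t ≥ 0`, `x > 0`, the only arguments at which it is used). -/
def meanSemigroup (α : ℝ → ℝ) (p : ℝ → ℕ → ℝ) (G : Measure Pos) (f : ℝ → ℝ) : ℝ → ℝ → ℝ :=
  Classical.epsilon (SolvesMean α p G f)

/-- `Π_∞ f(x) = ∫₀^∞ π_s f(x) ds`. -/
def totalMean (α : ℝ → ℝ) (p : ℝ → ℕ → ℝ) (G : Measure Pos) (f : ℝ → ℝ) (x : ℝ) : ℝ :=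
  ∫ s in Set.Ioi (0 : ℝ), meanSemigroup α p G f s x

/-- The immigration functional `ψ(f) = ∫ (1 - exp(-⟨ν, f⟩)) L(dν)`. -/
def immigration (L : Measure PopMeasure) (f : ℝ → ℝ) : ℝ :=
  ∫ ν, (1 - Real.exp (-pairing ν.toM f)) ∂L

/-- `(P_t)` is the transition semigroup of the `(α, g, G, ψ)`-process: for `f ∈ B(0, ∞)⁺`,
`∫ exp(-⟨ν, f⟩) P_t(σ, dν) = exp(-⟨σ, u_t f⟩ - ∫₀ᵗ ψ(u_s f) ds)`. -/
def IsTransition (α : ℝ → ℝ) (p : ℝ → ℕ → ℝ) (G : Measure Pos) (L : Measure PopMeasure)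
    (P : ℝ≥0 → Kernel PopMeasure PopMeasure) : Prop :=
  (∀ t, IsMarkovKernel (P t)) ∧
  ∀ f : ℝ → ℝ, BddBorel f → (∀ x, 0 ≤ f x) → ∀ (t : ℝ≥0) (σ : PopMeasure),
    ∫ ν, Real.exp (-pairing ν.toM f) ∂(P t σ) =
      Real.exp (-pairing σ.toM (cumulant α p G f t) -
        ∫ s in (0 : ℝ)..t, immigration L (cumulant α p G f s))

/-- `Y` is a right-continuous realization, started from `σ`, of the `(α, g, G, ψ)`-process with
respect to the filtration `ℱ`: a Markov process with state space `𝔑(0, ∞)` and transition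
semigroup as in `IsTransition`. -/
structure IsProcess {Ω : Type*} {mΩ : MeasurableSpace Ω} (Pr : Measure Ω) (ℱ : Filtration ℝ≥0 mΩ)
    (α : ℝ → ℝ) (p : ℝ → ℕ → ℝ) (G : Measure Pos) (L : Measure PopMeasure) (σ : PopMeasure)
    (Y : ℝ≥0 → Ω → PopMeasure) : Prop where
  adapted : ∀ t, Measurable[ℱ t] (Y t)
  start : ∀ᵐ ω ∂Pr, Y 0 ω = σ
  right_continuous : ∀ ω t, ContinuousWithinAt (fun s => Y s ω) (Set.Ici t) t
  markov : ∃ P : ℝ≥0 → Kernel PopMeasure PopMeasure, IsTransition α p G L P ∧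
    ∀ (s t : ℝ≥0) (F : PopMeasure → ℝ), Measurable F → (∃ C : ℝ, ∀ ν, |F ν| ≤ C) →
      Pr[fun ω => F (Y (s + t) ω) | ℱ s] =ᵐ[Pr] fun ω => ∫ ν, F ν ∂(P t (Y s ω))

/-- `⟨Z_t, f⟩ = ∫₀ᵗ ⟨Y_s, f⟩ ds`, where `Z_t = ∫₀ᵗ Y_s ds` is the occupation time process. -/
def occupation {Ω : Type*} (Y : ℝ≥0 → Ω → PopMeasure) (f : ℝ → ℝ) (t : ℝ) (ω : Ω) : ℝ :=
  ∫ s in (0 : ℝ)..t, pairing (Y s.toNNReal ω).toM f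

/-- Direct Riemann integrability over `[0, ∞)` of a nonnegative function: with `Mₙ(a)`, `mₙ(a)`
the supremum and infimum of `h` over `[(n-1)a, na]`, the sums `∑ₙ a Mₙ(a)` (`n ≥ 1`) are finite for
all `a > 0`, and `∑ₙ a Mₙ(a)` and `∑ₙ a mₙ(a)` have the same limit as `a ↓ 0`. -/
def DirectlyRiemannIntegrable (h : ℝ → ℝ) : Prop :=
  let upper : ℝ → ℝ≥0∞ := fun a => ∑' n : ℕ, ENNReal.ofReal a *
    ⨆ t ∈ Set.Icc ((n : ℝ) * a) (((n : ℝ) + 1) * a), ENNReal.ofReal (h t)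
  let lower : ℝ → ℝ≥0∞ := fun a => ∑' n : ℕ, ENNReal.ofReal a *
    ⨅ t ∈ Set.Icc ((n : ℝ) * a) (((n : ℝ) + 1) * a), ENNReal.ofReal (h t)
  (∀ a : ℝ, 0 < a → upper a < ⊤) ∧
    ∃ l : ℝ≥0∞, Tendsto upper (𝓝[>] 0) (𝓝 l) ∧ Tendsto lower (𝓝[>] 0) (𝓝 l)

/-- `∫₀^∞ e^{c s} ds ∫_{(s, ∞)} α(x-s) g'(x-s, 1-) G(dx)`. -/
def reproduction (α : ℝ → ℝ) (p : ℝ → ℕ → ℝ) (G : Measure Pos) (c : ℝ) : ℝ≥0∞ :=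
  ∫⁻ s in Set.Ioi (0 : ℝ), ENNReal.ofReal (Real.exp (c * s)) *
    ∫⁻ x in {x : Pos | s < (x : ℝ)}, ENNReal.ofReal (α (x - s) * genFunDeriv p (x - s)) ∂G

/-- Subcriticality together with the Malthusian-type exponent `α₁ > 0`. -/
structure SubcriticalMalthus (α : ℝ → ℝ) (p : ℝ → ℕ → ℝ) (G : Measure Pos) (α₁ : ℝ) : Prop where
  subcritical : reproduction α p G 0 < 1
  pos : 0 < α₁
  tail_dri : DirectlyRiemannIntegrable fun t =>
    Real.exp (α₁ * t) * (1 - G.real {x : Pos | (x : ℝ) ≤ t})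
  malthus : reproduction α p G α₁ = 1

end

end AgeBranching

open AgeBranching

/-! ### Pairings with integer-valued measures: measurability and integrability -/

namespace AgeBranching

/-! Put c = α₁/2 and β(x) = α(x) g'(x, 1-). The mean equation is a renewal equation with kernel
built from β and G. Since 2e^{cs} ≤ 1 + e^{α₁s}, the mass of this kernel weighted by e^{cs} is at
most the average of the unweighted mass, which is below 1, and of the mass at α₁, which equals 1. So
it is at most some κ < 1 (`exists_subcriticalKernel`), and a contraction argument gives the tool
used throughout, `SubcriticalKernel.comparison`: a locally bounded subsolution whose source is at
most D e^{c(x-t)} is itself at most a fixed multiple of D e^{c(x-t)}. For f ≥ 0 with f ≤ A e^{cx}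
this yields π_t f(x) ≤ const · A e^{c(x-t)}, an exponential decay in t. It also gives uniqueness and
positivity of the mean semigroup.

The nonlinear equation is controlled by the same principle: u_t f ≤ π_t f, and the gap is at most
const · A² e^{c(x-t)} (`mean_sub_cumulant_le`). Replacing f by θf, the Laplace exponent of ⟨Y_t, f⟩
lies between θm - θ²V and θm, where m is the expected mean and V is bounded uniformly in t. Letting
θ tend to 0 identifies the first moment and bounds the second by const · A², uniformly in time
(`moments_of_laplace`, `exists_moment_bound`).

By the Markov property, the conditional mean of ⟨Y_{s+t}, f⟩ given the past up to s is ⟨Y_s, π_t f⟩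
+ ∫₀ᵗ ∫ ⟨ν, π_r f⟩ L(dν) dr. The first term is of size e^{-ct} in L², by the second moment bound
applied to π_t f; the second is within const · e^{-ct} of the limit a = ∫ ⟨ν, Π_∞ f⟩ L(dν). Hence
the correlations of ⟨Y_s, f⟩ - a are bounded above by const · e^{-ct} (`exists_correlation_bound`).

The centred time integral over [0, T] therefore has second moment O(T), so along T = n² the squared
errors of the averages have summable expectations. For f ≥ 0 the occupation time is nondecreasing,
which fills the gaps between consecutive squares (`ae_tendsto_time_average`). A general f is split
into positive and negative parts. -/

lemma PopMeasure.measurable_toM : Measurable PopMeasure.toM :=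
  measurable_subtype_coe.comp measurable_subtype_coe

instance (ν : PopMeasure) : IsFiniteMeasure ν.toM := by
  unfold PopMeasure.toM; infer_instance

/-- The identity kernel, sending a population to the measure it represents. -/
noncomputable def popKernel : Kernel PopMeasure Pos := ⟨PopMeasure.toM, PopMeasure.measurable_toM⟩

lemma measurableSet_popSize (n : ℕ) : MeasurableSet {ν : PopMeasure | ν.toM Set.univ = n} :=
  (Measure.measurable_coe MeasurableSet.univ).comp PopMeasure.measurable_toM
    (measurableSet_singleton _)

-- The total masses are natural numbers, so cutting the kernel according to the total mass leaves
-- countably many pieces, the n-th one bounded by n. This s-finiteness makes ν ↦ ⟨ν, f⟩ measurable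
-- although the masses are not uniformly bounded.
open Classical in
instance : IsSFiniteKernel popKernel := by
  refine ⟨fun n => Kernel.piecewise (measurableSet_popSize n) popKernel 0, fun n => ?_, ?_⟩
  · refine ⟨⟨n, by simp, fun ν => ?_⟩⟩
    rw [Kernel.piecewise_apply]
    split_ifs with h
    · exact h.le
    · simp
  · ext ν s hs
    rw [Kernel.sum_apply' _ _ hs]
    obtain ⟨n, hn⟩ := ν.2 Set.univ MeasurableSet.univ
    have hn' : ν.toM Set.univ = n := hn
    rw [tsum_eq_single n]
    · rw [Kernel.piecewise_apply, if_pos (show ν ∈ {ν : PopMeasure | ν.toM Set.univ = n} from hn')]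
    · intro m hm
      rw [Kernel.piecewise_apply, if_neg]
      · simp
      · intro h
        have h' : ν.toM Set.univ = m := h
        rw [hn'] at h'
        exact hm (by exact_mod_cast h'.symm)

lemma measurable_pairing_prod {S : Type*} [MeasurableSpace S] {F : S → ℝ → ℝ}
    (hF : Measurable (Function.uncurry F)) :
    Measurable fun q : S × PopMeasure => pairing q.2.toM (F q.1) := by
  have h : StronglyMeasurable (Function.uncurry fun (q : S × PopMeasure) (x : Pos) => F q.1 x) := by
    apply Measurable.stronglyMeasurable
    exact hF.comp ((measurable_fst.comp measurable_fst).prodMk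
      (measurable_subtype_coe.comp measurable_snd))
  exact (StronglyMeasurable.integral_kernel_prod_right (κ := Kernel.prodMkLeft S popKernel)
    h).measurable

lemma measurable_pairing {f : ℝ → ℝ} (hf : Measurable f) :
    Measurable fun ν : PopMeasure => pairing ν.toM f := by
  have := measurable_pairing_prod (S := Unit) (F := fun _ => f) (hf.comp measurable_snd)
  exact this.comp (measurable_const.prodMk measurable_id : Measurable fun ν : PopMeasure => ((), ν))

/-- The masses of (n, ∞) decrease to 0 and are integers, so one of them is already 0. Consequently
every exponential is integrable against every population, and the initial state needs no moment
condition. -/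
lemma PopMeasure.exists_support_bound (ν : PopMeasure) :
    ∃ N : ℝ, ∀ᵐ x : Pos ∂ν.toM, (x : ℝ) ≤ N := by
  have h1 : Tendsto (fun n : ℕ => ν.toM {x : Pos | (n : ℝ) < x}) atTop (𝓝 0) := by
    have h2 : ⋂ n : ℕ, {x : Pos | (n : ℝ) < x} = ∅ := by
      ext x
      simp only [Set.mem_iInter, Set.mem_ofPred_eq, Set.mem_empty_iff_false, iff_false, not_forall,
        not_lt]
      exact exists_nat_ge _
    rw [← measure_empty (μ := ν.toM), ← h2]
    apply tendsto_measure_iInter_atTop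
    · intro n
      exact (measurableSet_lt measurable_const measurable_subtype_coe).nullMeasurableSet
    · intro m n hmn x hx
      simp only [Set.mem_ofPred_eq] at hx ⊢
      exact lt_of_le_of_lt (by exact_mod_cast hmn) hx
    · exact ⟨0, measure_ne_top _ _⟩
  obtain ⟨n, hn⟩ := (h1.eventually (gt_mem_nhds (zero_lt_one))).exists
  refine ⟨n, ?_⟩
  obtain ⟨k, hk⟩ := ν.2 {x : Pos | (n : ℝ) < x}
    (measurableSet_lt measurable_const measurable_subtype_coe)
  have hk' : ν.toM {x : Pos | (n : ℝ) < x} = k := hk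
  rw [hk'] at hn
  have : k = 0 := by
    have : k < 1 := by exact_mod_cast hn
    omega
  rw [ae_iff]
  simp only [not_le]
  rw [hk', this]; simp

lemma PopMeasure.integrable_exp (ν : PopMeasure) (c : ℝ) (hc : 0 ≤ c) :
    Integrable (fun x : Pos => Real.exp (c * x)) ν.toM := by
  obtain ⟨N, hN⟩ := ν.exists_support_bound
  refine Integrable.of_bound (C := Real.exp (c * N)) ?_ ?_
  · exact (Real.measurable_exp.comp (measurable_const.mul measurable_subtype_coe)).aestronglyMeasurable
  · filter_upwards [hN] with x hx
    rw [Real.norm_eq_abs, abs_of_pos (Real.exp_pos _)]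
    exact Real.exp_le_exp.2 (mul_le_mul_of_nonneg_left hx hc)

lemma intervalIntegrable_of_bound {g : ℝ → ℝ} {C a b : ℝ} (hg : Measurable g) (hab : a ≤ b)
    (h : ∀ s, a < s → s ≤ b → |g s| ≤ C) : IntervalIntegrable g volume a b := by
  rw [intervalIntegrable_iff_integrableOn_Ioc_of_le hab]
  refine Measure.integrableOn_of_bounded (M := C) (by simp) hg.aestronglyMeasurable ?_
  refine (ae_restrict_mem measurableSet_Ioc).mono fun s hs => ?_
  exact h s hs.1 hs.2

lemma integrable_of_bound {μ : Measure Pos} [IsFiniteMeasure μ] {g : ℝ → ℝ} {C : ℝ}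
    (hg : Measurable g) (h : ∀ x, 0 < x → |g x| ≤ C) : Integrable (fun x : Pos => g x) μ :=
  Integrable.of_bound (hg.comp measurable_subtype_coe).aestronglyMeasurable C
    (Eventually.of_forall fun x => h x x.2)

lemma measurable_pairing_left {μ : Measure Pos} [SFinite μ] {S : Type*} [MeasurableSpace S]
    {F : S → ℝ → ℝ} (hF : Measurable (Function.uncurry F)) :
    Measurable fun s => pairing μ (F s) := by
  have h : StronglyMeasurable (Function.uncurry fun (s : S) (x : Pos) => F s x) := by
    apply Measurable.stronglyMeasurable
    exact hF.comp (measurable_fst.prodMk (measurable_subtype_coe.comp measurable_snd))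
  exact h.integral_prod_right.measurable

/-- A convolution integral depends measurably on its upper end and on parameters. -/
lemma measurable_intervalIntegral {S : Type*} [MeasurableSpace S] {F : S → ℝ → ℝ} {T : S → ℝ}
    (hT : Measurable T) (hF : Measurable (Function.uncurry F)) :
    Measurable fun q => ∫ s in (0 : ℝ)..T q, F q s := by
  have key : ∀ {a b : S → ℝ}, Measurable a → Measurable b →
      Measurable fun q => ∫ s in Set.Ioc (a q) (b q), F q s := by
    intro a b ha hb
    have : (fun q => ∫ s in Set.Ioc (a q) (b q), F q s) =
        fun q => ∫ s, (Set.Ioc (a q) (b q)).indicator (F q) s := by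
      funext q
      rw [integral_indicator measurableSet_Ioc]
    rw [this]
    have h : StronglyMeasurable
        (Function.uncurry fun (q : S) (s : ℝ) => (Set.Ioc (a q) (b q)).indicator (F q) s) := by
      apply Measurable.stronglyMeasurable
      have hs : MeasurableSet {z : S × ℝ | a z.1 < z.2 ∧ z.2 ≤ b z.1} :=
        (measurableSet_lt (ha.comp measurable_fst) measurable_snd).inter
          (measurableSet_le measurable_snd (hb.comp measurable_fst))
      exact hF.indicator hs
    exact h.integral_prod_right.measurable
  simp only [intervalIntegral]
  exact (key measurable_const hT).sub (key hT measurable_const)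

lemma pairing_mono {μ : Measure Pos} {f g : ℝ → ℝ} (hf : Integrable (fun x : Pos => f x) μ)
    (hg : Integrable (fun x : Pos => g x) μ) (h : ∀ x, 0 < x → f x ≤ g x) :
    pairing μ f ≤ pairing μ g :=
  integral_mono hf hg fun x => h x x.2

lemma pairing_nonneg {μ : Measure Pos} {f : ℝ → ℝ} (h : ∀ x, 0 < x → 0 ≤ f x) :
    0 ≤ pairing μ f :=
  integral_nonneg fun x => h x x.2

lemma pairing_congr {μ : Measure Pos} {f g : ℝ → ℝ} (h : ∀ x, 0 < x → f x = g x) :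
    pairing μ f = pairing μ g :=
  integral_congr_ae (Eventually.of_forall fun x => h x x.2)

end AgeBranching

/-! ### Comparison principle for the weighted renewal equation -/

namespace AgeBranching

/-- The factor β(x - s) vanishes for s ≥ x, so whatever t is, only ∫_{-∞}^x K e^{cs} ds can
contribute. The bound is therefore uniform in t. -/
lemma integral_exp_mul_conv_le {β : ℝ → ℝ} {K c : ℝ} (hm : Measurable β)
    (hβK : ∀ x, β x ≤ K) (hβ : ∀ x ≤ 0, β x = 0) (hc : 0 < c) {t x : ℝ} (h0 : ∀ x, 0 ≤ β x)
    (ht : 0 ≤ t) : ∫ s in (0 : ℝ)..t, Real.exp (c * s) * β (x - s) ≤ K / c * Real.exp (c * x) := by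
  have hK : 0 ≤ K := (hβ 0 le_rfl).symm.le.trans (hβK 0)
  have hmeas : Measurable fun s => Real.exp (c * s) * β (x - s) := by fun_prop
  have hint : IntegrableOn (fun s => K * Real.exp (c * s)) (Set.Iic x) :=
    (integrableOn_exp_mul_Iic hc x).const_mul K
  have hind : Integrable ((Set.Iic x).indicator fun s => K * Real.exp (c * s)) :=
    hint.integrable_indicator measurableSet_Iic
  have hle : ∀ s, Real.exp (c * s) * β (x - s) ≤
      (Set.Iic x).indicator (fun s => K * Real.exp (c * s)) s := by
    intro s
    by_cases hs : s ≤ x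
    · rw [Set.indicator_of_mem (by exact hs), mul_comm]
      exact mul_le_mul_of_nonneg_right (hβK _) (Real.exp_pos _).le
    · rw [Set.indicator_of_notMem (by exact hs), hβ _ (by linarith), mul_zero]
  have hI : Integrable fun s => Real.exp (c * s) * β (x - s) := by
    refine hind.mono' hmeas.aestronglyMeasurable (Eventually.of_forall fun s => ?_)
    rw [Real.norm_eq_abs, abs_of_nonneg (mul_nonneg (Real.exp_pos _).le (h0 _))]
    exact hle s
  calc ∫ s in (0 : ℝ)..t, Real.exp (c * s) * β (x - s)
      = ∫ s in Set.Ioc 0 t, Real.exp (c * s) * β (x - s) := intervalIntegral.integral_of_le ht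
    _ ≤ ∫ s, Real.exp (c * s) * β (x - s) :=
        setIntegral_le_integral hI (Eventually.of_forall fun s =>
          mul_nonneg (Real.exp_pos _).le (h0 _))
    _ ≤ ∫ s, (Set.Iic x).indicator (fun s => K * Real.exp (c * s)) s := integral_mono hI hind hle
    _ = K / c * Real.exp (c * x) := by
        rw [integral_indicator measurableSet_Iic, integral_const_mul, integral_exp_mul_Iic hc]
        ring

/-- A bounded birth intensity `β` on `(0, ∞)` and a lifetime law `G` for which the reproduction
kernel, weighted by `s ↦ e^{cs}`, has mass at most `κ < 1`. -/
structure SubcriticalKernel (β : ℝ → ℝ) (G : Measure Pos) (c κ K : ℝ) : Prop where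
  measurable : Measurable β
  nonneg : ∀ x, 0 ≤ β x
  le : ∀ x, β x ≤ K
  zero_off : ∀ x ≤ 0, β x = 0
  c_pos : 0 < c
  lt_one : κ < 1
  mass_le : ∀ t, 0 ≤ t → pairing G (fun x => ∫ s in (0 : ℝ)..t, Real.exp (c * s) * β (x - s)) ≤ κ
  exp_integrable : Integrable (fun x : Pos => Real.exp (2 * c * x)) G

/-- The constant in the comparison principle for subsolutions of the renewal equation. -/
noncomputable def growthConst (G : Measure Pos) (c κ K : ℝ) : ℝ :=
  1 + pairing G (fun x => Real.exp (c * x)) / (1 - κ) * (K / c)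

namespace SubcriticalKernel

variable {β : ℝ → ℝ} {G : Measure Pos} {c κ K : ℝ}

lemma K_nonneg (h : SubcriticalKernel β G c κ K) : 0 ≤ K :=
  (h.zero_off 0 le_rfl).symm.le.trans (h.le 0)

lemma κ_nonneg (h : SubcriticalKernel β G c κ K) : 0 ≤ κ := by
  simpa [pairing] using h.mass_le 0 le_rfl

lemma one_le_growthConst (h : SubcriticalKernel β G c κ K) : 1 ≤ growthConst G c κ K := by
  unfold growthConst
  have h1 : 0 ≤ pairing G (fun x => Real.exp (c * x)) :=
    pairing_nonneg fun x _ => (Real.exp_pos _).le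
  have h2 := h.c_pos
  have h3 := h.lt_one
  have h4 := h.K_nonneg
  have : 0 < 1 - κ := by linarith
  have : 0 ≤ pairing G (fun x => Real.exp (c * x)) / (1 - κ) * (K / c) := by positivity
  linarith

lemma exp_integrable' (h : SubcriticalKernel β G c κ K) :
    Integrable (fun x : Pos => Real.exp (c * x)) G := by
  refine h.exp_integrable.mono'
    (Real.measurable_exp.comp (measurable_const.mul measurable_subtype_coe)).aestronglyMeasurable
    (Eventually.of_forall fun x => ?_)
  rw [Real.norm_eq_abs, abs_of_pos (Real.exp_pos _)]
  have hx : 0 < (x : ℝ) := x.2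
  exact Real.exp_le_exp.2 (by nlinarith [h.c_pos])

lemma conv_le (h : SubcriticalKernel β G c κ K) {t x : ℝ} (ht : 0 ≤ t) :
    ∫ s in (0 : ℝ)..t, Real.exp (c * s) * β (x - s) ≤ K / c * Real.exp (c * x) :=
  integral_exp_mul_conv_le h.measurable h.le h.zero_off h.c_pos h.nonneg ht

lemma conv_nonneg (h : SubcriticalKernel β G c κ K) {t x : ℝ} (ht : 0 ≤ t) :
    0 ≤ ∫ s in (0 : ℝ)..t, Real.exp (c * s) * β (x - s) :=
  intervalIntegral.integral_nonneg ht fun _ _ => mul_nonneg (Real.exp_pos _).le (h.nonneg _)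

lemma measurable_conv (h : SubcriticalKernel β G c κ K) (t : ℝ) :
    Measurable fun x => ∫ s in (0 : ℝ)..t, Real.exp (c * s) * β (x - s) := by
  have hβ := h.measurable
  refine measurable_intervalIntegral (F := fun x s => Real.exp (c * s) * β (x - s))
    measurable_const ?_
  exact (Real.measurable_exp.comp (measurable_const.mul measurable_snd)).mul
    (hβ.comp (measurable_fst.sub measurable_snd))

lemma integrable_conv (h : SubcriticalKernel β G c κ K) {t : ℝ} (ht : 0 ≤ t) :
    Integrable (fun x : Pos => ∫ s in (0 : ℝ)..t, Real.exp (c * s) * β (x - s)) G := by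
  refine (h.exp_integrable'.const_mul (K / c)).mono'
    ((h.measurable_conv t).comp measurable_subtype_coe).aestronglyMeasurable
    (Eventually.of_forall fun x => ?_)
  rw [Real.norm_eq_abs, abs_of_nonneg (h.conv_nonneg ht)]
  exact h.conv_le ht

/-- Convolution preserves the decay rate at the cost of weighting the kernel, because e^{-c(t-s)} =
e^{-ct} e^{cs}. This is the reason for the weight in `mass_le`. -/
lemma conv_mul_le (h : SubcriticalKernel β G c κ K) {v : ℝ → ℝ} (hv : Measurable v)
    {t M B : ℝ} (ht : 0 ≤ t) (hB : ∀ s, 0 ≤ s → s ≤ t → |v s| ≤ B)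
    (hM : ∀ s, 0 ≤ s → s ≤ t → v s ≤ M * Real.exp (-(c * s))) (x : ℝ) :
    ∫ s in (0 : ℝ)..t, β (x - s) * v (t - s) ≤
      M * Real.exp (-(c * t)) * ∫ s in (0 : ℝ)..t, Real.exp (c * s) * β (x - s) := by
  have hβ := h.measurable
  have hB0 : 0 ≤ B := (abs_nonneg _).trans (hB 0 le_rfl ht)
  rw [← intervalIntegral.integral_const_mul]
  refine intervalIntegral.integral_mono_on ht ?_ ?_ fun s hs => ?_
  · refine intervalIntegrable_of_bound (C := K * B) (by fun_prop) ht fun s hs1 hs2 => ?_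
    rw [abs_mul, abs_of_nonneg (h.nonneg _)]
    exact mul_le_mul (h.le _) (hB _ (by linarith) (by linarith)) (abs_nonneg _) h.K_nonneg
  · refine IntervalIntegrable.const_mul ?_ _
    refine intervalIntegrable_of_bound (C := Real.exp (c * t) * K) (by fun_prop) ht
      fun s hs1 hs2 => ?_
    rw [abs_of_nonneg (mul_nonneg (Real.exp_pos _).le (h.nonneg _))]
    exact mul_le_mul (Real.exp_le_exp.2 (mul_le_mul_of_nonneg_left hs2 h.c_pos.le)) (h.le _)
      (h.nonneg _) (Real.exp_pos _).le
  · have h1 := hM (t - s) (by linarith [hs.2]) (by linarith [hs.1])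
    have h2 : Real.exp (-(c * (t - s))) = Real.exp (-(c * t)) * Real.exp (c * s) := by
      rw [← Real.exp_add]; ring_nf
    calc β (x - s) * v (t - s) ≤ β (x - s) * (M * Real.exp (-(c * (t - s)))) :=
          mul_le_mul_of_nonneg_left h1 (h.nonneg _)
      _ = _ := by rw [h2]; ring

/-- Comparison principle: a locally bounded subsolution of the renewal equation whose source is
dominated by `D e^{c(x-t)}` is itself dominated by a fixed multiple of it. -/
theorem comparison (h : SubcriticalKernel β G c κ K) [IsProbabilityMeasure G]
    {w : ℝ → ℝ → ℝ} {D : ℝ} (hD : 0 ≤ D)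
    (hw : Measurable (Function.uncurry w)) (hb : LocBdd w)
    (hsub : ∀ t x : ℝ, 0 ≤ t → 0 < x →
      w t x ≤ (∫ s in (0 : ℝ)..t, β (x - s) * pairing G (w (t - s))) + D * Real.exp (c * (x - t)))
    {t x : ℝ} (ht : 0 ≤ t) (hx : 0 < x) :
    w t x ≤ growthConst G c κ K * D * Real.exp (c * (x - t)) := by
  obtain ⟨B, hB⟩ := hb t
  set v : ℝ → ℝ := fun s => pairing G (w s) with hv
  set E : ℝ := pairing G (fun x => Real.exp (c * x)) with hE
  have hE0 : 0 ≤ E := pairing_nonneg fun x _ => (Real.exp_pos _).le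
  have hvm : Measurable v := measurable_pairing_left hw
  have hws : ∀ s, Measurable (w s) := fun s => hw.comp (measurable_const.prodMk measurable_id)
  have hwi : ∀ s, 0 ≤ s → s ≤ t → Integrable (fun x : Pos => w s x) G := fun s h0 h1 =>
    integrable_of_bound (hws s) fun x hx => hB s x h0 h1 hx
  have hvB : ∀ s, 0 ≤ s → s ≤ t → |v s| ≤ B := by
    intro s h0 h1
    have := norm_integral_le_of_norm_le_const (μ := G) (f := fun x : Pos => w s x) (C := B)
      (Eventually.of_forall fun x => hB s x h0 h1 x.2)
    simpa [hv, pairing] using this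
  have step : ∀ M, (∀ s, 0 ≤ s → s ≤ t → v s ≤ M * Real.exp (-(c * s))) →
      ∀ r y, 0 ≤ r → r ≤ t → 0 < y → w r y ≤ M * Real.exp (-(c * r)) *
        (∫ s in (0 : ℝ)..r, Real.exp (c * s) * β (y - s)) + D * Real.exp (c * (y - r)) := by
    intro M hM r y h0 h1 hy
    refine (hsub r y h0 hy).trans ?_
    gcongr
    exact h.conv_mul_le hvm h0 (fun s h2 h3 => hvB s h2 (h3.trans h1))
      (fun s h2 h3 => hM s h2 (h3.trans h1)) y
  -- Averaging the pointwise bound over G closes the loop: a decay constant M for v improves to κM +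
  -- DE.
  have step2 : ∀ M, 0 ≤ M → (∀ s, 0 ≤ s → s ≤ t → v s ≤ M * Real.exp (-(c * s))) →
      ∀ s, 0 ≤ s → s ≤ t → v s ≤ (κ * M + D * E) * Real.exp (-(c * s)) := by
    intro M hM0 hM r h0 h1
    have hint1 := (h.integrable_conv h0).const_mul (M * Real.exp (-(c * r)))
    have hint2 := h.exp_integrable'.const_mul (D * Real.exp (-(c * r)))
    calc v r ≤ ∫ y : Pos, (M * Real.exp (-(c * r)) *
          (∫ s in (0 : ℝ)..r, Real.exp (c * s) * β (y - s)) +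
            D * Real.exp (-(c * r)) * Real.exp (c * y)) ∂G := by
          refine integral_mono (hwi r h0 h1) (hint1.add hint2) fun y => ?_
          refine (step M hM r y h0 h1 y.2).trans (le_of_eq ?_)
          rw [mul_assoc D, ← Real.exp_add, show -(c * r) + c * (y : ℝ) = c * (y - r) by ring]
      _ = M * Real.exp (-(c * r)) * pairing G
            (fun y => ∫ s in (0 : ℝ)..r, Real.exp (c * s) * β (y - s)) +
            D * Real.exp (-(c * r)) * E := by
          rw [integral_add hint1 hint2, integral_const_mul, integral_const_mul]; rfl
      _ ≤ M * Real.exp (-(c * r)) * κ + D * Real.exp (-(c * r)) * E := by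
          gcongr
          exact h.mass_le r h0
      _ = _ := by ring
  -- The best decay constant on [0, t]. The maximum with 0 keeps it nonnegative, as `step2` demands,
  -- since v may be negative.
  set A : Set ℝ := (fun s => max 0 (v s * Real.exp (c * s))) '' Set.Icc 0 t with hA
  have hAbdd : BddAbove A := by
    refine ⟨B * Real.exp (c * t), ?_⟩
    rintro _ ⟨s, hs, rfl⟩
    have hB0 : 0 ≤ B := (abs_nonneg _).trans (hvB s hs.1 hs.2)
    refine max_le (by positivity) ?_
    exact mul_le_mul ((le_abs_self _).trans (hvB s hs.1 hs.2))
      (Real.exp_le_exp.2 (mul_le_mul_of_nonneg_left hs.2 h.c_pos.le)) (Real.exp_pos _).le hB0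
  have hAne : A.Nonempty := ⟨_, 0, ⟨le_rfl, ht⟩, rfl⟩
  have hS0 : 0 ≤ sSup A :=
    (le_max_left _ _).trans (le_csSup hAbdd ⟨0, ⟨le_rfl, ht⟩, rfl⟩)
  have hS : ∀ s, 0 ≤ s → s ≤ t → v s ≤ sSup A * Real.exp (-(c * s)) := by
    intro s h0 h1
    have h2 : v s * Real.exp (c * s) ≤ sSup A :=
      (le_max_right _ _).trans (le_csSup hAbdd ⟨s, ⟨h0, h1⟩, rfl⟩)
    calc v s = v s * Real.exp (c * s) * Real.exp (-(c * s)) := by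
          rw [mul_assoc, ← Real.exp_add]; simp
      _ ≤ _ := by gcongr
  have hκ := h.κ_nonneg
  have hκ1 : 0 < 1 - κ := by linarith [h.lt_one]
  -- Applied to the best constant, the improvement is an inequality for that constant. It is finite
  -- by local boundedness, so κ < 1 allows solving for it, with a result independent of t.
  have hSle : sSup A ≤ κ * sSup A + D * E := by
    refine csSup_le hAne ?_
    rintro _ ⟨s, hs, rfl⟩
    refine max_le (by positivity) ?_
    calc v s * Real.exp (c * s)
        ≤ (κ * sSup A + D * E) * Real.exp (-(c * s)) * Real.exp (c * s) := by
          gcongr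
          exact step2 _ hS0 hS s hs.1 hs.2
      _ = _ := by rw [mul_assoc, ← Real.exp_add]; simp
  have hSle' : sSup A ≤ D * E / (1 - κ) := by
    rw [le_div_iff₀ hκ1]; linarith
  have hK := h.K_nonneg
  have hc := h.c_pos
  calc w t x ≤ sSup A * Real.exp (-(c * t)) *
        (∫ s in (0 : ℝ)..t, Real.exp (c * s) * β (x - s)) + D * Real.exp (c * (x - t)) :=
        step _ hS t x ht le_rfl hx
    _ ≤ D * E / (1 - κ) * Real.exp (-(c * t)) * (K / c * Real.exp (c * x)) +
          D * Real.exp (c * (x - t)) := by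
        gcongr
        · exact h.conv_nonneg ht
        · exact h.conv_le ht
    _ = growthConst G c κ K * D * Real.exp (c * (x - t)) := by
        rw [growthConst, ← hE, show c * (x - t) = -(c * t) + c * x by ring, Real.exp_add]; ring

end SubcriticalKernel

end AgeBranching

/-! ### Monotone iteration for renewal equations -/

namespace AgeBranching

/-- The right-hand side of a renewal equation as a function of the boundary value `y`. -/
noncomputable def renewalMap (H : ℝ → ℝ → ℝ) (f : ℝ → ℝ) (y : ℝ → ℝ) (t x : ℝ) : ℝ :=
  f (x - t) + ∫ s in (0 : ℝ)..t, H (x - s) (y (t - s))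

lemma measurable_renewalMap {H : ℝ → ℝ → ℝ} {f y : ℝ → ℝ}
    (hH : Measurable (Function.uncurry H)) (hf : Measurable f) (hy : Measurable y) :
    Measurable (Function.uncurry (renewalMap H f y)) := by
  refine (hf.comp (measurable_snd.sub measurable_fst)).add ?_
  refine measurable_intervalIntegral (S := ℝ × ℝ)
    (F := fun q s => H (q.2 - s) (y (q.1 - s))) measurable_fst ?_
  exact hH.comp (((measurable_snd.comp measurable_fst).sub measurable_snd).prodMk
    (hy.comp ((measurable_fst.comp measurable_fst).sub measurable_snd)))

/-- Monotone iteration for `y t = ⟨G, J (u t)⟩`, where `u = renewalMap H f y`. -/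
theorem exists_renewal_solution {G : Measure Pos} [IsProbabilityMeasure G] {H : ℝ → ℝ → ℝ}
    {J f : ℝ → ℝ} {R B C : ℝ} (hR : 0 ≤ R)
    (hH : Measurable (Function.uncurry H))
    (hmono : ∀ x y y', 0 ≤ y → y ≤ y' → y' ≤ R → H x y ≤ H x y')
    (hcont : ∀ x, ContinuousOn (H x) (Set.Icc 0 R))
    (hnn : ∀ x y, 0 ≤ y → y ≤ R → 0 ≤ H x y) (hB : ∀ x y, 0 ≤ y → y ≤ R → H x y ≤ B)
    (hJc : Continuous J) (hJm : Monotone J) (hJ0 : 0 ≤ J 0)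
    (hf : Measurable f) (hf0 : ∀ x, 0 ≤ f x) (hfC : ∀ x, f x ≤ C)
    (hinv : ∀ y : ℝ → ℝ, Measurable y → (∀ t, 0 ≤ y t ∧ y t ≤ R) → ∀ t, 0 ≤ t →
      pairing G (fun x => J (renewalMap H f y t x)) ≤ R) :
    ∃ u : ℝ → ℝ → ℝ, Measurable (Function.uncurry u) ∧ (∀ t x, 0 ≤ t → 0 < x → 0 ≤ u t x) ∧
      LocBdd u ∧ ∀ t x, 0 ≤ t → 0 < x → u t x = f (x - t) + ∫ s in (0 : ℝ)..t,
        H (x - s) (pairing G fun z => J (u (t - s) z)) := by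
  set U := renewalMap H f with hU
  have hB0 : 0 ≤ B := (hnn 0 0 le_rfl hR).trans (hB 0 0 le_rfl hR)
  have hint : ∀ (y : ℝ → ℝ), Measurable y → (∀ t, 0 ≤ y t ∧ y t ≤ R) → ∀ t x, 0 ≤ t →
      IntervalIntegrable (fun s => H (x - s) (y (t - s))) volume 0 t := by
    intro y hy hyR t x ht
    refine intervalIntegrable_of_bound (C := B) ?_ ht fun s _ _ => ?_
    · exact hH.comp ((measurable_const.sub measurable_id).prodMk
        (hy.comp (measurable_const.sub measurable_id)))
    · rw [abs_of_nonneg (hnn _ _ (hyR _).1 (hyR _).2)]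
      exact hB _ _ (hyR _).1 (hyR _).2
  have hU0 : ∀ (y : ℝ → ℝ), (∀ t, 0 ≤ y t ∧ y t ≤ R) → ∀ t x, 0 ≤ t → 0 ≤ U y t x :=
    fun y hyR t x ht => add_nonneg (hf0 _)
      (intervalIntegral.integral_nonneg ht fun s _ => hnn _ _ (hyR _).1 (hyR _).2)
  have hUB : ∀ (y : ℝ → ℝ), Measurable y → (∀ t, 0 ≤ y t ∧ y t ≤ R) → ∀ t x, 0 ≤ t →
      U y t x ≤ C + B * t := by
    intro y hy hyR t x ht
    refine add_le_add (hfC _) ?_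
    calc ∫ s in (0 : ℝ)..t, H (x - s) (y (t - s)) ≤ ∫ _ in (0 : ℝ)..t, B :=
          intervalIntegral.integral_mono_on ht (hint y hy hyR t x ht) (by simp)
            fun s _ => hB _ _ (hyR _).1 (hyR _).2
      _ = B * t := by simp [mul_comm]
  -- The value 0 at negative times keeps every iterate in [0, R] on all of ℝ, whereas the invariance
  -- `hinv` is available only for t ≥ 0.
  set Φ : (ℝ → ℝ) → ℝ → ℝ := fun y t => if 0 ≤ t then pairing G (fun x => J (U y t x)) else 0
    with hΦ
  have hUm : ∀ y : ℝ → ℝ, Measurable y → Measurable (Function.uncurry (U y)) :=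
    fun y hy => measurable_renewalMap hH hf hy
  have hJU : ∀ y : ℝ → ℝ, Measurable y → Measurable (Function.uncurry fun t x => J (U y t x)) :=
    fun y hy => hJc.measurable.comp (hUm y hy)
  have hJUt : ∀ y : ℝ → ℝ, Measurable y → ∀ t, Measurable fun x => J (U y t x) :=
    fun y hy t => (hJU y hy).comp (measurable_const.prodMk measurable_id)
  have hJb : ∀ (y : ℝ → ℝ), Measurable y → (∀ t, 0 ≤ y t ∧ y t ≤ R) → ∀ t x, 0 ≤ t →
      |J (U y t x)| ≤ J (C + B * t) := by
    intro y hy hyR t x ht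
    rw [abs_of_nonneg (hJ0.trans (hJm (hU0 y hyR t x ht)))]
    exact hJm (hUB y hy hyR t x ht)
  have hΦm : ∀ y : ℝ → ℝ, Measurable y → Measurable (Φ y) := fun y hy =>
    Measurable.ite measurableSet_Ici (measurable_pairing_left (hJU y hy)) measurable_const
  have hΦR : ∀ y : ℝ → ℝ, Measurable y → (∀ t, 0 ≤ y t ∧ y t ≤ R) →
      ∀ t, 0 ≤ Φ y t ∧ Φ y t ≤ R := by
    intro y hy hyR t
    by_cases ht : 0 ≤ t
    · simp only [hΦ, if_pos ht]
      exact ⟨pairing_nonneg fun x _ => hJ0.trans (hJm (hU0 y hyR t x ht)), hinv y hy hyR t ht⟩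
    · simp only [hΦ, if_neg ht]
      exact ⟨le_rfl, hR⟩
  have hΦmono : ∀ y y' : ℝ → ℝ, Measurable y → Measurable y' → (∀ t, 0 ≤ y t ∧ y t ≤ R) →
      (∀ t, 0 ≤ y' t ∧ y' t ≤ R) → (∀ t, y t ≤ y' t) → ∀ t, Φ y t ≤ Φ y' t := by
    intro y y' hy hy' hyR hyR' hle t
    by_cases ht : 0 ≤ t
    · simp only [hΦ, if_pos ht]
      refine pairing_mono (integrable_of_bound (hJUt y hy t) fun x _ => hJb y hy hyR t x ht)
        (integrable_of_bound (hJUt y' hy' t) fun x _ => hJb y' hy' hyR' t x ht) fun x _ => ?_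
      refine hJm (add_le_add_right ?_ _)
      exact intervalIntegral.integral_mono_on ht (hint y hy hyR t x ht) (hint y' hy' hyR' t x ht)
        fun s _ => hmono _ _ _ (hyR _).1 (hle _) (hyR' _).2
    · simp only [hΦ, if_neg ht, le_refl]
  -- Φ preserves order and the interval [0, R], so its iterates starting from the least element 0
  -- increase to a limit.
  set Y : ℕ → ℝ → ℝ := fun n => Φ^[n] (fun _ => 0) with hYdef
  have hYsucc : ∀ n, Y (n + 1) = Φ (Y n) := fun n => Function.iterate_succ_apply' _ _ _
  have hYm : ∀ n, Measurable (Y n) ∧ ∀ t, 0 ≤ Y n t ∧ Y n t ≤ R := by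
    intro n
    induction n with
    | zero => exact ⟨measurable_const, fun t => ⟨le_rfl, hR⟩⟩
    | succ n ih => rw [hYsucc]; exact ⟨hΦm _ ih.1, hΦR _ ih.1 ih.2⟩
  have hYmono : ∀ t, Monotone fun n => Y n t := by
    intro t
    suffices h : ∀ n t, Y n t ≤ Y (n + 1) t from monotone_nat_of_le_succ fun n => h n t
    intro n
    induction n with
    | zero => exact fun t => ((hYm 1).2 t).1
    | succ n ih =>
      intro t
      rw [hYsucc n, hYsucc (n + 1)]
      exact hΦmono _ _ (hYm n).1 (hYm (n + 1)).1 (hYm n).2 (hYm (n + 1)).2 ih t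
  set y : ℝ → ℝ := fun t => ⨆ n, Y n t with hydef
  have hylim : ∀ t, Tendsto (fun n => Y n t) atTop (𝓝 (y t)) := fun t =>
    tendsto_atTop_ciSup (hYmono t) ⟨R, by rintro _ ⟨n, rfl⟩; exact ((hYm n).2 t).2⟩
  have hym : Measurable y :=
    measurable_of_tendsto_metrizable (fun n => (hYm n).1) (tendsto_pi_nhds.2 hylim)
  have hyR : ∀ t, 0 ≤ y t ∧ y t ≤ R := fun t =>
    ⟨ge_of_tendsto' (hylim t) fun n => ((hYm n).2 t).1,
      le_of_tendsto' (hylim t) fun n => ((hYm n).2 t).2⟩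
  have hUlim : ∀ t x, 0 ≤ t → Tendsto (fun n => U (Y n) t x) atTop (𝓝 (U y t x)) := by
    intro t x ht
    refine tendsto_const_nhds.add ?_
    refine intervalIntegral.tendsto_integral_filter_of_dominated_convergence (fun _ => B)
      (Eventually.of_forall fun n => ?_) (Eventually.of_forall fun n => ?_) (by simp) ?_
    · have := (hint (Y n) (hYm n).1 (hYm n).2 t x ht).aestronglyMeasurable
      rwa [Set.uIoc_of_le ht]
    · refine Eventually.of_forall fun s _ => ?_
      rw [Real.norm_eq_abs, abs_of_nonneg (hnn _ _ ((hYm n).2 _).1 ((hYm n).2 _).2)]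
      exact hB _ _ ((hYm n).2 _).1 ((hYm n).2 _).2
    · refine Eventually.of_forall fun s _ => ?_
      refine ((hcont (x - s)) _ (hyR (t - s))).tendsto.comp ?_
      exact tendsto_nhdsWithin_iff.2 ⟨hylim _, Eventually.of_forall fun n => (hYm n).2 _⟩
  -- Dominated convergence passes to the limit in Y (n + 1) = Φ (Y n), so the limit is a fixed
  -- point.
  have hfix : ∀ t, 0 ≤ t → y t = pairing G (fun x => J (U y t x)) := by
    intro t ht
    refine tendsto_nhds_unique ((hylim t).comp (tendsto_add_atTop_nat 1)) ?_
    have : (fun n => Y n t) ∘ (fun n => n + 1) = fun n => pairing G (fun x => J (U (Y n) t x)) := by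
      funext n
      simp only [Function.comp, hYsucc, hΦ, if_pos ht]
    rw [this]
    refine tendsto_integral_of_dominated_convergence (fun _ => J (C + B * t))
      (fun n => ((hJUt _ (hYm n).1 t).comp measurable_subtype_coe).aestronglyMeasurable)
      (integrable_const _) (fun n => Eventually.of_forall fun x => hJb _ (hYm n).1 (hYm n).2 t x ht)
      (Eventually.of_forall fun x => (hJc.tendsto _).comp (hUlim t x ht))
  refine ⟨U y, hUm y hym, fun t x ht _ => hU0 y hyR t x ht, fun T => ⟨C + B * T, ?_⟩, ?_⟩
  · intro t x ht htT _
    rw [abs_of_nonneg (hU0 y hyR t x ht)]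
    exact (hUB y hym hyR t x ht).trans (by gcongr)
  · intro t x ht _
    have : U y t x = f (x - t) + ∫ s in (0 : ℝ)..t, H (x - s) (y (t - s)) := rfl
    rw [this]
    congr 1
    refine intervalIntegral.integral_congr fun s hs => ?_
    rw [Set.uIcc_of_le ht] at hs
    rw [hfix (t - s) (by linarith [hs.2])]

end AgeBranching

/-! ### Offspring generating functions and the birth intensity -/

namespace AgeBranching

lemma C1Nonneg.measurable {h : ℝ → ℝ} (hh : C1Nonneg h) : Measurable h := by
  classical
  have h1 : ContinuousOn h (Set.Ioi 0) := fun x hx =>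
    (hh.differentiable x hx).continuousAt.continuousWithinAt
  have h2 := h1.measurable_piecewise (g := fun _ => (0 : ℝ)) continuousOn_const measurableSet_Ioi
  convert h2 using 1
  funext x
  by_cases hx : x ∈ Set.Ioi (0 : ℝ)
  · rw [Set.piecewise_eq_of_mem _ _ _ hx]
  · rw [Set.piecewise_eq_of_notMem _ _ _ hx, hh.zero_off x (not_lt.1 hx)]

/-- A Bonferroni inequality. Multiplying the quadratic for n by 1 - r produces the one for n + 1
minus n(n-1)r³/2, which has the right sign. -/
lemma one_sub_pow_le_quadratic {r : ℝ} (h0 : 0 ≤ r) (h1 : r ≤ 1) (i : ℕ) :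
    (1 - r) ^ i ≤ 1 - i * r + i * (i - 1) / 2 * r ^ 2 := by
  induction i with
  | zero => simp
  | succ n ih =>
    have h2 : (0 : ℝ) ≤ n * (n - 1) := by
      rcases Nat.eq_zero_or_pos n with rfl | hn
      · simp
      · have : (1 : ℝ) ≤ n := by exact_mod_cast hn
        nlinarith
    have h3 : 0 ≤ (n : ℝ) * (n - 1) * r ^ 3 := by positivity
    rw [pow_succ]
    calc (1 - r) ^ n * (1 - r) ≤ (1 - n * r + n * (n - 1) / 2 * r ^ 2) * (1 - r) :=
          mul_le_mul_of_nonneg_right ih (by linarith)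
      _ ≤ _ := by push_cast; nlinarith

/-- The mean intensity of births `x ↦ α(x) g'(x, 1-)`. -/
noncomputable def birthRate (α : ℝ → ℝ) (p : ℝ → ℕ → ℝ) (x : ℝ) : ℝ := α x * genFunDeriv p x

namespace BranchingData

variable {α : ℝ → ℝ} {p : ℝ → ℕ → ℝ}

lemma law_zero (hd : BranchingData α p) {x : ℝ} (hx : x ≤ 0) (i : ℕ) : p x i = 0 :=
  (hd.law_C1 i).zero_off x hx

lemma law_nonneg (hd : BranchingData α p) (x : ℝ) (i : ℕ) : 0 ≤ p x i := (hd.law_C1 i).nonneg x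

lemma summable_law (hd : BranchingData α p) (x : ℝ) : Summable (p x) := by
  rcases le_or_gt x 0 with hx | hx
  · exact summable_zero.congr fun i => (hd.law_zero hx i).symm
  · exact (hd.law_sum x hx).summable

lemma summable_mean (hd : BranchingData α p) (x : ℝ) : Summable fun i : ℕ => (i : ℝ) * p x i := by
  rcases le_or_gt x 0 with hx | hx
  · exact summable_zero.congr fun i => by simp [hd.law_zero hx i]
  · exact (hd.mean_bounded.choose_spec x hx).1

lemma measurable_tsum {S : Type*} [MeasurableSpace S] {F : ℕ → S → ℝ} (hF : ∀ i, Measurable (F i))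
    (hs : ∀ q, Summable fun i => F i q) : Measurable fun q => ∑' i, F i q := by
  refine measurable_of_tendsto_metrizable (f := fun n q => ∑ i ∈ Finset.range n, F i q)
    (fun n => Finset.measurable_fun_sum _ fun i _ => hF i) ?_
  exact tendsto_pi_nhds.2 fun q => (hs q).hasSum.tendsto_sum_nat

lemma measurable_genFunDeriv (hd : BranchingData α p) : Measurable (genFunDeriv p) :=
  measurable_tsum (F := fun i x => (i : ℝ) * p x i)
    (fun i => (hd.law_C1 i).measurable.const_mul _) hd.summable_mean

lemma genFunDeriv_nonneg (hd : BranchingData α p) (x : ℝ) : 0 ≤ genFunDeriv p x :=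
  tsum_nonneg fun i => mul_nonneg (Nat.cast_nonneg _) (hd.law_nonneg x i)

lemma exists_rate_bound (hd : BranchingData α p) : ∃ A : ℝ, 0 ≤ A ∧ ∀ x, α x ≤ A := by
  obtain ⟨A, hA⟩ := hd.rate_C1.bounded
  exact ⟨A, (hd.rate_C1.nonneg 0).trans (hA 0), hA⟩

lemma exists_mean_bound (hd : BranchingData α p) : ∃ C : ℝ, 0 ≤ C ∧ ∀ x, genFunDeriv p x ≤ C := by
  obtain ⟨C, hC⟩ := hd.mean_bounded
  have hC0 : 0 ≤ C := (hd.genFunDeriv_nonneg 1).trans (hC 1 one_pos).2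
  refine ⟨C, hC0, fun x => ?_⟩
  rcases le_or_gt x 0 with hx | hx
  · simpa [genFunDeriv, hd.law_zero hx] using hC0
  · exact (hC x hx).2

lemma birthRate_nonneg (hd : BranchingData α p) (x : ℝ) : 0 ≤ birthRate α p x :=
  mul_nonneg (hd.rate_C1.nonneg x) (hd.genFunDeriv_nonneg x)

lemma birthRate_zero (hd : BranchingData α p) (x : ℝ) (hx : x ≤ 0) : birthRate α p x = 0 := by
  rw [birthRate, hd.rate_C1.zero_off x hx, zero_mul]

lemma measurable_birthRate (hd : BranchingData α p) : Measurable (birthRate α p) :=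
  hd.rate_C1.measurable.mul hd.measurable_genFunDeriv

lemma exists_birthRate_bound (hd : BranchingData α p) : ∃ K : ℝ, ∀ x, birthRate α p x ≤ K := by
  obtain ⟨A, hA0, hA⟩ := hd.exists_rate_bound
  obtain ⟨C, _, hC⟩ := hd.exists_mean_bound
  exact ⟨A * C, fun x => mul_le_mul (hA x) (hC x) (hd.genFunDeriv_nonneg x) hA0⟩

lemma term_le (hd : BranchingData α p) {x z : ℝ} (h0 : 0 ≤ z) (h1 : z ≤ 1) (i : ℕ) :
    p x i * z ^ i ≤ p x i :=
  mul_le_of_le_one_right (hd.law_nonneg x i) (pow_le_one₀ h0 h1)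

lemma summable_genFun (hd : BranchingData α p) {x z : ℝ} (h0 : 0 ≤ z) (h1 : z ≤ 1) :
    Summable fun i : ℕ => p x i * z ^ i :=
  (hd.summable_law x).of_nonneg_of_le
    (fun i => mul_nonneg (hd.law_nonneg x i) (pow_nonneg h0 i)) (hd.term_le h0 h1)

lemma one_sub_genFun (hd : BranchingData α p) {x z : ℝ} (hx : 0 < x) (h0 : 0 ≤ z) (h1 : z ≤ 1) :
    HasSum (fun i : ℕ => p x i * (1 - z ^ i)) (1 - genFun p x z) := by
  have := (hd.law_sum x hx).sub (hd.summable_genFun (x := x) h0 h1).hasSum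
  simpa [mul_sub, genFun] using this

lemma one_sub_genFun_nonneg (hd : BranchingData α p) {x z : ℝ} (hx : 0 < x) (h0 : 0 ≤ z)
    (h1 : z ≤ 1) : 0 ≤ 1 - genFun p x z := by
  rw [← (hd.one_sub_genFun hx h0 h1).tsum_eq]
  exact tsum_nonneg fun i => mul_nonneg (hd.law_nonneg x i) (by linarith [pow_le_one₀ (n := i) h0 h1])

lemma genFun_nonneg (hd : BranchingData α p) {x z : ℝ} (h0 : 0 ≤ z) : 0 ≤ genFun p x z :=
  tsum_nonneg fun i => mul_nonneg (hd.law_nonneg x i) (pow_nonneg h0 i)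

/-- Bernoulli's inequality term by term: the generating function lies above its tangent at 1. -/
lemma one_sub_genFun_le (hd : BranchingData α p) {x z : ℝ} (hx : 0 < x) (h0 : 0 ≤ z)
    (h1 : z ≤ 1) : 1 - genFun p x z ≤ genFunDeriv p x * (1 - z) := by
  refine hasSum_le (fun i => ?_) (hd.one_sub_genFun hx h0 h1)
    ((hd.summable_mean x).hasSum.mul_right (1 - z))
  have := one_add_mul_le_pow (a := z - 1) (by linarith) i
  have h2 : 1 - z ^ i ≤ i * (1 - z) := by
    rw [show 1 + (z - 1) = z by ring] at this; linarith
  calc p x i * (1 - z ^ i) ≤ p x i * (i * (1 - z)) :=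
        mul_le_mul_of_nonneg_left h2 (hd.law_nonneg x i)
    _ = _ := by ring

/-- The Bonferroni bound summed over the offspring law. With the tangent bound it shows that
linearising at z = 1 costs only a quadratic error; this is the use of the second factorial moment.
-/
lemma le_one_sub_genFun (hd : BranchingData α p) {x z C : ℝ} (hx : 0 < x) (h0 : 0 ≤ z)
    (h1 : z ≤ 1) (hs : Summable fun i : ℕ => (i : ℝ) * ((i : ℝ) - 1) * p x i)
    (hC : ∑' i : ℕ, (i : ℝ) * ((i : ℝ) - 1) * p x i ≤ C) :
    genFunDeriv p x * (1 - z) - C / 2 * (1 - z) ^ 2 ≤ 1 - genFun p x z := by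
  have h2 : genFunDeriv p x * (1 - z) -
      (∑' i : ℕ, (i : ℝ) * ((i : ℝ) - 1) * p x i) * ((1 - z) ^ 2 / 2) ≤ 1 - genFun p x z := by
    refine hasSum_le (fun i => ?_)
      (((hd.summable_mean x).hasSum.mul_right (1 - z)).sub (hs.hasSum.mul_right ((1 - z) ^ 2 / 2)))
      (hd.one_sub_genFun hx h0 h1)
    have := one_sub_pow_le_quadratic (r := 1 - z) (by linarith) (by linarith) i
    rw [sub_sub_cancel] at this
    calc (i : ℝ) * p x i * (1 - z) - (i : ℝ) * ((i : ℝ) - 1) * p x i * ((1 - z) ^ 2 / 2)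
        = p x i * (i * (1 - z) - i * (i - 1) / 2 * (1 - z) ^ 2) := by ring
      _ ≤ _ := mul_le_mul_of_nonneg_left (by linarith) (hd.law_nonneg x i)
  have h3 := mul_le_mul_of_nonneg_right hC (by positivity : 0 ≤ (1 - z) ^ 2 / 2)
  linarith

lemma continuousOn_genFun (hd : BranchingData α p) (x : ℝ) :
    ContinuousOn (genFun p x) (Set.Icc 0 1) := by
  refine continuousOn_tsum (u := p x) (fun i => by fun_prop) (hd.summable_law x) fun i z hz => ?_
  rw [Real.norm_eq_abs, abs_of_nonneg (mul_nonneg (hd.law_nonneg x i) (pow_nonneg hz.1 i))]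
  exact hd.term_le hz.1 hz.2 i

lemma genFun_mono (hd : BranchingData α p) (x : ℝ) {z z' : ℝ} (h0 : 0 ≤ z) (h : z ≤ z')
    (h1 : z' ≤ 1) : genFun p x z ≤ genFun p x z' :=
  (hd.summable_genFun h0 (h.trans h1)).tsum_le_tsum (fun i =>
    mul_le_mul_of_nonneg_left (pow_le_pow_left₀ h0 h i) (hd.law_nonneg x i))
    (hd.summable_genFun (h0.trans h) h1)

lemma measurable_genFun (hd : BranchingData α p) {S : Type*} [MeasurableSpace S] {a z : S → ℝ}
    (ha : Measurable a) (hz : Measurable z) (h0 : ∀ q, 0 ≤ z q) (h1 : ∀ q, z q ≤ 1) :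
    Measurable fun q => genFun p (a q) (z q) :=
  measurable_tsum (F := fun i q => p (a q) i * z q ^ i)
    (fun i => ((hd.law_C1 i).measurable.comp ha).mul (hz.pow_const i))
    fun q => hd.summable_genFun (h0 q) (h1 q)

end BranchingData

/-! ### Solving the mean and the cumulant equation -/

variable {α : ℝ → ℝ} {p : ℝ → ℕ → ℝ} {G : Measure Pos} {c κ K : ℝ}

lemma SubcriticalKernel.exists_mean_nonneg {f : ℝ → ℝ} [IsProbabilityMeasure G]
    (h : SubcriticalKernel (birthRate α p) G c κ K) (hf : BddBorel f) (hf0 : ∀ x, 0 ≤ f x) :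
    ∃ m, SolvesMean α p G f m := by
  obtain ⟨C, hC⟩ := hf.bounded
  have hC0 : 0 ≤ C := (abs_nonneg _).trans (hC 0)
  have hκ1 : 0 < 1 - κ := by linarith [h.lt_one]
  have hR : 0 ≤ C / (1 - κ) := by positivity
  have hK := h.K_nonneg
  have hβ := h.measurable
  -- The radius R = C / (1 - κ) solves C + κR = R, so [0, R] is invariant. The unweighted kernel
  -- mass is also at most κ, because e^{cs} ≥ 1 for s ≥ 0.
  refine Exists.elim (exists_renewal_solution (G := G)
    (H := fun x y => birthRate α p x * y) (J := fun y => y) (f := f) (R := C / (1 - κ))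
    (B := K * (C / (1 - κ))) (C := C) hR
    ((hβ.comp measurable_fst).mul measurable_snd)
    (fun x y y' _ h2 _ => mul_le_mul_of_nonneg_left h2 (h.nonneg x))
    (fun x => by fun_prop) (fun x y h0 _ => mul_nonneg (h.nonneg x) h0)
    (fun x y h0 h1 => mul_le_mul (h.le x) h1 h0 hK) continuous_id monotone_id le_rfl
    hf.measurable hf0 (fun x => (le_abs_self _).trans (hC x)) ?_)
    fun u ⟨h1, _, h3, h4⟩ => ⟨u, h1, h3, h4⟩
  intro y hy hyR t ht
  have hI : Integrable (fun x : Pos => C / (1 - κ) *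
      ∫ s in (0 : ℝ)..t, Real.exp (c * s) * birthRate α p (x - s)) G :=
    (h.integrable_conv ht).const_mul _
  have hle : ∀ x : Pos, renewalMap (fun x y => birthRate α p x * y) f y t x ≤
      C + C / (1 - κ) * ∫ s in (0 : ℝ)..t, Real.exp (c * s) * birthRate α p (x - s) := by
    intro x
    refine add_le_add ((le_abs_self _).trans (hC _)) ?_
    rw [← intervalIntegral.integral_const_mul]
    refine intervalIntegral.integral_mono_on ht ?_ ?_ fun s hs => ?_
    · refine intervalIntegrable_of_bound (C := K * (C / (1 - κ))) (by fun_prop) ht fun s _ _ => ?_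
      rw [abs_of_nonneg (mul_nonneg (h.nonneg _) (hyR _).1)]
      exact mul_le_mul (h.le _) (hyR _).2 (hyR _).1 hK
    · refine IntervalIntegrable.const_mul ?_ _
      refine intervalIntegrable_of_bound (C := Real.exp (c * t) * K) (by fun_prop) ht
        fun s hs1 hs2 => ?_
      rw [abs_of_nonneg (mul_nonneg (Real.exp_pos _).le (h.nonneg _))]
      exact mul_le_mul (Real.exp_le_exp.2 (mul_le_mul_of_nonneg_left hs2 h.c_pos.le)) (h.le _)
        (h.nonneg _) (Real.exp_pos _).le
    · have h1 : 1 ≤ Real.exp (c * s) := Real.one_le_exp (mul_nonneg h.c_pos.le hs.1)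
      calc birthRate α p (x - s) * y (t - s) ≤ birthRate α p (x - s) * (C / (1 - κ)) :=
            mul_le_mul_of_nonneg_left (hyR _).2 (h.nonneg _)
        _ ≤ (Real.exp (c * s) * birthRate α p (x - s)) * (C / (1 - κ)) :=
            mul_le_mul_of_nonneg_right (le_mul_of_one_le_left (h.nonneg _) h1) hR
        _ = _ := mul_comm _ _
  have hnn : ∀ x : Pos, 0 ≤ renewalMap (fun x y => birthRate α p x * y) f y t x := fun x =>
    add_nonneg (hf0 _) (intervalIntegral.integral_nonneg ht fun s _ =>
      mul_nonneg (h.nonneg _) (hyR _).1)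
  calc pairing G (fun x => renewalMap (fun x y => birthRate α p x * y) f y t x)
      ≤ ∫ x : Pos, (C + C / (1 - κ) *
        ∫ s in (0 : ℝ)..t, Real.exp (c * s) * birthRate α p (x - s)) ∂G :=
        integral_mono_of_nonneg (Eventually.of_forall hnn) ((integrable_const _).add hI)
          (Eventually.of_forall hle)
    _ = C + C / (1 - κ) * pairing G
        (fun x => ∫ s in (0 : ℝ)..t, Real.exp (c * s) * birthRate α p (x - s)) := by
        rw [integral_add (integrable_const _) hI, integral_const_mul]; simp [pairing]
    _ ≤ C + C / (1 - κ) * κ := by gcongr; exact h.mass_le t ht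
    _ = C / (1 - κ) := by field_simp; ring

lemma SolvesMean.intervalIntegrable [IsProbabilityMeasure G]
    (h : SubcriticalKernel (birthRate α p) G c κ K) {m : ℝ → ℝ → ℝ}
    (hm : Measurable (Function.uncurry m)) (hb : LocBdd m) {t : ℝ} (ht : 0 ≤ t) (x : ℝ) :
    IntervalIntegrable (fun s => birthRate α p (x - s) * pairing G (m (t - s))) volume 0 t := by
  have hβ := h.measurable
  obtain ⟨B, hB⟩ := hb t
  have hv : Measurable fun s => pairing G (m s) := measurable_pairing_left hm
  refine intervalIntegrable_of_bound (C := K * B)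
    ((hβ.comp (measurable_const.sub measurable_id)).mul
      (hv.comp (measurable_const.sub measurable_id))) ht fun s hs1 hs2 => ?_
  have hvB : |pairing G (m (t - s))| ≤ B := by
    have := norm_integral_le_of_norm_le_const (μ := G) (f := fun x : Pos => m (t - s) x) (C := B)
      (Eventually.of_forall fun x => hB _ x (by linarith) (by linarith) x.2)
    simpa [pairing] using this
  rw [abs_mul, abs_of_nonneg (h.nonneg _)]
  exact mul_le_mul (h.le _) hvB (abs_nonneg _) h.K_nonneg

lemma LocBdd.integrable [IsFiniteMeasure G] {m : ℝ → ℝ → ℝ} (hb : LocBdd m)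
    (hm : Measurable (Function.uncurry m)) {t : ℝ} (ht : 0 ≤ t) :
    Integrable (fun x : Pos => m t x) G := by
  obtain ⟨B, hB⟩ := hb t
  exact integrable_of_bound (hm.comp (measurable_const.prodMk measurable_id))
    fun x hx => hB t x ht le_rfl hx

/-- Linear combinations of solutions of the mean equation. -/
lemma SolvesMean.lin [IsProbabilityMeasure G] (h : SubcriticalKernel (birthRate α p) G c κ K)
    {f₁ f₂ : ℝ → ℝ} {m₁ m₂ : ℝ → ℝ → ℝ} (h₁ : SolvesMean α p G f₁ m₁)
    (h₂ : SolvesMean α p G f₂ m₂) (a b : ℝ) :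
    SolvesMean α p G (fun x => a * f₁ x + b * f₂ x) (fun t x => a * m₁ t x + b * m₂ t x) := by
  refine ⟨(h₁.measurable.const_mul a).add (h₂.measurable.const_mul b), fun T => ?_, ?_⟩
  · obtain ⟨B₁, hB₁⟩ := h₁.locBdd T
    obtain ⟨B₂, hB₂⟩ := h₂.locBdd T
    refine ⟨|a| * B₁ + |b| * B₂, fun t x h0 h1 hx => (abs_add_le _ _).trans ?_⟩
    rw [abs_mul, abs_mul]
    gcongr
    · exact hB₁ t x h0 h1 hx
    · exact hB₂ t x h0 h1 hx
  · intro t x ht hx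
    have i₁ := SolvesMean.intervalIntegrable h h₁.measurable h₁.locBdd ht x
    have i₂ := SolvesMean.intervalIntegrable h h₂.measurable h₂.locBdd ht x
    have hI : ∫ s in (0 : ℝ)..t, α (x - s) * genFunDeriv p (x - s) *
        pairing G ((fun t x => a * m₁ t x + b * m₂ t x) (t - s)) =
        ∫ s in (0 : ℝ)..t, (a * (birthRate α p (x - s) * pairing G (m₁ (t - s))) +
          b * (birthRate α p (x - s) * pairing G (m₂ (t - s)))) := by
      refine intervalIntegral.integral_congr fun s hs => ?_
      rw [Set.uIcc_of_le ht] at hs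
      have ht' : 0 ≤ t - s := by linarith [hs.2]
      have : pairing G ((fun t x => a * m₁ t x + b * m₂ t x) (t - s)) =
          a * pairing G (m₁ (t - s)) + b * pairing G (m₂ (t - s)) := by
        unfold pairing
        rw [← integral_const_mul, ← integral_const_mul, ← integral_add]
        · exact (h₁.locBdd.integrable h₁.measurable ht').const_mul a
        · exact (h₂.locBdd.integrable h₂.measurable ht').const_mul b
      simp only [this, birthRate]
      ring
    rw [hI, intervalIntegral.integral_add (i₁.const_mul a) (i₂.const_mul b),
      intervalIntegral.integral_const_mul, intervalIntegral.integral_const_mul,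
      h₁.eqn t x ht hx, h₂.eqn t x ht hx]
    simp only [birthRate]
    ring

/-- The difference of two solutions, in either order, is a subsolution with zero source, so the
comparison principle with D = 0 makes it nonpositive. -/
lemma SolvesMean.unique [IsProbabilityMeasure G] (h : SubcriticalKernel (birthRate α p) G c κ K)
    {f : ℝ → ℝ} {m₁ m₂ : ℝ → ℝ → ℝ} (h₁ : SolvesMean α p G f m₁) (h₂ : SolvesMean α p G f m₂)
    {t x : ℝ} (ht : 0 ≤ t) (hx : 0 < x) : m₁ t x = m₂ t x := by
  have key : ∀ {m₁ m₂ : ℝ → ℝ → ℝ}, SolvesMean α p G f m₁ → SolvesMean α p G f m₂ →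
      m₁ t x ≤ m₂ t x := by
    intro m₁ m₂ h₁ h₂
    have h3 := SolvesMean.lin h h₁ h₂ 1 (-1)
    have := h.comparison (D := 0) le_rfl h3.measurable h3.locBdd (fun t x ht hx => by
      rw [h3.eqn t x ht hx]; simp [birthRate]) ht hx
    simp only [one_mul, neg_mul, mul_zero, zero_mul] at this
    linarith
  exact le_antisymm (key h₁ h₂) (key h₂ h₁)

lemma BddBorel.pos_part {f : ℝ → ℝ} (hf : BddBorel f) : BddBorel fun x => max (f x) 0 := by
  obtain ⟨C, hC⟩ := hf.bounded
  refine ⟨hf.measurable.max measurable_const, ⟨C, fun x => ?_⟩, fun x hx => by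
    simp [hf.zero_off x hx]⟩
  rw [abs_of_nonneg (le_max_right _ _)]
  exact max_le ((le_abs_self _).trans (hC x)) ((abs_nonneg _).trans (hC x))

lemma BddBorel.const_mul {f : ℝ → ℝ} (hf : BddBorel f) (a : ℝ) : BddBorel fun x => a * f x := by
  obtain ⟨C, hC⟩ := hf.bounded
  refine ⟨hf.measurable.const_mul a, ⟨|a| * C, fun x => ?_⟩, fun x hx => by
    simp [hf.zero_off x hx]⟩
  rw [abs_mul]
  exact mul_le_mul_of_nonneg_left (hC x) (abs_nonneg a)

lemma SubcriticalKernel.exists_mean {f : ℝ → ℝ} [IsProbabilityMeasure G]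
    (h : SubcriticalKernel (birthRate α p) G c κ K) (hf : BddBorel f) :
    ∃ m, SolvesMean α p G f m := by
  obtain ⟨m₁, h₁⟩ := h.exists_mean_nonneg hf.pos_part fun x => le_max_right _ _
  obtain ⟨m₂, h₂⟩ := h.exists_mean_nonneg (hf.const_mul (-1)).pos_part fun x => le_max_right _ _
  have h3 := SolvesMean.lin h h₁ h₂ 1 (-1)
  have hfe : (fun x => 1 * max (f x) 0 + -1 * max (-1 * f x) 0) = f := by
    funext x
    rcases le_total (f x) 0 with hx | hx
    · rw [max_eq_right hx, max_eq_left (by linarith)]; ring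
    · rw [max_eq_left hx, max_eq_right (by linarith)]; ring
  rw [hfe] at h3
  exact ⟨_, h3⟩

lemma SubcriticalKernel.solvesMean {f : ℝ → ℝ} [IsProbabilityMeasure G]
    (h : SubcriticalKernel (birthRate α p) G c κ K) (hf : BddBorel f) :
    SolvesMean α p G f (meanSemigroup α p G f) :=
  Classical.epsilon_spec (h.exists_mean hf)

/-- In the unknown y_t = ⟨G, 1 - e^{-u_t}⟩ the equation is monotone and [0, 1] is trivially
invariant. Existence is enough: it makes `cumulant` a solution, and the later estimates hold for
every solution. -/
lemma BranchingData.solvesCumulant {f : ℝ → ℝ} [IsProbabilityMeasure G]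
    (hd : BranchingData α p) (hf : BddBorel f) (hf0 : ∀ x, 0 ≤ f x) :
    SolvesCumulant α p G f (cumulant α p G f) := by
  refine Classical.epsilon_spec ?_
  obtain ⟨C, hC⟩ := hf.bounded
  obtain ⟨A, hA0, hA⟩ := hd.exists_rate_bound
  -- The argument of the generating function is clamped to [0, 1], where its series converges; on
  -- the solution obtained the clamp is inactive.
  have hz : ∀ y : ℝ, 0 ≤ 1 - max 0 (min 1 y) ∧ 1 - max 0 (min 1 y) ≤ 1 := fun y =>
    ⟨by simp, by simp⟩
  have hzm : Measurable fun q : ℝ × ℝ => 1 - max 0 (min 1 q.2) := by fun_prop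
  have hH0 : ∀ x y, 0 ≤ α x * (1 - genFun p x (1 - max 0 (min 1 y))) := by
    intro x y
    rcases le_or_gt x 0 with hx | hx
    · rw [hd.rate_C1.zero_off x hx, zero_mul]
    · exact mul_nonneg (hd.rate_C1.nonneg x) (hd.one_sub_genFun_nonneg hx (hz y).1 (hz y).2)
  have hexp : Continuous fun v : ℝ => 1 - Real.exp (-v) := by fun_prop
  have hexpm : Monotone fun v : ℝ => 1 - Real.exp (-v) := fun a b hab => by
    have := Real.exp_le_exp.2 (neg_le_neg hab)
    simp only; linarith
  refine Exists.elim (exists_renewal_solution (G := G)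
    (H := fun x y => α x * (1 - genFun p x (1 - max 0 (min 1 y))))
    (J := fun v => 1 - Real.exp (-v)) (f := f) (R := 1) (B := A) (C := C) zero_le_one
    ((hd.rate_C1.measurable.comp measurable_fst).mul (measurable_const.sub
      (hd.measurable_genFun measurable_fst hzm (fun q => (hz q.2).1) fun q => (hz q.2).2)))
    (fun x y y' _ h2 _ => mul_le_mul_of_nonneg_left (sub_le_sub_left (hd.genFun_mono x (hz y').1
      (sub_le_sub_left (max_le_max le_rfl (min_le_min le_rfl h2)) _) (hz y).2) _)
      (hd.rate_C1.nonneg x))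
    (fun x => continuousOn_const.mul (continuousOn_const.sub ((hd.continuousOn_genFun x).comp
      (by fun_prop) fun y _ => hz y)))
    (fun x y _ _ => hH0 x y)
    (fun x y _ _ => (mul_le_of_le_one_right (hd.rate_C1.nonneg x)
      (by linarith [hd.genFun_nonneg (x := x) (hz y).1])).trans (hA x))
    hexp hexpm (by simp) hf.measurable hf0 (fun x => (le_abs_self _).trans (hC x)) ?_) ?_
  rotate_left
  · rintro u ⟨h1, h2, h3, h4⟩
    refine ⟨u, h1, h2, h3, fun t x ht hx => ?_⟩
    rw [h4 t x ht hx]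
    congr 1
    refine intervalIntegral.integral_congr fun s hs => ?_
    rw [Set.uIcc_of_le ht] at hs
    have ht' : 0 ≤ t - s := by linarith [hs.2]
    have hum : Measurable (u (t - s)) := h1.comp (measurable_const.prodMk measurable_id)
    have hem : Measurable fun y => Real.exp (-u (t - s) y) := by fun_prop
    have he : ∀ y, 0 < y → |Real.exp (-u (t - s) y)| ≤ 1 := fun y hy => by
      rw [abs_of_pos (Real.exp_pos _)]
      exact Real.exp_le_one_iff.2 (by linarith [h2 _ y ht' hy])
    have hint := integrable_of_bound (μ := G) hem he
    have h5 : pairing G (fun z => 1 - Real.exp (-u (t - s) z)) =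
        1 - pairing G fun z => Real.exp (-u (t - s) z) := by
      unfold pairing
      rw [integral_sub (integrable_const _) hint]; simp
    have h6 : 0 ≤ pairing G fun z => Real.exp (-u (t - s) z) :=
      pairing_nonneg fun _ _ => (Real.exp_pos _).le
    have h7 : (pairing G fun z => Real.exp (-u (t - s) z)) ≤ 1 := by
      have := pairing_mono hint (integrable_const (1 : ℝ)) fun y hy =>
        (le_abs_self _).trans (he y hy)
      simpa [pairing] using this
    simp only [h5]
    rw [min_eq_right (by linarith), max_eq_right (by linarith), sub_sub_cancel]
  · intro y hy hyR t ht
    have : ∀ x : Pos, (fun v => 1 - Real.exp (-v)) (renewalMap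
      (fun x y => α x * (1 - genFun p x (1 - max 0 (min 1 y)))) f y t x) ≤ 1 := fun x => by
        simp [(Real.exp_pos _).le]
    calc _ ≤ ∫ _ : Pos, (1 : ℝ) ∂G := integral_mono_of_nonneg (Eventually.of_forall fun x => ?_)
          (integrable_const _) (Eventually.of_forall this)
      _ = 1 := by simp
    have h0 : 0 ≤ renewalMap (fun x y => α x * (1 - genFun p x (1 - max 0 (min 1 y)))) f y t x :=
      add_nonneg (hf0 _) (intervalIntegral.integral_nonneg ht fun s _ => hH0 _ _)
    have := hexpm h0
    simpa using this

end AgeBranching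

/-! ### Decay of the mean semigroup and linearisation of the cumulant -/

namespace AgeBranching

variable {α : ℝ → ℝ} {p : ℝ → ℕ → ℝ} {G : Measure Pos} {c κ K : ℝ}

lemma SolvesMean.eqn_birthRate {f : ℝ → ℝ} {m : ℝ → ℝ → ℝ} (hm : SolvesMean α p G f m) {t x : ℝ}
    (ht : 0 ≤ t) (hx : 0 < x) : m t x =
      f (x - t) + ∫ s in (0 : ℝ)..t, birthRate α p (x - s) * pairing G (m (t - s)) :=
  hm.eqn t x ht hx

lemma SolvesCumulant.measurable_section {f : ℝ → ℝ} {u : ℝ → ℝ → ℝ}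
    (hu : SolvesCumulant α p G f u) (t : ℝ) : Measurable (u t) :=
  hu.measurable.comp (measurable_const.prodMk measurable_id)

/-- Follows from e^y ≥ 1 + y + y²/2 and (1 + y + y²/2)(1 - y + y²/2) = 1 + y⁴/4 ≥ 1. -/
lemma one_sub_exp_neg_ge {y : ℝ} (hy : 0 ≤ y) : y - y ^ 2 / 2 ≤ 1 - Real.exp (-y) := by
  have h1 := Real.quadratic_le_exp_of_nonneg hy
  have h2 : Real.exp (-y) * Real.exp y = 1 := by rw [← Real.exp_add]; simp
  have h3 := mul_le_mul_of_nonneg_left h1 (Real.exp_pos (-y)).le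
  rw [h2] at h3
  have h5 : 0 < 1 + y + y ^ 2 / 2 := by positivity
  have h6 : Real.exp (-y) ≤ 1 - y + y ^ 2 / 2 := by
    by_contra! hlt
    have := mul_lt_mul_of_pos_right hlt h5
    nlinarith [sq_nonneg (y ^ 2)]
  linarith

variable [IsProbabilityMeasure G]

/-- The negative of the solution has the source -f ≤ 0, hence is a subsolution with D = 0. -/
lemma SubcriticalKernel.mean_nonneg {f : ℝ → ℝ} (h : SubcriticalKernel (birthRate α p) G c κ K)
    (hf : BddBorel f) (hf0 : ∀ x, 0 ≤ f x) {t x : ℝ} (ht : 0 ≤ t) (hx : 0 < x) :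
    0 ≤ meanSemigroup α p G f t x := by
  have hm := h.solvesMean hf
  have h0 := SolvesMean.lin h hm hm (-1) 0
  have := h.comparison (D := 0) le_rfl h0.measurable h0.locBdd (fun t x ht hx => by
    rw [h0.eqn t x ht hx]
    have := hf0 (x - t)
    simp only [birthRate, zero_mul, add_zero]
    linarith) ht hx
  simp only [zero_mul, mul_zero, add_zero] at this
  linarith

/-- The exponential decay in t on which all later estimates rest. The source f(x - t) is at most A
e^{c(x-t)}: by assumption while t < x, and because f vanishes there once t ≥ x. -/
lemma SubcriticalKernel.mean_le {f : ℝ → ℝ} (h : SubcriticalKernel (birthRate α p) G c κ K)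
    (hf : BddBorel f) {A : ℝ} (hA : 0 ≤ A) (hfA : ∀ x, 0 < x → f x ≤ A * Real.exp (c * x))
    {t x : ℝ} (ht : 0 ≤ t) (hx : 0 < x) :
    meanSemigroup α p G f t x ≤ growthConst G c κ K * A * Real.exp (c * (x - t)) := by
  have hm := h.solvesMean hf
  refine h.comparison hA hm.measurable hm.locBdd (fun t x ht hx => ?_) ht hx
  rw [hm.eqn t x ht hx, add_comm]
  refine add_le_add le_rfl ?_
  rcases le_or_gt (x - t) 0 with h1 | h1
  · rw [hf.zero_off _ h1]; positivity
  · exact hfA _ h1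

lemma SubcriticalKernel.mean_const_mul {f : ℝ → ℝ} (h : SubcriticalKernel (birthRate α p) G c κ K)
    (hf : BddBorel f) (θ : ℝ) {t x : ℝ} (ht : 0 ≤ t) (hx : 0 < x) :
    meanSemigroup α p G (fun x => θ * f x) t x = θ * meanSemigroup α p G f t x := by
  have hm := h.solvesMean hf
  have h0 := SolvesMean.lin h hm hm θ 0
  have h1 := h.solvesMean (hf.const_mul θ)
  simp only [zero_mul, add_zero] at h0
  exact SolvesMean.unique h h1 h0 ht hx

lemma SubcriticalKernel.mean_sub {f₁ f₂ : ℝ → ℝ} (h : SubcriticalKernel (birthRate α p) G c κ K)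
    (h₁ : BddBorel f₁) (h₂ : BddBorel f₂) (hf : BddBorel fun x => f₁ x - f₂ x) {t x : ℝ}
    (ht : 0 ≤ t) (hx : 0 < x) :
    meanSemigroup α p G (fun x => f₁ x - f₂ x) t x =
      meanSemigroup α p G f₁ t x - meanSemigroup α p G f₂ t x := by
  have h0 := SolvesMean.lin h (h.solvesMean h₁) (h.solvesMean h₂) 1 (-1)
  simp only [one_mul, neg_one_mul, ← sub_eq_add_neg] at h0
  exact SolvesMean.unique h (h.solvesMean hf) h0 ht hx

section Cumulant

variable {f : ℝ → ℝ} {u : ℝ → ℝ → ℝ}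

lemma SolvesCumulant.integrable_exp_neg (hu : SolvesCumulant α p G f u) {t : ℝ} (ht : 0 ≤ t) :
    Integrable (fun x : Pos => Real.exp (-u t x)) G := by
  have hm := hu.measurable_section t
  refine integrable_of_bound (g := fun x => Real.exp (-u t x)) (C := 1) (by fun_prop)
    fun x hx => ?_
  rw [abs_of_pos (Real.exp_pos _)]
  exact Real.exp_le_one_iff.2 (by linarith [hu.nonneg t x ht hx])

lemma SolvesCumulant.pairing_exp_mem (hu : SolvesCumulant α p G f u) {t : ℝ} (ht : 0 ≤ t) :
    0 ≤ pairing G (fun y => Real.exp (-u t y)) ∧ pairing G (fun y => Real.exp (-u t y)) ≤ 1 := by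
  refine ⟨pairing_nonneg fun _ _ => (Real.exp_pos _).le, ?_⟩
  have := pairing_mono (f := fun y => Real.exp (-u t y)) (g := fun _ => 1) (hu.integrable_exp_neg ht)
    (integrable_const (1 : ℝ)) fun y hy =>
    Real.exp_le_one_iff.2 (by linarith [hu.nonneg t y ht hy])
  simpa [pairing] using this

lemma SolvesCumulant.one_sub_pairing_le (hu : SolvesCumulant α p G f u) {t : ℝ} (ht : 0 ≤ t) :
    1 - pairing G (fun y => Real.exp (-u t y)) ≤ pairing G (u t) := by
  have hi := hu.locBdd.integrable hu.measurable ht (G := G)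
  have h1 : 1 - pairing G (fun y => Real.exp (-u t y)) =
      ∫ y : Pos, (1 - Real.exp (-u t y)) ∂G := by
    rw [integral_sub (integrable_const _) (hu.integrable_exp_neg ht)]; simp [pairing]
  rw [h1]
  refine integral_mono ((integrable_const _).sub (hu.integrable_exp_neg ht)) hi fun y => ?_
  have := Real.add_one_le_exp (-u t y)
  simp only
  linarith

lemma SolvesCumulant.le_one_sub_pairing (hu : SolvesCumulant α p G f u) {t a : ℝ} (ht : 0 ≤ t)
    (hc : Integrable (fun x : Pos => Real.exp (2 * c * x)) G)
    (ha : ∀ x, 0 < x → u t x ≤ a * Real.exp (c * x)) :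
    pairing G (u t) - a ^ 2 / 2 * pairing G (fun x => Real.exp (2 * c * x)) ≤
      1 - pairing G (fun y => Real.exp (-u t y)) := by
  have hi := hu.locBdd.integrable hu.measurable ht (G := G)
  have h1 : 1 - pairing G (fun y => Real.exp (-u t y)) =
      ∫ y : Pos, (1 - Real.exp (-u t y)) ∂G := by
    rw [integral_sub (integrable_const _) (hu.integrable_exp_neg ht)]; simp [pairing]
  have h2 : pairing G (u t) - a ^ 2 / 2 * pairing G (fun x => Real.exp (2 * c * x)) =
      ∫ y : Pos, (u t y - a ^ 2 / 2 * Real.exp (2 * c * y)) ∂G := by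
    rw [integral_sub hi (hc.const_mul _), integral_const_mul]; rfl
  rw [h1, h2]
  refine integral_mono (hi.sub (hc.const_mul _))
    ((integrable_const _).sub (hu.integrable_exp_neg ht)) fun y => ?_
  have h3 := hu.nonneg t y ht y.2
  have h4 := one_sub_exp_neg_ge h3
  have h5 : u t y ^ 2 ≤ a ^ 2 * Real.exp (2 * c * y) := by
    calc u t y ^ 2 ≤ (a * Real.exp (c * y)) ^ 2 := pow_le_pow_left₀ h3 (ha y y.2) 2
      _ = _ := by rw [mul_pow, ← Real.exp_nat_mul]; congr 2; push_cast; ring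
  simp only
  linarith

lemma SolvesCumulant.intervalIntegrable (hd : BranchingData α p) (hu : SolvesCumulant α p G f u)
    {t : ℝ} (ht : 0 ≤ t) (x : ℝ) : IntervalIntegrable (fun s => α (x - s) *
      (1 - genFun p (x - s) (pairing G fun y => Real.exp (-u (t - s) y)))) volume 0 t := by
  obtain ⟨A, hA0, hA⟩ := hd.exists_rate_bound
  have hα := hd.rate_C1.measurable
  -- Nothing is known about u at negative times, so the pairing may leave [0, 1] for s > t. Clamping
  -- gives a function measurable on all of ℝ that agrees with the integrand on (0, t].
  set z : ℝ → ℝ := fun s => max 0 (min 1 (pairing G fun y => Real.exp (-u (t - s) y))) with hz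
  have hzm : Measurable z := by
    refine measurable_const.max (measurable_const.min ?_)
    have h1 : Measurable fun r => pairing G fun y => Real.exp (-u r y) :=
      measurable_pairing_left (Real.measurable_exp.comp hu.measurable.neg)
    exact h1.comp (measurable_const.sub measurable_id)
  have hz01 : ∀ s, 0 ≤ z s ∧ z s ≤ 1 := fun s => ⟨by simp [hz], by simp [hz]⟩
  have key : IntervalIntegrable (fun s => α (x - s) * (1 - genFun p (x - s) (z s))) volume 0 t := by
    refine intervalIntegrable_of_bound (C := A) ?_ ht fun s _ _ => ?_
    · exact (hα.comp (measurable_const.sub measurable_id)).mul (measurable_const.sub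
        (hd.measurable_genFun (measurable_const.sub measurable_id) hzm (fun s => (hz01 s).1)
          fun s => (hz01 s).2))
    · rcases le_or_gt (x - s) 0 with hx | hx
      · rw [hd.rate_C1.zero_off _ hx]; simpa using hA0
      · have h1 := hd.one_sub_genFun_nonneg hx (hz01 s).1 (hz01 s).2
        have h2 := hd.genFun_nonneg (x := x - s) (hz01 s).1
        rw [abs_of_nonneg (mul_nonneg (hd.rate_C1.nonneg _) h1)]
        exact (mul_le_of_le_one_right (hd.rate_C1.nonneg _) (by linarith)).trans (hA _)
  refine key.congr fun s hs => ?_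
  rw [Set.uIoc_of_le ht] at hs
  have := hu.pairing_exp_mem (sub_nonneg.2 hs.2)
  simp only [hz]
  rw [min_eq_right this.2, max_eq_right this.1]

/-- Since 1 - g(x, z) ≤ g'(x, 1-)(1 - z) and 1 - e^{-u} ≤ u, the nonlinearity lies below its
linearisation, and u - m is a subsolution with zero source. -/
lemma SolvesCumulant.le_mean (hd : BranchingData α p)
    (h : SubcriticalKernel (birthRate α p) G c κ K) {m : ℝ → ℝ → ℝ}
    (hu : SolvesCumulant α p G f u) (hm : SolvesMean α p G f m) {t x : ℝ} (ht : 0 ≤ t)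
    (hx : 0 < x) : u t x ≤ m t x := by
  have hlb : LocBdd fun t x => u t x - m t x := fun T => by
    obtain ⟨B₁, hB₁⟩ := hu.locBdd T
    obtain ⟨B₂, hB₂⟩ := hm.locBdd T
    exact ⟨B₁ + B₂, fun t x h0 h1 hx => (abs_sub _ _).trans
      (add_le_add (hB₁ t x h0 h1 hx) (hB₂ t x h0 h1 hx))⟩
  have hmeas : Measurable (Function.uncurry fun t x => u t x - m t x) :=
    hu.measurable.sub hm.measurable
  have := h.comparison (D := 0) le_rfl hmeas hlb (fun t x ht hx => ?_) ht hx
  · simp only [mul_zero, zero_mul] at this; linarith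
  have i1 := hu.intervalIntegrable hd ht x
  have i2 := SolvesMean.intervalIntegrable h hm.measurable hm.locBdd ht x
  have i3 := SolvesMean.intervalIntegrable h hmeas hlb ht x
  rw [hu.eqn t x ht hx, hm.eqn_birthRate ht hx]
  simp only [zero_mul, add_zero, add_sub_add_left_eq_sub]
  rw [← intervalIntegral.integral_sub i1 i2]
  refine intervalIntegral.integral_mono_on ht (i1.sub i2) i3 fun s hs => ?_
  have hts : 0 ≤ t - s := sub_nonneg.2 hs.2
  have e1 : (pairing G fun x => u (t - s) x - m (t - s) x) =
      pairing G (u (t - s)) - pairing G (m (t - s)) :=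
    integral_sub (hu.locBdd.integrable hu.measurable hts) (hm.locBdd.integrable hm.measurable hts)
  rw [e1]
  rcases le_or_gt (x - s) 0 with hxs | hxs
  · simp [birthRate, hd.rate_C1.zero_off _ hxs]
  · obtain ⟨h0, h1⟩ := hu.pairing_exp_mem hts
    have h2 := hd.one_sub_genFun_le hxs h0 h1
    have h3 := mul_le_mul_of_nonneg_left (hu.one_sub_pairing_le hts)
      (hd.genFunDeriv_nonneg (x - s))
    have h4 := mul_le_mul_of_nonneg_left (h2.trans h3) (hd.rate_C1.nonneg (x - s))
    simp only [birthRate]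
    linarith

end Cumulant

/-- The gap m - u satisfies the mean equation with a source that is the linearisation error,
quadratic in u ≤ m and hence quadratic in A. The factor A² is the point: for θf the error becomes of
order θ², which is what second moments require. -/
lemma mean_sub_cumulant_le (hd : BranchingData α p) (hg2 : BddSecondMoment p)
    (h : SubcriticalKernel (birthRate α p) G c κ K) : ∃ C₂ : ℝ, 0 ≤ C₂ ∧
    ∀ (f : ℝ → ℝ) (A : ℝ), BddBorel f → (∀ x, 0 ≤ f x) → 0 ≤ A →
      (∀ x, 0 < x → f x ≤ A * Real.exp (c * x)) → ∀ t x : ℝ, 0 ≤ t → 0 < x →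
        meanSemigroup α p G f t x - cumulant α p G f t x ≤
          C₂ * A ^ 2 * Real.exp (c * (x - t)) := by
  obtain ⟨a, ha0, ha⟩ := hd.exists_rate_bound
  obtain ⟨M₁, hM₁0, hM₁⟩ := hd.exists_mean_bound
  obtain ⟨M₂, hM₂⟩ := hg2
  have hc := h.c_pos
  have hM₂0 : 0 ≤ M₂ := by
    refine le_trans (tsum_nonneg fun i => ?_) (hM₂ 1 one_pos).2
    refine mul_nonneg ?_ (hd.law_nonneg 1 i)
    rcases Nat.eq_zero_or_pos i with rfl | hi
    · simp
    · have : (1 : ℝ) ≤ i := by exact_mod_cast hi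
      nlinarith
  set g₀ := growthConst G c κ K with hg₀
  have hg₀1 : 1 ≤ g₀ := h.one_le_growthConst
  set E₁ := pairing G fun x => Real.exp (c * x) with hE₁
  set E₂ := pairing G fun x => Real.exp (2 * c * x) with hE₂
  have hE₁0 : 0 ≤ E₁ := pairing_nonneg fun x _ => (Real.exp_pos _).le
  have hE₂0 : 0 ≤ E₂ := pairing_nonneg fun x _ => (Real.exp_pos _).le
  -- The two sources of error: M₁E₂/2 comes from replacing 1 - e^{-u} by u, and M₂E₁²/2 from
  -- replacing g by its tangent at 1.
  set Q := (M₁ * E₂ + M₂ * E₁ ^ 2) / 2 with hQ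
  have hQ0 : 0 ≤ Q := by positivity
  refine ⟨g₀ * (Q * g₀ ^ 2 * (a / c)), by positivity, ?_⟩
  intro f A hf hf0 hA hfA t x ht hx
  have hu := hd.solvesCumulant (G := G) hf hf0
  have hm := h.solvesMean hf
  set u := cumulant α p G f
  set m := meanSemigroup α p G f
  have hlb : LocBdd fun t x => m t x - u t x := fun T => by
    obtain ⟨B₁, hB₁⟩ := hm.locBdd T
    obtain ⟨B₂, hB₂⟩ := hu.locBdd T
    exact ⟨B₁ + B₂, fun t x h0 h1 hx => (abs_sub _ _).trans
      (add_le_add (hB₁ t x h0 h1 hx) (hB₂ t x h0 h1 hx))⟩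
  have hmeas : Measurable (Function.uncurry fun t x => m t x - u t x) :=
    hm.measurable.sub hu.measurable
  have := h.comparison (D := Q * g₀ ^ 2 * (a / c) * A ^ 2) (by positivity) hmeas hlb
    (fun t x ht hx => ?_) ht hx
  · refine this.trans (le_of_eq ?_)
    ring
  have i1 := hu.intervalIntegrable hd ht x
  have i2 := SolvesMean.intervalIntegrable h hm.measurable hm.locBdd ht x
  have i3 := SolvesMean.intervalIntegrable h hmeas hlb ht x
  have hαm := hd.rate_C1.measurable
  have i4 : IntervalIntegrable (fun s => Q * (g₀ * A) ^ 2 * Real.exp (-(c * t)) *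
      (Real.exp (c * s) * α (x - s))) volume 0 t := by
    refine IntervalIntegrable.const_mul ?_ _
    refine intervalIntegrable_of_bound (C := Real.exp (c * t) * a) (by fun_prop) ht
      fun s hs1 hs2 => ?_
    rw [abs_of_nonneg (mul_nonneg (Real.exp_pos _).le (hd.rate_C1.nonneg _))]
    exact mul_le_mul (Real.exp_le_exp.2 (mul_le_mul_of_nonneg_left hs2 hc.le)) (ha _)
      (hd.rate_C1.nonneg _) (Real.exp_pos _).le
  have hsrc : ∫ s in (0 : ℝ)..t, Q * (g₀ * A) ^ 2 * Real.exp (-(c * t)) *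
      (Real.exp (c * s) * α (x - s)) ≤ Q * g₀ ^ 2 * (a / c) * A ^ 2 * Real.exp (c * (x - t)) := by
    rw [intervalIntegral.integral_const_mul]
    calc _ ≤ Q * (g₀ * A) ^ 2 * Real.exp (-(c * t)) * (a / c * Real.exp (c * x)) := by
          gcongr
          exact integral_exp_mul_conv_le hαm ha hd.rate_C1.zero_off hc hd.rate_C1.nonneg ht
      _ = _ := by
          rw [show c * (x - t) = -(c * t) + c * x by ring, Real.exp_add]; ring
  refine le_trans ?_ (add_le_add_right hsrc _)
  rw [← intervalIntegral.integral_add i3 i4, hu.eqn t x ht hx, hm.eqn_birthRate ht hx]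
  rw [add_sub_add_left_eq_sub, ← intervalIntegral.integral_sub i2 i1]
  refine intervalIntegral.integral_mono_on ht (i2.sub i1) (i3.add i4) fun s hs => ?_
  have hts : 0 ≤ t - s := sub_nonneg.2 hs.2
  have e1 : (pairing G fun x => m (t - s) x - u (t - s) x) =
      pairing G (m (t - s)) - pairing G (u (t - s)) :=
    integral_sub (hm.locBdd.integrable hm.measurable hts) (hu.locBdd.integrable hu.measurable hts)
  rw [e1]
  rcases le_or_gt (x - s) 0 with hxs | hxs
  · simp [birthRate, hd.rate_C1.zero_off _ hxs]
  obtain ⟨h0, h1⟩ := hu.pairing_exp_mem hts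
  set b := g₀ * A * Real.exp (-(c * (t - s))) with hb
  have hb0 : 0 ≤ b := by positivity
  have hub : ∀ y, 0 < y → u (t - s) y ≤ b * Real.exp (c * y) := fun y hy => by
    refine (hu.le_mean hd h hm hts hy).trans ((h.mean_le hf hA hfA hts hy).trans (le_of_eq ?_))
    rw [hb, show c * (y - (t - s)) = -(c * (t - s)) + c * y by ring, Real.exp_add]; ring
  have h2 := hu.le_one_sub_pairing hts h.exp_integrable hub
  have h3 : 1 - pairing G (fun y => Real.exp (-u (t - s) y)) ≤ b * E₁ := by
    refine (hu.one_sub_pairing_le hts).trans ?_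
    refine (pairing_mono (hu.locBdd.integrable hu.measurable hts)
      (h.exp_integrable'.const_mul b) hub).trans (le_of_eq ?_)
    exact integral_const_mul _ _
  set z := pairing G (fun y => Real.exp (-u (t - s) y)) with hz
  have h4 := hd.le_one_sub_genFun hxs h0 h1 (hM₂ _ hxs).1 (hM₂ _ hxs).2
  have h5 : (1 - z) ^ 2 ≤ (b * E₁) ^ 2 := pow_le_pow_left₀ (by linarith) h3 2
  have hg0 := hd.genFunDeriv_nonneg (x - s)
  have h6 : genFunDeriv p (x - s) * (pairing G (u (t - s)) - b ^ 2 / 2 * E₂) ≤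
      genFunDeriv p (x - s) * (1 - z) := mul_le_mul_of_nonneg_left h2 hg0
  have h7 : genFunDeriv p (x - s) * (b ^ 2 / 2 * E₂) ≤ M₁ * (b ^ 2 / 2 * E₂) :=
    mul_le_mul_of_nonneg_right (hM₁ _) (by positivity)
  have h8 : M₂ / 2 * (1 - z) ^ 2 ≤ M₂ / 2 * (b * E₁) ^ 2 :=
    mul_le_mul_of_nonneg_left h5 (by positivity)
  have h9 : genFunDeriv p (x - s) * pairing G (u (t - s)) - (1 - genFun p (x - s) z) ≤
      Q * b ^ 2 := by
    rw [hQ]; nlinarith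
  -- The square decays at rate 2c; one factor is discarded to match the rate c of the comparison
  -- principle.
  have hb2 : b ^ 2 ≤ (g₀ * A) ^ 2 * Real.exp (-(c * (t - s))) := by
    rw [hb, mul_pow]
    refine mul_le_mul_of_nonneg_left ?_ (by positivity)
    rw [sq]
    exact mul_le_of_le_one_right (Real.exp_pos _).le (Real.exp_le_one_iff.2 (by nlinarith))
  have h10 := mul_le_mul_of_nonneg_left (h9.trans (mul_le_mul_of_nonneg_left hb2 hQ0))
    (hd.rate_C1.nonneg (x - s))
  rw [show -(c * (t - s)) = -(c * t) + c * s by ring, Real.exp_add] at h10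
  simp only [birthRate]
  linarith

end AgeBranching

/-! ### Moments from the Laplace exponent -/

namespace AgeBranching

/-- First and second moments of a nonnegative variable, read off from two-sided bounds on its
Laplace exponent near `0`. -/
theorem moments_of_laplace {S : Type*} [MeasurableSpace S] {Q : Measure S} [IsProbabilityMeasure Q]
    {X : S → ℝ} (hX : Measurable X) (hX0 : ∀ q, 0 ≤ X q) {U : ℝ → ℝ} {m V : ℝ}
    (hU : ∀ θ, 0 < θ → ∫ q, Real.exp (-(θ * X q)) ∂Q = Real.exp (-U θ))
    (hle : ∀ θ, 0 < θ → U θ ≤ θ * m) (hge : ∀ θ, 0 < θ → θ * m - θ ^ 2 * V ≤ U θ) :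
    Integrable X Q ∧ ∫ q, X q ∂Q = m ∧ Integrable (fun q => X q ^ 2) Q ∧
      ∫ q, X q ^ 2 ∂Q ≤ 2 * V + m ^ 2 := by
  have hei : ∀ θ, 0 < θ → Integrable (fun q => Real.exp (-(θ * X q))) Q := fun θ hθ =>
    Integrable.of_bound (by fun_prop) 1 (Eventually.of_forall fun q => by
      rw [Real.norm_eq_abs, abs_of_pos (Real.exp_pos _)]
      exact Real.exp_le_one_iff.2 (by linarith [mul_nonneg hθ.le (hX0 q)]))
  have hU0 : ∀ θ, 0 < θ → 0 ≤ U θ := by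
    intro θ hθ
    have h1 : ∫ q, Real.exp (-(θ * X q)) ∂Q ≤ ∫ _, (1 : ℝ) ∂Q :=
      integral_mono (hei θ hθ) (integrable_const _) fun q =>
        Real.exp_le_one_iff.2 (by linarith [mul_nonneg hθ.le (hX0 q)])
    rw [hU θ hθ] at h1
    simp only [integral_const, probReal_univ, smul_eq_mul, mul_one] at h1
    have := Real.exp_le_one_iff.1 h1
    linarith
  have hm0 : 0 ≤ m := by have := (hU0 1 one_pos).trans (hle 1 one_pos); linarith
  set θ : ℕ → ℝ := fun n => 1 / ((n : ℝ) + 1) with hθdef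
  have hθ : ∀ n, 0 < θ n := fun n => Nat.one_div_pos_of_nat
  have hθlim : Tendsto θ atTop (𝓝 0) := tendsto_one_div_add_atTop_nhds_zero_nat
  -- First difference quotients at 0: they lie below X, converge to X, and have means expressed
  -- through U.
  set φ : ℕ → S → ℝ := fun n q => (1 - Real.exp (-(θ n * X q))) / θ n with hφ
  have hφ0 : ∀ n q, 0 ≤ φ n q := fun n q => div_nonneg (by
    have := Real.exp_le_one_iff.2 (by linarith [mul_nonneg (hθ n).le (hX0 q)] :
      -(θ n * X q) ≤ 0)
    linarith) (hθ n).le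
  have hφX : ∀ n q, φ n q ≤ X q := fun n q => by
    rw [hφ, div_le_iff₀ (hθ n)]
    have := Real.add_one_le_exp (-(θ n * X q))
    linarith
  have hφge : ∀ n q, X q - θ n * X q ^ 2 / 2 ≤ φ n q := fun n q => by
    rw [hφ, le_div_iff₀ (hθ n)]
    have := one_sub_exp_neg_ge (mul_nonneg (hθ n).le (hX0 q))
    nlinarith
  have hφlim : ∀ q, Tendsto (fun n => φ n q) atTop (𝓝 (X q)) := fun q => by
    refine tendsto_of_tendsto_of_tendsto_of_le_of_le ?_ tendsto_const_nhds (fun n => hφge n q)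
      fun n => hφX n q
    have : Tendsto (fun n => X q - θ n * X q ^ 2 / 2) atTop (𝓝 (X q - 0 * X q ^ 2 / 2)) :=
      tendsto_const_nhds.sub ((hθlim.mul_const _).div_const _)
    simpa using this
  have hφm : ∀ n, Measurable (φ n) := fun n => by fun_prop
  have hφi : ∀ n, Integrable (φ n) Q := fun n =>
    ((integrable_const _).sub (hei _ (hθ n))).div_const _
  have hφint : ∀ n, ∫ q, φ n q ∂Q = (1 - Real.exp (-U (θ n))) / θ n := fun n => by
    simp only [hφ]
    rw [integral_div, integral_sub (integrable_const _) (hei _ (hθ n)), hU _ (hθ n)]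
    simp
  have hφle : ∀ n, ∫ q, φ n q ∂Q ≤ m := fun n => by
    rw [hφint, div_le_iff₀ (hθ n)]
    have h1 := Real.add_one_le_exp (-U (θ n))
    have h2 := hle _ (hθ n)
    linarith
  -- Fatou's lemma, as the means of φ n are at most m. Once X is known to be integrable it dominates
  -- the φ n, which gives the exact mean.
  have hXi : Integrable X Q := by
    refine ⟨hX.aestronglyMeasurable, ?_⟩
    rw [hasFiniteIntegral_iff_ofReal (Eventually.of_forall hX0)]
    have h1 : ∫⁻ q, ENNReal.ofReal (X q) ∂Q ≤
        liminf (fun n => ∫⁻ q, ENNReal.ofReal (φ n q) ∂Q) atTop := by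
      refine le_trans (le_of_eq ?_) (lintegral_liminf_le fun n => (hφm n).ennreal_ofReal)
      congr 1
      funext q
      exact ((ENNReal.continuous_ofReal.tendsto _).comp (hφlim q)).liminf_eq.symm
    have h2 : ∀ n, ∫⁻ q, ENNReal.ofReal (φ n q) ∂Q ≤ ENNReal.ofReal m := fun n => by
      rw [← ofReal_integral_eq_lintegral_ofReal (hφi n) (Eventually.of_forall (hφ0 n))]
      exact ENNReal.ofReal_le_ofReal (hφle n)
    refine (h1.trans ?_).trans_lt ENNReal.ofReal_lt_top (b := ENNReal.ofReal m)
    exact liminf_le_of_le (by isBoundedDefault) fun b hb => by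
      obtain ⟨n, hn⟩ := hb.exists
      exact hn.trans (h2 n)
  have hXm : ∫ q, X q ∂Q = m := by
    have h1 : Tendsto (fun n => ∫ q, φ n q ∂Q) atTop (𝓝 (∫ q, X q ∂Q)) :=
      tendsto_integral_of_dominated_convergence X (fun n => (hφm n).aestronglyMeasurable) hXi
        (fun n => Eventually.of_forall fun q => by
          rw [Real.norm_eq_abs, abs_of_nonneg (hφ0 n q)]; exact hφX n q)
        (Eventually.of_forall hφlim)
    refine tendsto_nhds_unique h1 ?_
    have hlow : ∀ n, m - θ n * (V + m ^ 2 / 2) ≤ ∫ q, φ n q ∂Q := fun n => by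
      rw [hφint, le_div_iff₀ (hθ n)]
      have h2 := one_sub_exp_neg_ge (hU0 _ (hθ n))
      have h3 := hge _ (hθ n)
      have h4 : U (θ n) ^ 2 ≤ (θ n * m) ^ 2 := pow_le_pow_left₀ (hU0 _ (hθ n)) (hle _ (hθ n)) 2
      nlinarith
    refine tendsto_of_tendsto_of_tendsto_of_le_of_le ?_ tendsto_const_nhds hlow hφle
    have : Tendsto (fun n => m - θ n * (V + m ^ 2 / 2)) atTop (𝓝 (m - 0 * (V + m ^ 2 / 2))) :=
      tendsto_const_nhds.sub (hθlim.mul_const _)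
    simpa using this
  -- Second difference quotients, with limit X². Their means are bounded because the first order
  -- terms cancel: the mean of X is exactly m, and that of φ n is at least m - θ n (V + m²/2).
  -- Fatou's lemma applies again.
  set χ : ℕ → S → ℝ := fun n q => 2 * (X q - φ n q) / θ n with hχ
  have hχ0 : ∀ n q, 0 ≤ χ n q := fun n q => div_nonneg (by linarith [hφX n q]) (hθ n).le
  have hχm : ∀ n, Measurable (χ n) := fun n => ((hX.sub (hφm n)).const_mul 2).div_const _
  have hχi : ∀ n, Integrable (χ n) Q := fun n => ((hXi.sub (hφi n)).const_mul 2).div_const _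
  have hχle : ∀ n, ∫ q, χ n q ∂Q ≤ 2 * V + m ^ 2 := fun n => by
    simp only [hχ]
    rw [integral_div, integral_const_mul, integral_sub hXi (hφi n), hXm, hφint,
      div_le_iff₀ (hθ n)]
    have h2 := one_sub_exp_neg_ge (hU0 _ (hθ n))
    have h3 := hge _ (hθ n)
    have h4 : U (θ n) ^ 2 ≤ (θ n * m) ^ 2 := pow_le_pow_left₀ (hU0 _ (hθ n)) (hle _ (hθ n)) 2
    have h5 : m - θ n * (V + m ^ 2 / 2) ≤ (1 - Real.exp (-U (θ n))) / θ n := by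
      rw [le_div_iff₀ (hθ n)]; nlinarith
    nlinarith
  have hχlim : ∀ q, Tendsto (fun n => χ n q) atTop (𝓝 (X q ^ 2)) := fun q => by
    -- The third order Taylor bound for e^{-y}, y ≥ 0; the derivative of the difference is
    -- nonnegative by the second order bound.
    have hcub : ∀ n, X q ^ 2 - θ n * X q ^ 3 / 3 ≤ χ n q := fun n => by
      have hy := mul_nonneg (hθ n).le (hX0 q)
      have h1 : Real.exp (-(θ n * X q)) ≥ 1 - θ n * X q + (θ n * X q) ^ 2 / 2 -
          (θ n * X q) ^ 3 / 6 := by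
        have hder : ∀ y : ℝ, HasDerivAt (fun y => Real.exp (-y) - (1 - y + y ^ 2 / 2 - y ^ 3 / 6))
            (-Real.exp (-y) - (-1 + y - y ^ 2 / 2)) y := fun y => by
          have e1 : HasDerivAt (fun y : ℝ => Real.exp (-y)) (-Real.exp (-y)) y := by
            simpa using (hasDerivAt_neg y).exp
          have e2 : HasDerivAt (fun y : ℝ => 1 - y + y ^ 2 / 2 - y ^ 3 / 6)
              (-1 + y - y ^ 2 / 2) y := by
            have := ((((hasDerivAt_const y (1 : ℝ)).sub (hasDerivAt_id y)).add
              ((hasDerivAt_pow 2 y).div_const 2)).sub ((hasDerivAt_pow 3 y).div_const 6))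
            exact this.congr_deriv (by norm_num; ring)
          exact e1.sub e2
        have hmono : MonotoneOn (fun y : ℝ => Real.exp (-y) - (1 - y + y ^ 2 / 2 - y ^ 3 / 6))
            (Set.Ici 0) := by
          refine monotoneOn_of_deriv_nonneg (convex_Ici 0)
            (fun y _ => (hder y).continuousAt.continuousWithinAt)
            (fun y _ => (hder y).differentiableAt.differentiableWithinAt) fun y hy => ?_
          rw [interior_Ici] at hy
          rw [(hder y).deriv]
          have := one_sub_exp_neg_ge (le_of_lt hy)
          linarith
        have := hmono (Set.mem_Ici.2 le_rfl) (Set.mem_Ici.2 hy) hy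
        simp at this
        linarith
      have e1 : φ n q * θ n = 1 - Real.exp (-(θ n * X q)) := div_mul_cancel₀ _ (hθ n).ne'
      rw [hχ, le_div_iff₀ (hθ n)]
      refine le_of_mul_le_mul_right ?_ (hθ n)
      nlinarith
    have hup : ∀ n, χ n q ≤ X q ^ 2 := fun n => by
      rw [hχ, div_le_iff₀ (hθ n)]
      have := hφge n q
      nlinarith
    refine tendsto_of_tendsto_of_tendsto_of_le_of_le ?_ tendsto_const_nhds hcub hup
    have : Tendsto (fun n => X q ^ 2 - θ n * X q ^ 3 / 3) atTop
        (𝓝 (X q ^ 2 - 0 * X q ^ 3 / 3)) :=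
      tendsto_const_nhds.sub ((hθlim.mul_const _).div_const _)
    simpa using this
  have hsq : ∫⁻ q, ENNReal.ofReal (X q ^ 2) ∂Q ≤ ENNReal.ofReal (2 * V + m ^ 2) := by
    have h1 : ∫⁻ q, ENNReal.ofReal (X q ^ 2) ∂Q ≤
        liminf (fun n => ∫⁻ q, ENNReal.ofReal (χ n q) ∂Q) atTop := by
      refine le_trans (le_of_eq ?_) (lintegral_liminf_le fun n => (hχm n).ennreal_ofReal)
      congr 1
      funext q
      exact ((ENNReal.continuous_ofReal.tendsto _).comp (hχlim q)).liminf_eq.symm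
    have h2 : ∀ n, ∫⁻ q, ENNReal.ofReal (χ n q) ∂Q ≤ ENNReal.ofReal (2 * V + m ^ 2) := fun n => by
      rw [← ofReal_integral_eq_lintegral_ofReal (hχi n) (Eventually.of_forall (hχ0 n))]
      exact ENNReal.ofReal_le_ofReal (hχle n)
    refine h1.trans (liminf_le_of_le (by isBoundedDefault) fun b hb => ?_)
    obtain ⟨n, hn⟩ := hb.exists
    exact hn.trans (h2 n)
  have hsq0 : ∀ q, 0 ≤ X q ^ 2 := fun q => sq_nonneg _
  have hsqi : Integrable (fun q => X q ^ 2) Q :=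
    ⟨(hX.pow_const 2).aestronglyMeasurable, by
      rw [hasFiniteIntegral_iff_ofReal (Eventually.of_forall hsq0)]
      exact hsq.trans_lt ENNReal.ofReal_lt_top⟩
  refine ⟨hXi, hXm, hsqi, ?_⟩
  rw [← ofReal_integral_eq_lintegral_ofReal hsqi (Eventually.of_forall hsq0)] at hsq
  refine (ENNReal.ofReal_le_ofReal_iff ?_).1 hsq
  exact (integral_nonneg (hχ0 0)).trans (hχle 0)

end AgeBranching

/-! ### First and second moments of the process, uniformly in time -/

namespace AgeBranching

/-- `⟨ν, e^{c·}⟩`. -/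
noncomputable def expWeight (c : ℝ) (ν : PopMeasure) : ℝ :=
  pairing ν.toM fun x => Real.exp (c * x)

lemma expWeight_nonneg (c : ℝ) (ν : PopMeasure) : 0 ≤ expWeight c ν :=
  pairing_nonneg fun _ _ => (Real.exp_pos _).le

lemma measurable_expWeight (c : ℝ) : Measurable (expWeight c) :=
  measurable_pairing (by fun_prop)

lemma PopMeasure.integrable_of_le_exp (ν : PopMeasure) {c A : ℝ} (hc : 0 ≤ c) {f : ℝ → ℝ}
    (hf : Measurable f) (h0 : ∀ x, 0 < x → |f x| ≤ A * Real.exp (c * x)) :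
    Integrable (fun x : Pos => f x) ν.toM :=
  ((ν.integrable_exp c hc).const_mul A).mono' (hf.comp measurable_subtype_coe).aestronglyMeasurable
    (Eventually.of_forall fun x => h0 x x.2)

lemma PopMeasure.abs_pairing_le (ν : PopMeasure) {c A : ℝ} (hc : 0 ≤ c) {f : ℝ → ℝ}
    (h0 : ∀ x, 0 < x → |f x| ≤ A * Real.exp (c * x)) :
    |pairing ν.toM f| ≤ A * expWeight c ν := by
  refine (norm_integral_le_of_norm_le (f := fun x : Pos => f x) ((ν.integrable_exp c hc).const_mul A)
    (Eventually.of_forall fun x => h0 x x.2)).trans (le_of_eq ?_)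
  exact integral_const_mul _ _

lemma pairing_const_mul (μ : Measure Pos) (a : ℝ) (f : ℝ → ℝ) :
    pairing μ (fun x => a * f x) = a * pairing μ f :=
  integral_const_mul _ _

/-- `∫ ⟨ν, π_s f⟩ L(dν)`, the mean contribution at time `s` of one unit of immigration. -/
noncomputable def immigrationMean (α : ℝ → ℝ) (p : ℝ → ℕ → ℝ) (G : Measure Pos)
    (L : Measure PopMeasure) (f : ℝ → ℝ) (s : ℝ) : ℝ :=
  ∫ ν, pairing ν.toM (meanSemigroup α p G f s) ∂L

/-- The mean of `⟨Y_t, f⟩` for the process started from `ν`. -/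
noncomputable def processMean (α : ℝ → ℝ) (p : ℝ → ℕ → ℝ) (G : Measure Pos)
    (L : Measure PopMeasure) (f : ℝ → ℝ) (t : ℝ) (ν : PopMeasure) : ℝ :=
  pairing ν.toM (meanSemigroup α p G f t) + ∫ s in (0 : ℝ)..t, immigrationMean α p G L f s

variable {α : ℝ → ℝ} {p : ℝ → ℕ → ℝ} {G : Measure Pos} {c κ K : ℝ}

lemma SolvesMean.measurable_section {f : ℝ → ℝ} {m : ℝ → ℝ → ℝ} (hm : SolvesMean α p G f m) (t : ℝ) :
    Measurable (m t) :=
  hm.measurable.comp (measurable_const.prodMk measurable_id)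

variable [IsProbabilityMeasure G]
  {L : Measure PopMeasure} {f : ℝ → ℝ} {A : ℝ}

lemma SubcriticalKernel.abs_mean_le (h : SubcriticalKernel (birthRate α p) G c κ K)
    (hf : BddBorel f) (hf0 : ∀ x, 0 ≤ f x) (hA : 0 ≤ A)
    (hfA : ∀ x, 0 < x → f x ≤ A * Real.exp (c * x)) {t x : ℝ} (ht : 0 ≤ t) (hx : 0 < x) :
    |meanSemigroup α p G f t x| ≤
      growthConst G c κ K * A * Real.exp (-(c * t)) * Real.exp (c * x) := by
  rw [abs_of_nonneg (h.mean_nonneg hf hf0 ht hx), mul_assoc _ (Real.exp _), ← Real.exp_add,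
    show -(c * t) + c * x = c * (x - t) by ring]
  exact h.mean_le hf hA hfA ht hx

lemma SubcriticalKernel.pairing_mean_nonneg (h : SubcriticalKernel (birthRate α p) G c κ K)
    (hf : BddBorel f) (hf0 : ∀ x, 0 ≤ f x) {t : ℝ} (ht : 0 ≤ t) (ν : PopMeasure) :
    0 ≤ pairing ν.toM (meanSemigroup α p G f t) :=
  pairing_nonneg fun _ hx => h.mean_nonneg hf hf0 ht hx

lemma SubcriticalKernel.pairing_mean_le (h : SubcriticalKernel (birthRate α p) G c κ K)
    (hf : BddBorel f) (hf0 : ∀ x, 0 ≤ f x) (hA : 0 ≤ A)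
    (hfA : ∀ x, 0 < x → f x ≤ A * Real.exp (c * x)) {t : ℝ} (ht : 0 ≤ t) (ν : PopMeasure) :
    pairing ν.toM (meanSemigroup α p G f t) ≤
      growthConst G c κ K * A * Real.exp (-(c * t)) * expWeight c ν :=
  (le_abs_self _).trans (ν.abs_pairing_le h.c_pos.le fun _ hx =>
    h.abs_mean_le hf hf0 hA hfA ht hx)

lemma SubcriticalKernel.integrable_pairing_mean (h : SubcriticalKernel (birthRate α p) G c κ K)
    (hf : BddBorel f) (hf0 : ∀ x, 0 ≤ f x) (hA : 0 ≤ A)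
    (hfA : ∀ x, 0 < x → f x ≤ A * Real.exp (c * x)) (hW : Integrable (expWeight c) L) {t : ℝ}
    (ht : 0 ≤ t) : Integrable (fun ν => pairing ν.toM (meanSemigroup α p G f t)) L := by
  refine (hW.const_mul (growthConst G c κ K * A * Real.exp (-(c * t)))).mono' (measurable_pairing
    ((h.solvesMean hf).measurable_section t)).aestronglyMeasurable
    (Eventually.of_forall fun ν => ?_)
  rw [Real.norm_eq_abs, abs_of_nonneg (h.pairing_mean_nonneg hf hf0 ht ν)]
  exact h.pairing_mean_le hf hf0 hA hfA ht ν

lemma SubcriticalKernel.immigrationMean_nonneg (h : SubcriticalKernel (birthRate α p) G c κ K)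
    (hf : BddBorel f) (hf0 : ∀ x, 0 ≤ f x) {t : ℝ} (ht : 0 ≤ t) :
    0 ≤ immigrationMean α p G L f t :=
  integral_nonneg fun ν => h.pairing_mean_nonneg hf hf0 ht ν

lemma SubcriticalKernel.immigrationMean_le (h : SubcriticalKernel (birthRate α p) G c κ K)
    (hf : BddBorel f) (hf0 : ∀ x, 0 ≤ f x) (hA : 0 ≤ A)
    (hfA : ∀ x, 0 < x → f x ≤ A * Real.exp (c * x)) (hW : Integrable (expWeight c) L) {t : ℝ}
    (ht : 0 ≤ t) : immigrationMean α p G L f t ≤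
      growthConst G c κ K * A * (∫ ν, expWeight c ν ∂L) * Real.exp (-(c * t)) := by
  refine (integral_mono (h.integrable_pairing_mean hf hf0 hA hfA hW ht) (hW.const_mul _)
    fun ν => h.pairing_mean_le hf hf0 hA hfA ht ν).trans (le_of_eq ?_)
  rw [integral_const_mul]; ring

lemma SubcriticalKernel.measurable_immigrationMean [SFinite L]
    (h : SubcriticalKernel (birthRate α p) G c κ K) (hf : BddBorel f) :
    Measurable (immigrationMean α p G L f) :=
  (measurable_pairing_prod (h.solvesMean hf).measurable).stronglyMeasurable.integral_prod_right
    |>.measurable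

lemma SubcriticalKernel.intervalIntegrable_immigrationMean [SFinite L]
    (h : SubcriticalKernel (birthRate α p) G c κ K)
    (hf : BddBorel f) (hf0 : ∀ x, 0 ≤ f x) (hA : 0 ≤ A)
    (hfA : ∀ x, 0 < x → f x ≤ A * Real.exp (c * x)) (hW : Integrable (expWeight c) L) {t : ℝ}
    (ht : 0 ≤ t) : IntervalIntegrable (immigrationMean α p G L f) volume 0 t := by
  refine intervalIntegrable_of_bound (C := growthConst G c κ K * A * (∫ ν, expWeight c ν ∂L))
    (h.measurable_immigrationMean hf) ht fun s hs _ => ?_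
  rw [abs_of_nonneg (h.immigrationMean_nonneg hf hf0 hs.le)]
  refine (h.immigrationMean_le hf hf0 hA hfA hW hs.le).trans (mul_le_of_le_one_right ?_ ?_)
  · have := h.one_le_growthConst
    have : 0 ≤ ∫ ν, expWeight c ν ∂L := integral_nonneg fun ν => expWeight_nonneg c ν
    positivity
  · exact Real.exp_le_one_iff.2 (by have := mul_nonneg h.c_pos.le hs.le; linarith)

lemma integral_exp_neg_le {c t : ℝ} (hc : 0 < c) (ht : 0 ≤ t) :
    ∫ s in (0 : ℝ)..t, Real.exp (-(c * s)) ≤ 1 / c := by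
  rw [intervalIntegral.integral_of_le ht]
  have h1 : IntegrableOn (fun s => Real.exp (-c * s)) (Set.Ioi 0) :=
    integrableOn_exp_mul_Ioi (by linarith) 0
  have h2 := integral_exp_mul_Ioi (a := -c) (by linarith) 0
  simp only [neg_mul, mul_zero, Real.exp_zero, neg_div_neg_eq] at h1 h2
  rw [← h2]
  exact setIntegral_mono_set h1 (Eventually.of_forall fun s => (Real.exp_pos _).le)
    Set.Ioc_subset_Ioi_self.eventuallyLE

lemma SubcriticalKernel.processMean_nonneg (h : SubcriticalKernel (birthRate α p) G c κ K)
    (hf : BddBorel f) (hf0 : ∀ x, 0 ≤ f x) {t : ℝ} (ht : 0 ≤ t) (ν : PopMeasure) :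
    0 ≤ processMean α p G L f t ν :=
  add_nonneg (h.pairing_mean_nonneg hf hf0 ht ν) (intervalIntegral.integral_nonneg ht fun _ hs =>
    h.immigrationMean_nonneg hf hf0 hs.1)

/-- Immigration accumulates over [0, t], but the contribution of age s decays like e^{-cs}, so the
total is bounded independently of t; this is the 1 / c. -/
lemma SubcriticalKernel.processMean_le [SFinite L]
    (h : SubcriticalKernel (birthRate α p) G c κ K)
    (hf : BddBorel f) (hf0 : ∀ x, 0 ≤ f x) (hA : 0 ≤ A)
    (hfA : ∀ x, 0 < x → f x ≤ A * Real.exp (c * x)) (hW : Integrable (expWeight c) L) {t : ℝ}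
    (ht : 0 ≤ t) (ν : PopMeasure) : processMean α p G L f t ν ≤
      growthConst G c κ K * (expWeight c ν + (∫ ν, expWeight c ν ∂L) / c) * A := by
  have hg := h.one_le_growthConst
  have hW0 : 0 ≤ ∫ ν, expWeight c ν ∂L := integral_nonneg fun ν => expWeight_nonneg c ν
  have hν := expWeight_nonneg c ν
  have hc := h.c_pos
  have h1 : pairing ν.toM (meanSemigroup α p G f t) ≤ growthConst G c κ K * A * expWeight c ν := by
    refine (h.pairing_mean_le hf hf0 hA hfA ht ν).trans ?_
    exact mul_le_mul_of_nonneg_right (mul_le_of_le_one_right (by positivity)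
      (Real.exp_le_one_iff.2 (by have := mul_nonneg hc.le ht; linarith))) hν
  have h2 : ∫ s in (0 : ℝ)..t, immigrationMean α p G L f s ≤
      growthConst G c κ K * A * (∫ ν, expWeight c ν ∂L) * (1 / c) := by
    calc _ ≤ ∫ s in (0 : ℝ)..t, growthConst G c κ K * A * (∫ ν, expWeight c ν ∂L) *
          Real.exp (-(c * s)) := by
          refine intervalIntegral.integral_mono_on ht
            (h.intervalIntegrable_immigrationMean hf hf0 hA hfA hW ht)
            (Continuous.intervalIntegrable (by fun_prop) _ _) fun s hs =>
              h.immigrationMean_le hf hf0 hA hfA hW hs.1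
      _ ≤ _ := by
          rw [intervalIntegral.integral_const_mul]
          gcongr
          exact integral_exp_neg_le hc ht
  unfold processMean
  calc _ ≤ _ := add_le_add h1 h2
    _ = _ := by ring

/-- Two-sided comparison of the immigration functional with its linearisation. -/
lemma immigration_bounds [IsFiniteMeasure L] (hd : BranchingData α p)
    (h : SubcriticalKernel (birthRate α p) G c κ K) {C₂ : ℝ}
    (hf : BddBorel f) (hf0 : ∀ x, 0 ≤ f x) (hA : 0 ≤ A)
    (hfA : ∀ x, 0 < x → f x ≤ A * Real.exp (c * x))
    (hC₂ : ∀ t x : ℝ, 0 ≤ t → 0 < x → meanSemigroup α p G f t x - cumulant α p G f t x ≤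
      C₂ * A ^ 2 * Real.exp (c * (x - t)))
    (hW : Integrable (expWeight c) L) (hW2 : Integrable (fun ν => expWeight c ν ^ 2) L) {t : ℝ}
    (ht : 0 ≤ t) :
    immigration L (cumulant α p G f t) ≤ immigrationMean α p G L f t ∧
    immigrationMean α p G L f t - (C₂ * (∫ ν, expWeight c ν ∂L) +
      growthConst G c κ K ^ 2 / 2 * ∫ ν, expWeight c ν ^ 2 ∂L) * A ^ 2 * Real.exp (-(c * t)) ≤
      immigration L (cumulant α p G f t) := by
  have hu := hd.solvesCumulant (G := G) hf hf0
  have hm := h.solvesMean hf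
  set u := cumulant α p G f
  have hc := h.c_pos
  set g₀ := growthConst G c κ K with hg₀
  have hg : 1 ≤ g₀ := h.one_le_growthConst
  set e := Real.exp (-(c * t)) with he
  have he0 : 0 < e := Real.exp_pos _
  have he1 : e ≤ 1 := Real.exp_le_one_iff.2 (by have := mul_nonneg hc.le ht; linarith)
  have hum := hu.measurable_section t
  have hX0 : ∀ ν : PopMeasure, 0 ≤ pairing ν.toM (u t) := fun ν =>
    pairing_nonneg fun x hx => hu.nonneg t x ht hx
  have hmA : ∀ x, 0 < x → |meanSemigroup α p G f t x| ≤ g₀ * A * e * Real.exp (c * x) :=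
    fun x hx => h.abs_mean_le hf hf0 hA hfA ht hx
  have huA : ∀ x, 0 < x → |u t x| ≤ g₀ * A * e * Real.exp (c * x) := fun x hx => by
    rw [abs_of_nonneg (hu.nonneg t x ht hx)]
    exact (hu.le_mean hd h hm ht hx).trans ((le_abs_self _).trans (hmA x hx))
  have hui : ∀ ν : PopMeasure, Integrable (fun x : Pos => u t x) ν.toM := fun ν =>
    ν.integrable_of_le_exp hc.le hum huA
  have hmi : ∀ ν : PopMeasure, Integrable (fun x : Pos => meanSemigroup α p G f t x) ν.toM :=
    fun ν => ν.integrable_of_le_exp hc.le (hm.measurable_section t) hmA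
  have hXm : ∀ ν : PopMeasure, pairing ν.toM (u t) ≤ pairing ν.toM (meanSemigroup α p G f t) :=
    fun ν => pairing_mono (hui ν) (hmi ν) fun x hx => hu.le_mean hd h hm ht hx
  have hdiff : ∀ ν : PopMeasure, pairing ν.toM (meanSemigroup α p G f t) - pairing ν.toM (u t) ≤
      C₂ * A ^ 2 * e * expWeight c ν := fun ν => by
    have h1 : pairing ν.toM (meanSemigroup α p G f t) - pairing ν.toM (u t) =
        pairing ν.toM fun x => meanSemigroup α p G f t x - u t x := by
      unfold pairing; rw [integral_sub (hmi ν) (hui ν)]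
    rw [h1]
    have h2 : C₂ * A ^ 2 * e * expWeight c ν =
        pairing ν.toM fun x => C₂ * A ^ 2 * e * Real.exp (c * x) := (integral_const_mul _ _).symm
    rw [h2]
    refine pairing_mono ((hmi ν).sub (hui ν)) ((ν.integrable_exp c hc.le).const_mul _)
      fun x hx => (hC₂ t x ht hx).trans (le_of_eq ?_)
    rw [he, mul_assoc _ (Real.exp _), ← Real.exp_add]
    ring_nf
  have hmeasX : Measurable fun ν : PopMeasure => pairing ν.toM (u t) := measurable_pairing hum
  have hi1 : Integrable (fun ν : PopMeasure => 1 - Real.exp (-pairing ν.toM (u t))) L := by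
    refine Integrable.of_bound
      (measurable_const.sub (Real.measurable_exp.comp hmeasX.neg)).aestronglyMeasurable 1 (Eventually.of_forall fun ν => ?_)
    have h1 := Real.exp_le_one_iff.2 (neg_nonpos.2 (hX0 ν))
    rw [Real.norm_eq_abs, abs_of_nonneg (by linarith)]
    linarith [Real.exp_pos (-pairing ν.toM (u t))]
  have hi2 := h.integrable_pairing_mean hf hf0 hA hfA hW ht
  refine ⟨integral_mono hi1 hi2 fun ν => ?_, ?_⟩
  · have := Real.add_one_le_exp (-pairing ν.toM (u t))
    have := hXm ν
    simp only
    linarith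
  · have hi3 : Integrable (fun ν => C₂ * A ^ 2 * e * expWeight c ν +
        g₀ ^ 2 / 2 * A ^ 2 * e * expWeight c ν ^ 2) L := (hW.const_mul _).add (hW2.const_mul _)
    have hval : immigrationMean α p G L f t - (C₂ * (∫ ν, expWeight c ν ∂L) +
        g₀ ^ 2 / 2 * ∫ ν, expWeight c ν ^ 2 ∂L) * A ^ 2 * e =
        ∫ ν, (pairing ν.toM (meanSemigroup α p G f t) - (C₂ * A ^ 2 * e * expWeight c ν +
        g₀ ^ 2 / 2 * A ^ 2 * e * expWeight c ν ^ 2)) ∂L := by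
      rw [integral_sub hi2 hi3, integral_add (hW.const_mul _) (hW2.const_mul _),
        integral_const_mul, integral_const_mul]
      unfold immigrationMean
      ring
    rw [hval]
    refine integral_mono (hi2.sub hi3) hi1 fun ν => ?_
    have h1 := one_sub_exp_neg_ge (hX0 ν)
    have h2 := hdiff ν
    have h3 : pairing ν.toM (u t) ≤ g₀ * A * e * expWeight c ν :=
      (le_abs_self _).trans (ν.abs_pairing_le hc.le huA)
    have h4 : pairing ν.toM (u t) ^ 2 ≤ (g₀ * A * e * expWeight c ν) ^ 2 :=
      pow_le_pow_left₀ (hX0 ν) h3 2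
    -- Only one of the two decay factors is kept, so that both error terms carry the same
    -- time-integrable e^{-ct}.
    have h5 : (g₀ * A * e * expWeight c ν) ^ 2 ≤ g₀ ^ 2 * A ^ 2 * e * expWeight c ν ^ 2 := by
      have : (g₀ * A * e * expWeight c ν) ^ 2 = (g₀ ^ 2 * A ^ 2 * e * expWeight c ν ^ 2) * e := by
        ring
      rw [this]
      exact mul_le_of_le_one_right (by positivity) he1
    simp only
    linarith

/-- The first moment of the process and a bound on its second moment, uniform in time. -/
theorem exists_moment_bound [IsFiniteMeasure L] (hd : BranchingData α p) (hg2 : BddSecondMoment p)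
    (h : SubcriticalKernel (birthRate α p) G c κ K)
    (hW : Integrable (expWeight c) L) (hW2 : Integrable (fun ν => expWeight c ν ^ 2) L)
    {P : ℝ≥0 → Kernel PopMeasure PopMeasure} (hP : IsTransition α p G L P) (σ : PopMeasure) :
    ∃ M : ℝ, 0 ≤ M ∧ ∀ (f : ℝ → ℝ) (A : ℝ), BddBorel f → (∀ x, 0 ≤ f x) → 0 ≤ A →
      (∀ x, 0 < x → f x ≤ A * Real.exp (c * x)) → ∀ t : ℝ≥0,
      Integrable (fun ν => pairing ν.toM f) (P t σ) ∧
      ∫ ν, pairing ν.toM f ∂(P t σ) = processMean α p G L f t σ ∧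
      Integrable (fun ν => pairing ν.toM f ^ 2) (P t σ) ∧
      ∫ ν, pairing ν.toM f ^ 2 ∂(P t σ) ≤ M * A ^ 2 := by
  obtain ⟨C₂, hC₂0, hC₂⟩ := mean_sub_cumulant_le hd hg2 h
  have hc := h.c_pos
  set g₀ := growthConst G c κ K with hg₀
  have hg : 1 ≤ g₀ := h.one_le_growthConst
  have hW0 : 0 ≤ ∫ ν, expWeight c ν ∂L := integral_nonneg fun ν => expWeight_nonneg c ν
  have hW20 : 0 ≤ ∫ ν, expWeight c ν ^ 2 ∂L := integral_nonneg fun ν => sq_nonneg _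
  have hσ := expWeight_nonneg c σ
  set C₃ := C₂ * (∫ ν, expWeight c ν ∂L) + g₀ ^ 2 / 2 * ∫ ν, expWeight c ν ^ 2 ∂L with hC₃
  have hC₃0 : 0 ≤ C₃ := by positivity
  -- V A² bounds the linearisation error of the whole exponent: the initial population plus the
  -- immigration error integrated over time. B A bounds the mean. Both are free of t.
  set V := C₂ * expWeight c σ + C₃ / c with hV
  set B := g₀ * (expWeight c σ + (∫ ν, expWeight c ν ∂L) / c) with hB
  refine ⟨2 * V + B ^ 2, by positivity, ?_⟩
  intro f A hf hf0 hA hfA t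
  have := hP.1 t
  have ht : (0 : ℝ) ≤ t := t.2
  have hm0 := h.processMean_nonneg (L := L) hf hf0 ht σ
  have hmB := h.processMean_le hf hf0 hA hfA hW ht σ
  have hmom := moments_of_laplace (Q := P t σ) (X := fun ν => pairing ν.toM f)
    (U := fun θ => pairing σ.toM (cumulant α p G (fun x => θ * f x) t) +
      ∫ s in (0 : ℝ)..t, immigration L (cumulant α p G (fun x => θ * f x) s))
    (m := processMean α p G L f t σ) (V := V * A ^ 2) (measurable_pairing hf.measurable)
    (fun ν => pairing_nonneg fun x _ => hf0 x) (fun θ hθ => ?_) (fun θ hθ => ?_) (fun θ hθ => ?_)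
  · refine ⟨hmom.1, hmom.2.1, hmom.2.2.1, hmom.2.2.2.trans ?_⟩
    have : processMean α p G L f t σ ^ 2 ≤ (B * A) ^ 2 := pow_le_pow_left₀ hm0 hmB 2
    linarith
  · have h1 := hP.2 (fun x => θ * f x) (hf.const_mul θ)
      (fun x => mul_nonneg hθ.le (hf0 x)) t σ
    have h2 : ∀ ν : PopMeasure, pairing ν.toM (fun x => θ * f x) = θ * pairing ν.toM f :=
      fun ν => integral_const_mul _ _
    simp only [h2] at h1
    rw [h1]
    congr 1
    ring
  -- Both bounds on the exponent use θf, whose constant is θA: the mean parts scale linearly in θ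
  -- and the errors like θ².
  all_goals
    have hθf := hf.const_mul θ
    have hθf0 : ∀ x, 0 ≤ θ * f x := fun x => mul_nonneg hθ.le (hf0 x)
    have hθA : 0 ≤ θ * A := mul_nonneg hθ.le hA
    have hθfA : ∀ x, 0 < x → θ * f x ≤ θ * A * Real.exp (c * x) := fun x hx => by
      rw [mul_assoc]; exact mul_le_mul_of_nonneg_left (hfA x hx) hθ.le
    have hu := hd.solvesCumulant (G := G) hθf hθf0
    have hm := h.solvesMean hθf
    have hmA : ∀ x, 0 < x → |meanSemigroup α p G (fun x => θ * f x) t x| ≤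
        growthConst G c κ K * (θ * A) * Real.exp (-(c * t)) * Real.exp (c * x) :=
      fun x hx => h.abs_mean_le hθf hθf0 hθA hθfA ht hx
    have huA : ∀ x, 0 < x → |cumulant α p G (fun x => θ * f x) t x| ≤
        growthConst G c κ K * (θ * A) * Real.exp (-(c * t)) * Real.exp (c * x) := fun x hx => by
      rw [abs_of_nonneg (hu.nonneg t x ht hx)]
      exact (hu.le_mean hd h hm ht hx).trans ((le_abs_self _).trans (hmA x hx))
    have hui := σ.integrable_of_le_exp hc.le (hu.measurable_section t) huA
    have hmi := σ.integrable_of_le_exp hc.le (hm.measurable_section t) hmA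
    have himm := fun (s : ℝ) (hs : 0 ≤ s) => immigration_bounds hd h hθf hθf0 hθA hθfA
      (hC₂ _ _ hθf hθf0 hθA hθfA) hW hW2 hs
    have hscale : ∀ ν : PopMeasure, ∀ s, 0 ≤ s →
        pairing ν.toM (meanSemigroup α p G (fun x => θ * f x) s) =
          θ * pairing ν.toM (meanSemigroup α p G f s) := fun ν s hs => by
      rw [← pairing_const_mul]
      exact pairing_congr fun x hx => h.mean_const_mul hf θ hs hx
    have hiI := h.intervalIntegrable_immigrationMean hθf hθf0 hθA hθfA hW ht
    have hiψ : IntervalIntegrable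
        (fun s => immigration L (cumulant α p G (fun x => θ * f x) s)) volume 0 t := by
      refine intervalIntegrable_of_bound (C := L.real Set.univ) ?_ ht fun s hs _ => ?_
      · have h1 := measurable_pairing_prod hu.measurable
        have h2 : Measurable fun q : ℝ × PopMeasure =>
          1 - Real.exp (-pairing q.2.toM (cumulant α p G (fun x => θ * f x) q.1)) :=
          measurable_const.sub (Real.measurable_exp.comp h1.neg)
        exact h2.stronglyMeasurable.integral_prod_right.measurable
      · have h1 := norm_integral_le_of_norm_le_const (μ := L) (C := 1)
          (f := fun ν : PopMeasure =>
            1 - Real.exp (-pairing ν.toM (cumulant α p G (fun x => θ * f x) s)))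
          (Eventually.of_forall fun ν => by
            have h2 : 0 ≤ pairing ν.toM (cumulant α p G (fun x => θ * f x) s) :=
              pairing_nonneg fun x hx => hu.nonneg s x hs.le hx
            have h3 := Real.exp_le_one_iff.2 (neg_nonpos.2 h2)
            rw [Real.norm_eq_abs, abs_of_nonneg (by linarith)]
            linarith [Real.exp_pos (-pairing ν.toM (cumulant α p G (fun x => θ * f x) s))])
        simpa [immigration] using h1
    have hpm : θ * processMean α p G L f t σ =
        pairing σ.toM (meanSemigroup α p G (fun x => θ * f x) t) +
          ∫ s in (0 : ℝ)..t, immigrationMean α p G L (fun x => θ * f x) s := by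
      rw [hscale σ t ht, processMean, mul_add, ← intervalIntegral.integral_const_mul]
      congr 1
      refine intervalIntegral.integral_congr fun s hs => ?_
      rw [Set.uIcc_of_le ht] at hs
      simp only [immigrationMean, hscale _ s hs.1, integral_const_mul]
    rw [hpm]
  · exact add_le_add (pairing_mono hui hmi fun x hx => hu.le_mean hd h hm ht hx)
      (intervalIntegral.integral_mono_on ht hiψ hiI fun s hs => (himm s hs.1).1)
  · have e1 : pairing σ.toM (meanSemigroup α p G (fun x => θ * f x) t) -
        pairing σ.toM (cumulant α p G (fun x => θ * f x) t) ≤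
          C₂ * (θ * A) ^ 2 * expWeight c σ := by
      have h1 : pairing σ.toM (meanSemigroup α p G (fun x => θ * f x) t) -
          pairing σ.toM (cumulant α p G (fun x => θ * f x) t) =
          pairing σ.toM fun x => meanSemigroup α p G (fun x => θ * f x) t x -
            cumulant α p G (fun x => θ * f x) t x := by
        unfold pairing; rw [integral_sub hmi hui]
      have h2 : C₂ * (θ * A) ^ 2 * expWeight c σ =
          pairing σ.toM fun x => C₂ * (θ * A) ^ 2 * Real.exp (c * x) :=
        (integral_const_mul _ _).symm
      rw [h1, h2]
      refine pairing_mono (hmi.sub hui) ((σ.integrable_exp c hc.le).const_mul _) fun x hx =>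
        (hC₂ _ _ hθf hθf0 hθA hθfA t x ht hx).trans ?_
      gcongr
      linarith
    have e2 : (∫ s in (0 : ℝ)..t, immigrationMean α p G L (fun x => θ * f x) s) -
        ∫ s in (0 : ℝ)..t, immigration L (cumulant α p G (fun x => θ * f x) s) ≤
          C₃ * (θ * A) ^ 2 * (1 / c) := by
      rw [← intervalIntegral.integral_sub hiI hiψ]
      calc _ ≤ ∫ s in (0 : ℝ)..t, C₃ * (θ * A) ^ 2 * Real.exp (-(c * s)) := by
            refine intervalIntegral.integral_mono_on ht (hiI.sub hiψ)
              (Continuous.intervalIntegrable (by fun_prop) _ _) fun s hs => ?_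
            have := (himm s hs.1).2
            rw [← hg₀, ← hC₃] at this
            linarith
        _ ≤ _ := by
            rw [intervalIntegral.integral_const_mul]
            gcongr
            exact integral_exp_neg_le hc ht
    have e3 : θ ^ 2 * (V * A ^ 2) = C₂ * (θ * A) ^ 2 * expWeight c σ +
        C₃ * (θ * A) ^ 2 * (1 / c) := by rw [hV]; ring
    rw [e3]
    linarith

end AgeBranching

/-! ### Joint measurability and two-time laws of the process -/

namespace AgeBranching

variable {Ω : Type*} {mΩ : MeasurableSpace Ω} {Pr : Measure Ω} {ℱ : Filtration ℝ≥0 mΩ}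
  {α : ℝ → ℝ} {p : ℝ → ℕ → ℝ} {G : Measure Pos} {L : Measure PopMeasure} {σ : PopMeasure}
  {Y : ℝ≥0 → Ω → PopMeasure}

lemma IsProcess.measurable (hY : IsProcess Pr ℱ α p G L σ Y) (t : ℝ≥0) : Measurable (Y t) :=
  (hY.adapted t).mono (ℱ.le t) le_rfl

/-- The index of the cell of mesh `1 / (k + 1)` that contains `s`. -/
noncomputable def cellIndex (k : ℕ) (s : ℝ≥0) : ℕ := ⌊s * (k + 1)⌋₊

/-- The right end point of the `n`-th cell of mesh `1 / (k + 1)`. -/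
noncomputable def gridPoint (k n : ℕ) : ℝ≥0 := ((n : ℝ≥0) + 1) / (k + 1)

lemma measurable_cellIndex (k : ℕ) : Measurable (cellIndex k) :=
  (measurable_id.mul_const ((k : ℝ≥0) + 1)).nat_floor

lemma measurable_comp_countable {E T : Type*} [MeasurableSpace E] [MeasurableSpace T]
    {Z : T → Ω → E} (hm : ∀ t, Measurable (Z t)) (g : ℕ → T) {a : T → ℕ} (ha : Measurable a) :
    Measurable fun q : T × Ω => Z (g (a q.1)) q.2 := by
  have h2 : Measurable fun z : ℕ × Ω => Z (g z.1) z.2 :=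
    measurable_from_prod_countable_right fun n => hm (g n)
  exact h2.comp ((ha.comp measurable_fst).prodMk measurable_snd)

/-- The approximation is from the right, the side on which the paths are continuous. -/
lemma tendsto_upper_grid (s : ℝ≥0) :
    Tendsto (fun k : ℕ => gridPoint k (cellIndex k s)) atTop (𝓝[≥] s) := by
  have hpos : ∀ k : ℕ, (0 : ℝ≥0) < k + 1 := fun k => by positivity
  have h1 : ∀ k : ℕ, s ≤ gridPoint k (cellIndex k s) := fun k => by
    rw [gridPoint, cellIndex, le_div_iff₀ (hpos k)]
    exact (Nat.lt_floor_add_one _).le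
  have h2 : ∀ k : ℕ, gridPoint k (cellIndex k s) ≤ s + 1 / (k + 1) := fun k => by
    rw [gridPoint, cellIndex, div_le_iff₀ (hpos k), add_mul, one_div, inv_mul_cancel₀ (hpos k).ne']
    gcongr
    exact Nat.floor_le (by positivity)
  refine tendsto_nhdsWithin_iff.2 ⟨?_, Eventually.of_forall h1⟩
  refine tendsto_of_tendsto_of_tendsto_of_le_of_le tendsto_const_nhds ?_ h1 h2
  have : Tendsto (fun k : ℕ => s + 1 / ((k : ℝ≥0) + 1)) atTop (𝓝 (s + 0)) :=
    tendsto_const_nhds.add tendsto_one_div_add_atTop_nhds_zero_nat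
  simpa using this

/-- A right-continuous population-valued process is jointly measurable. -/
lemma measurable_uncurry_of_rightContinuous (hm : ∀ t, Measurable (Y t))
    (hc : ∀ ω t, ContinuousWithinAt (fun s => Y s ω) (Set.Ici t) t) :
    Measurable (Function.uncurry Y) := by
  have h1 : ∀ φ : BoundedContinuousFunction Pos ℝ≥0,
      Measurable fun q : ℝ≥0 × Ω => ∫⁻ x, φ x ∂(Y q.1 q.2).toM := by
    intro φ
    have hφ : Measurable fun x : Pos => (φ x : ℝ≥0∞) := φ.continuous.measurable.coe_nnreal_ennreal
    have hev : Measurable fun ν : PopMeasure => ∫⁻ x, φ x ∂ν.toM :=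
      (Measure.measurable_lintegral hφ).comp PopMeasure.measurable_toM
    -- Evaluation at grid points involves countably many times only, hence is jointly measurable;
    -- right continuity gives convergence when tested against bounded continuous φ.
    refine measurable_of_tendsto_metrizable
      (f := fun (k : ℕ) (q : ℝ≥0 × Ω) =>
        ∫⁻ x, φ x ∂(Y (gridPoint k (cellIndex k q.1)) q.2).toM) (fun k => ?_) ?_
    · exact measurable_comp_countable (Z := fun t ω => ∫⁻ x, φ x ∂(Y t ω).toM)
        (fun t => hev.comp (hm t)) (gridPoint k) (measurable_cellIndex k)
    · refine tendsto_pi_nhds.2 fun q => ?_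
      have h4 : Tendsto (fun k : ℕ => (Y (gridPoint k (cellIndex k q.1)) q.2).1) atTop
          (𝓝 (Y q.1 q.2).1) :=
        (continuous_subtype_val.tendsto _).comp ((hc q.2 q.1).tendsto.comp (tendsto_upper_grid q.1))
      exact FiniteMeasure.tendsto_iff_forall_lintegral_tendsto.1 h4 φ
  have h2 : Measurable fun q : ℝ≥0 × Ω => (Y q.1 q.2).toM := by
    -- Indicators of closed sets are limits of bounded continuous functions, and closed sets form a
    -- π-system generating the Borel sets.
    refine Measurable.measure_of_isPiSystem (S := {s : Set Pos | IsClosed s})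
      (by rw [BorelSpace.measurable_eq (α := Pos), borel_eq_generateFrom_isClosed])
      isPiSystem_isClosed (fun F hF => ?_) ?_
    · have hF' : IsClosed F := hF
      exact measurable_of_tendsto_metrizable (fun n => h1 (hF'.apprSeq n))
        (tendsto_pi_nhds.2 fun q => HasOuterApproxClosed.tendsto_lintegral_apprSeq hF' _)
    · have := h1 1
      simpa using this
  refine Measurable.subtype_mk (Measurable.subtype_mk ?_)
  exact h2

/-- The joint law of the process at times `s` and `s + t`. -/
lemma map_prod_eq_compProd [IsProbabilityMeasure Pr] (hY : IsProcess Pr ℱ α p G L σ Y)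
    {P : ℝ≥0 → Kernel PopMeasure PopMeasure} (hP : IsTransition α p G L P)
    (hM : ∀ (s t : ℝ≥0) (F : PopMeasure → ℝ), Measurable F → (∃ C : ℝ, ∀ ν, |F ν| ≤ C) →
      Pr[fun ω => F (Y (s + t) ω) | ℱ s] =ᵐ[Pr] fun ω => ∫ ν, F ν ∂(P t (Y s ω))) (s t : ℝ≥0) :
    Pr.map (fun ω => (Y s ω, Y (s + t) ω)) = (Pr.map (Y s)) ⊗ₘ (P t) := by
  have := hP.1 t
  have hs := hY.measurable s
  have ht := hY.measurable (s + t)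
  have : IsProbabilityMeasure (Pr.map (Y s)) := Measure.isProbabilityMeasure_map hs.aemeasurable
  have : IsProbabilityMeasure (Pr.map fun ω => (Y s ω, Y (s + t) ω)) :=
    Measure.isProbabilityMeasure_map (hs.prodMk ht).aemeasurable
  refine Measure.ext_prod fun {A B} hA hB => ?_
  rw [Measure.compProd_apply_prod hA hB, Measure.map_apply (hs.prodMk ht) (hA.prod hB),
    setLIntegral_map hA (Kernel.measurable_coe _ hB) hs]
  have hF : Measurable (B.indicator fun _ => (1 : ℝ)) := measurable_const.indicator hB
  have hFb : ∀ ν, |B.indicator (fun _ => (1 : ℝ)) ν| ≤ 1 := fun ν => by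
    by_cases h : ν ∈ B <;> simp [h]
  have h1 := hM s t _ hF ⟨1, hFb⟩
  have hFi : Integrable (fun ω => B.indicator (fun _ => (1 : ℝ)) (Y (s + t) ω)) Pr :=
    Integrable.of_bound (hF.comp ht).aestronglyMeasurable 1 (Eventually.of_forall fun ω => hFb _)
  have hAm : MeasurableSet[ℱ s] (Y s ⁻¹' A) := hY.adapted s hA
  have h2 := setIntegral_condExp (ℱ.le s) hFi hAm
  rw [setIntegral_congr_ae (ℱ.le s _ hAm) (h1.mono fun ω hω _ => hω)] at h2
  have h3 : ∀ ω, ∫ ν, B.indicator (fun _ => (1 : ℝ)) ν ∂(P t (Y s ω)) = (P t (Y s ω)).real B :=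
    fun ω => integral_indicator_one hB
  simp only [h3] at h2
  have h4 : ∫ ω in Y s ⁻¹' A, B.indicator (fun _ => (1 : ℝ)) (Y (s + t) ω) ∂Pr =
      Pr.real (Y s ⁻¹' A ∩ Y (s + t) ⁻¹' B) := by
    have : (fun ω => B.indicator (fun _ => (1 : ℝ)) (Y (s + t) ω)) =
        (Y (s + t) ⁻¹' B).indicator fun _ => (1 : ℝ) := rfl
    rw [this, setIntegral_indicator (ht hB)]
    simp
  rw [h4] at h2
  have h5 : ∫⁻ ω in Y s ⁻¹' A, P t (Y s ω) B ∂Pr =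
      ENNReal.ofReal (∫ ω in Y s ⁻¹' A, (P t (Y s ω)).real B ∂Pr) := by
    rw [ofReal_integral_eq_lintegral_ofReal]
    · exact lintegral_congr fun ω => (ofReal_measureReal (measure_ne_top _ _)).symm
    · refine Integrable.of_bound
        (((Kernel.measurable_coe (P t) hB).comp hs).ennreal_toReal).aestronglyMeasurable 1
        (Eventually.of_forall fun ω => ?_)
      rw [Real.norm_eq_abs, abs_of_nonneg measureReal_nonneg]
      exact measureReal_le_one
    · exact Eventually.of_forall fun ω => measureReal_nonneg
  rw [h5, h2, ofReal_measureReal (measure_ne_top _ _)]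
  rfl

lemma map_eq_transition [IsProbabilityMeasure Pr] (hY : IsProcess Pr ℱ α p G L σ Y)
    {P : ℝ≥0 → Kernel PopMeasure PopMeasure} (hP : IsTransition α p G L P)
    (hM : ∀ (s t : ℝ≥0) (F : PopMeasure → ℝ), Measurable F → (∃ C : ℝ, ∀ ν, |F ν| ≤ C) →
      Pr[fun ω => F (Y (s + t) ω) | ℱ s] =ᵐ[Pr] fun ω => ∫ ν, F ν ∂(P t (Y s ω))) (t : ℝ≥0) :
    Pr.map (Y t) = P t σ := by
  have := hP.1 t
  have h0 := hY.measurable 0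
  have : IsProbabilityMeasure (Pr.map (Y 0)) := Measure.isProbabilityMeasure_map h0.aemeasurable
  have h1 := map_prod_eq_compProd hY hP hM 0 t
  rw [zero_add] at h1
  ext B hB
  have h2 := congrArg (fun μ => μ (Set.univ ×ˢ B)) h1
  simp only [Measure.compProd_apply_prod MeasurableSet.univ hB,
    Measure.map_apply (h0.prodMk (hY.measurable t)) (MeasurableSet.univ.prod hB),
    Measure.restrict_univ, lintegral_map (Kernel.measurable_coe (P t) hB) h0] at h2
  rw [lintegral_congr_ae (g := fun _ => P t σ B) (hY.start.mono fun ω hω => by simp only [hω])]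
    at h2
  rw [Measure.map_apply (hY.measurable t) hB]
  simpa [Set.mk_preimage_prod] using h2

end AgeBranching

/-! ### The limiting mean and exponential decay of correlations -/

namespace AgeBranching

lemma abs_mul_le_sq_add_sq (x y : ℝ) : |x * y| ≤ x ^ 2 + y ^ 2 :=
  abs_le.2 ⟨by nlinarith [sq_nonneg (x + y), sq_nonneg x, sq_nonneg y],
    by nlinarith [sq_nonneg (x - y), sq_nonneg x, sq_nonneg y]⟩

lemma integrableOn_exp_neg {c : ℝ} (hc : 0 < c) (t : ℝ) :
    IntegrableOn (fun s => Real.exp (-(c * s))) (Set.Ioi t) := by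
  have := integrableOn_exp_mul_Ioi (a := -c) (by linarith) t
  simpa only [neg_mul] using this

lemma integral_exp_neg_Ioi_eq {c : ℝ} (hc : 0 < c) (t : ℝ) :
    ∫ s in Set.Ioi t, Real.exp (-(c * s)) = Real.exp (-(c * t)) / c := by
  have := integral_exp_mul_Ioi (a := -c) (by linarith) t
  simpa only [neg_mul, neg_div_neg_eq] using this

lemma integrableOn_of_exp_decay {b : ℝ → ℝ} {C c : ℝ} (hc : 0 < c) (hb : Measurable b)
    (hle : ∀ s, 0 < s → |b s| ≤ C * Real.exp (-(c * s))) : IntegrableOn b (Set.Ioi 0) :=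
  ((integrableOn_exp_neg hc 0).const_mul C).mono' hb.aestronglyMeasurable
    ((ae_restrict_mem measurableSet_Ioi).mono fun s hs => hle s hs)

lemma abs_integral_sub_integral_Ioi_le {b : ℝ → ℝ} {C c : ℝ} (hc : 0 < c) (hb : Measurable b)
    (hle : ∀ s, 0 < s → |b s| ≤ C * Real.exp (-(c * s))) {t : ℝ} (ht : 0 ≤ t) :
    |(∫ s in (0 : ℝ)..t, b s) - ∫ s in Set.Ioi (0 : ℝ), b s| ≤ C / c * Real.exp (-(c * t)) := by
  have hi := integrableOn_of_exp_decay hc hb hle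
  have h1 : ∫ s in Set.Ioi (0 : ℝ), b s = (∫ s in (0 : ℝ)..t, b s) + ∫ s in Set.Ioi t, b s := by
    rw [intervalIntegral.integral_of_le ht, ← Set.Ioc_union_Ioi_eq_Ioi ht]
    refine setIntegral_union (Set.Ioc_disjoint_Ioi le_rfl) measurableSet_Ioi
      (hi.mono_set Set.Ioc_subset_Ioi_self) (hi.mono_set (Set.Ioi_subset_Ioi ht))
  rw [h1, sub_add_cancel_left, abs_neg]
  have h2 : ‖∫ s in Set.Ioi t, b s‖ ≤ ∫ s in Set.Ioi t, C * Real.exp (-(c * s)) :=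
    norm_integral_le_of_norm_le ((integrableOn_exp_neg hc t).const_mul C)
      ((ae_restrict_mem measurableSet_Ioi).mono fun s hs => hle s (lt_of_le_of_lt ht hs))
  rw [integral_const_mul, integral_exp_neg_Ioi_eq hc] at h2
  exact h2.trans (le_of_eq (by ring))

variable {α : ℝ → ℝ} {p : ℝ → ℕ → ℝ} {G : Measure Pos} {c κ K : ℝ} [IsProbabilityMeasure G]
  {L : Measure PopMeasure} {f : ℝ → ℝ} {A : ℝ}

lemma SubcriticalKernel.integrableOn_mean (h : SubcriticalKernel (birthRate α p) G c κ K)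
    (hf : BddBorel f) (hf0 : ∀ x, 0 ≤ f x) (hA : 0 ≤ A)
    (hfA : ∀ x, 0 < x → f x ≤ A * Real.exp (c * x)) {x : ℝ} (hx : 0 < x) :
    IntegrableOn (fun s => meanSemigroup α p G f s x) (Set.Ioi 0) := by
  refine integrableOn_of_exp_decay (C := growthConst G c κ K * A * Real.exp (c * x)) h.c_pos
    ((h.solvesMean hf).measurable.comp (measurable_id.prodMk measurable_const)) fun s hs => ?_
  exact (h.abs_mean_le hf hf0 hA hfA hs.le hx).trans (le_of_eq (by ring))

lemma SubcriticalKernel.measurable_totalMean (h : SubcriticalKernel (birthRate α p) G c κ K)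
    (hf : BddBorel f) : Measurable (totalMean α p G f) := by
  have h1 : Measurable fun q : ℝ × ℝ => meanSemigroup α p G f q.2 q.1 :=
    (h.solvesMean hf).measurable.comp measurable_swap
  exact h1.stronglyMeasurable.integral_prod_right.measurable

lemma SubcriticalKernel.abs_totalMean_le (h : SubcriticalKernel (birthRate α p) G c κ K)
    (hf : BddBorel f) (hf0 : ∀ x, 0 ≤ f x) (hA : 0 ≤ A)
    (hfA : ∀ x, 0 < x → f x ≤ A * Real.exp (c * x)) {x : ℝ} (hx : 0 < x) :
    |totalMean α p G f x| ≤ growthConst G c κ K * A / c * Real.exp (c * x) := by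
  have h2 : ‖∫ s in Set.Ioi (0 : ℝ), meanSemigroup α p G f s x‖ ≤
      ∫ s in Set.Ioi (0 : ℝ), growthConst G c κ K * A * Real.exp (c * x) * Real.exp (-(c * s)) :=
    norm_integral_le_of_norm_le ((integrableOn_exp_neg h.c_pos 0).const_mul _)
      ((ae_restrict_mem measurableSet_Ioi).mono fun s hs =>
        (h.abs_mean_le hf hf0 hA hfA (le_of_lt hs) hx).trans (le_of_eq (by ring)))
  rw [integral_const_mul, integral_exp_neg_Ioi_eq h.c_pos] at h2
  exact h2.trans (le_of_eq (by simp; ring))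

lemma SubcriticalKernel.integrable_totalMean (h : SubcriticalKernel (birthRate α p) G c κ K)
    (hf : BddBorel f) (hf0 : ∀ x, 0 ≤ f x) (hA : 0 ≤ A)
    (hfA : ∀ x, 0 < x → f x ≤ A * Real.exp (c * x)) (ν : PopMeasure) :
    Integrable (fun x : Pos => totalMean α p G f x) ν.toM :=
  ν.integrable_of_le_exp h.c_pos.le (h.measurable_totalMean hf)
    fun _ hx => h.abs_totalMean_le hf hf0 hA hfA hx

lemma SubcriticalKernel.integrable_pairing_totalMean
    (h : SubcriticalKernel (birthRate α p) G c κ K)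
    (hf : BddBorel f) (hf0 : ∀ x, 0 ≤ f x) (hA : 0 ≤ A)
    (hfA : ∀ x, 0 < x → f x ≤ A * Real.exp (c * x)) (hW : Integrable (expWeight c) L) :
    Integrable (fun ν : PopMeasure => pairing ν.toM (totalMean α p G f)) L :=
  (hW.const_mul (growthConst G c κ K * A / c)).mono'
    (measurable_pairing (h.measurable_totalMean hf)).aestronglyMeasurable
    (Eventually.of_forall fun ν => ν.abs_pairing_le h.c_pos.le
      fun _ hx => h.abs_totalMean_le hf hf0 hA hfA hx)

lemma SubcriticalKernel.pairing_totalMean (h : SubcriticalKernel (birthRate α p) G c κ K)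
    (hf : BddBorel f) (hf0 : ∀ x, 0 ≤ f x) (hA : 0 ≤ A)
    (hfA : ∀ x, 0 < x → f x ≤ A * Real.exp (c * x)) (ν : PopMeasure) :
    pairing ν.toM (totalMean α p G f) =
      ∫ s in Set.Ioi (0 : ℝ), pairing ν.toM (meanSemigroup α p G f s) := by
  unfold pairing totalMean
  refine integral_integral_swap ?_
  have h1 : Measurable fun q : Pos × ℝ => meanSemigroup α p G f q.2 q.1 :=
    (h.solvesMean hf).measurable.comp
      (measurable_snd.prodMk (measurable_subtype_coe.comp measurable_fst))
  refine (((ν.integrable_exp c h.c_pos.le).const_mul (growthConst G c κ K * A)).mul_prod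
    (integrableOn_exp_neg h.c_pos 0)).mono' h1.aestronglyMeasurable ?_
  have h2 : ∀ᵐ q ∂(ν.toM.prod (volume.restrict (Set.Ioi (0 : ℝ)))), q.2 ∈ Set.Ioi (0 : ℝ) :=
    Measure.quasiMeasurePreserving_snd.ae (ae_restrict_mem measurableSet_Ioi)
  filter_upwards [h2] with q hq
  exact (h.abs_mean_le hf hf0 hA hfA (le_of_lt hq) q.1.2).trans (le_of_eq (by ring))

/-- Fubini, dominated by the weight of ν times e^{-cs}. It identifies the constant in the theorem as
the limit of the immigration part of the process mean. -/
lemma SubcriticalKernel.integral_pairing_totalMean [SFinite L]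
    (h : SubcriticalKernel (birthRate α p) G c κ K)
    (hf : BddBorel f) (hf0 : ∀ x, 0 ≤ f x) (hA : 0 ≤ A)
    (hfA : ∀ x, 0 < x → f x ≤ A * Real.exp (c * x)) (hW : Integrable (expWeight c) L) :
    ∫ ν, pairing ν.toM (totalMean α p G f) ∂L =
      ∫ s in Set.Ioi (0 : ℝ), immigrationMean α p G L f s := by
  simp only [h.pairing_totalMean hf hf0 hA hfA]
  refine integral_integral_swap ?_
  have h1 : Measurable fun q : PopMeasure × ℝ => pairing q.1.toM (meanSemigroup α p G f q.2) :=
    (measurable_pairing_prod (h.solvesMean hf).measurable).comp measurable_swap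
  refine ((hW.const_mul (growthConst G c κ K * A)).mul_prod
    (integrableOn_exp_neg h.c_pos 0)).mono' h1.aestronglyMeasurable ?_
  have h2 : ∀ᵐ q ∂(L.prod (volume.restrict (Set.Ioi (0 : ℝ)))), q.2 ∈ Set.Ioi (0 : ℝ) :=
    Measure.quasiMeasurePreserving_snd.ae (ae_restrict_mem measurableSet_Ioi)
  filter_upwards [h2] with q hq
  rw [Function.uncurry, Real.norm_eq_abs, abs_of_nonneg (h.pairing_mean_nonneg hf hf0 (le_of_lt hq) q.1)]
  exact (h.pairing_mean_le hf hf0 hA hfA (le_of_lt hq) q.1).trans (le_of_eq (by ring))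

lemma SubcriticalKernel.abs_integral_immigrationMean_sub_le [SFinite L]
    (h : SubcriticalKernel (birthRate α p) G c κ K)
    (hf : BddBorel f) (hf0 : ∀ x, 0 ≤ f x) (hA : 0 ≤ A)
    (hfA : ∀ x, 0 < x → f x ≤ A * Real.exp (c * x)) (hW : Integrable (expWeight c) L) {t : ℝ}
    (ht : 0 ≤ t) : |(∫ s in (0 : ℝ)..t, immigrationMean α p G L f s) -
      ∫ ν, pairing ν.toM (totalMean α p G f) ∂L| ≤
        growthConst G c κ K * A * (∫ ν, expWeight c ν ∂L) / c * Real.exp (-(c * t)) := by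
  rw [h.integral_pairing_totalMean hf hf0 hA hfA hW]
  refine abs_integral_sub_integral_Ioi_le h.c_pos (h.measurable_immigrationMean hf)
    (fun s hs => ?_) ht
  rw [abs_of_nonneg (h.immigrationMean_nonneg hf hf0 hs.le)]
  exact h.immigrationMean_le hf hf0 hA hfA hW hs.le

/-- Cutting off (-∞, 0] turns π_t f into an admissible test function without changing pairings, so
that the moment bounds can be applied to it. -/
lemma BddBorel.truncated_mean (h : SubcriticalKernel (birthRate α p) G c κ K) (hf : BddBorel f)
    {t : ℝ} (ht : 0 ≤ t) : BddBorel ((Set.Ioi 0).indicator (meanSemigroup α p G f t)) := by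
  have hm := h.solvesMean hf
  obtain ⟨B, hB⟩ := hm.locBdd t
  refine ⟨(hm.measurable_section t).indicator measurableSet_Ioi, ⟨B, fun x => ?_⟩, fun x hx => ?_⟩
  · by_cases hx : x ∈ Set.Ioi (0 : ℝ)
    · rw [Set.indicator_of_mem hx]; exact hB t x ht le_rfl hx
    · rw [Set.indicator_of_notMem hx, abs_zero]
      exact (abs_nonneg _).trans (hB t 1 ht le_rfl one_pos)
  · exact Set.indicator_of_notMem (not_lt.2 hx) _

variable {Ω : Type*} {mΩ : MeasurableSpace Ω} {Pr : Measure Ω} {ℱ : Filtration ℝ≥0 mΩ}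
  {σ : PopMeasure} {Y : ℝ≥0 → Ω → PopMeasure}

/-- Exponential decay of the correlations of `⟨Y_s, f⟩` around its limiting mean. -/
theorem exists_correlation_bound [IsProbabilityMeasure Pr] [IsFiniteMeasure L]
    (hd : BranchingData α p) (hg2 : BddSecondMoment p)
    (h : SubcriticalKernel (birthRate α p) G c κ K)
    (hW : Integrable (expWeight c) L) (hW2 : Integrable (fun ν => expWeight c ν ^ 2) L)
    (hY : IsProcess Pr ℱ α p G L σ Y) (hf : BddBorel f) (hf0 : ∀ x, 0 ≤ f x) :
    ∃ C : ℝ, 0 ≤ C ∧ ∀ s : ℝ≥0,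
      Integrable (fun ω => (pairing (Y s ω).toM f -
        ∫ ν, pairing ν.toM (totalMean α p G f) ∂L) ^ 2) Pr ∧
      ∀ t : ℝ≥0, ∫ ω, (pairing (Y s ω).toM f - ∫ ν, pairing ν.toM (totalMean α p G f) ∂L) *
        (pairing (Y (s + t) ω).toM f - ∫ ν, pairing ν.toM (totalMean α p G f) ∂L) ∂Pr ≤
          C * Real.exp (-(c * t)) := by
  obtain ⟨A, hA'⟩ := hf.bounded
  have hA : 0 ≤ A := (abs_nonneg _).trans (hA' 0)
  have hc := h.c_pos
  have hfA : ∀ x, 0 < x → f x ≤ A * Real.exp (c * x) := fun x hx =>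
    ((le_abs_self _).trans (hA' x)).trans
      (le_mul_of_one_le_right hA (Real.one_le_exp (by positivity)))
  obtain ⟨P, hP, hM⟩ := hY.markov
  obtain ⟨M, hM0, hmom⟩ := exists_moment_bound hd hg2 h hW hW2 hP σ
  have htail := fun (t : ℝ) (ht : 0 ≤ t) =>
    h.abs_integral_immigrationMean_sub_le hf hf0 hA hfA hW ht
  set a := ∫ ν, pairing ν.toM (totalMean α p G f) ∂L
  set g₀ := growthConst G c κ K
  have hg : 1 ≤ g₀ := h.one_le_growthConst
  have hW0 : 0 ≤ ∫ ν, expWeight c ν ∂L := integral_nonneg fun ν => expWeight_nonneg c ν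
  set D := g₀ * A * (∫ ν, expWeight c ν ∂L) / c
  have hD0 : 0 ≤ D := by positivity
  have hlaw := fun t => map_eq_transition hY hP hM t
  have hfm : Measurable fun ν : PopMeasure => pairing ν.toM f := measurable_pairing hf.measurable
  have hprob : ∀ s, IsProbabilityMeasure (P s σ) := fun s => (hP.1 s).isProbabilityMeasure σ
  have hsqP : ∀ s, Integrable (fun ν => (pairing ν.toM f - a) ^ 2) (P s σ) := fun s => by
    obtain ⟨i1, -, i2, -⟩ := hmom f A hf hf0 hA hfA s
    have : (fun ν : PopMeasure => (pairing ν.toM f - a) ^ 2) =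
        fun ν => pairing ν.toM f ^ 2 - 2 * a * pairing ν.toM f + a ^ 2 := by
      funext ν; ring
    rw [this]
    exact (i2.sub (i1.const_mul _)).add (integrable_const _)
  have hsq : ∀ s, Integrable (fun ω => (pairing (Y s ω).toM f - a) ^ 2) Pr := fun s => by
    have h1 := hsqP s
    rw [← hlaw s] at h1
    exact h1.comp_measurable (hY.measurable s)
  refine ⟨M * A ^ 2 + a ^ 2 + (M * (g₀ * A) ^ 2 + D ^ 2), by positivity, fun s => ⟨hsq s, fun t => ?_⟩⟩
  have hmk := hP.1 t
  have ht : (0 : ℝ) ≤ t := t.2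
  set F : PopMeasure × PopMeasure → ℝ := fun q => (pairing q.1.toM f - a) * (pairing q.2.toM f - a)
    with hF
  have hFm : Measurable F :=
    ((hfm.comp measurable_fst).sub_const a).mul ((hfm.comp measurable_snd).sub_const a)
  have hpm : Measurable fun ω => (Y s ω, Y (s + t) ω) :=
    (hY.measurable s).prodMk (hY.measurable (s + t))
  have hFi : Integrable (fun ω => F (Y s ω, Y (s + t) ω)) Pr := by
    refine ((hsq s).add (hsq (s + t))).mono' (hFm.comp hpm).aestronglyMeasurable
      (Eventually.of_forall fun ω => ?_)
    exact abs_mul_le_sq_add_sq _ _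
  have hjoint := map_prod_eq_compProd hY hP hM s t
  rw [hlaw s] at hjoint
  have hFi' : Integrable F ((P s σ) ⊗ₘ (P t)) := by
    rw [← hjoint]
    exact (integrable_map_measure hFm.aestronglyMeasurable hpm.aemeasurable).2 hFi
  set I := ∫ r in (0 : ℝ)..t, immigrationMean α p G L f r
  set e := Real.exp (-(c * t)) with he
  have he0 : 0 < e := Real.exp_pos _
  set f' := (Set.Ioi 0).indicator (meanSemigroup α p G f t)
  have hf' : BddBorel f' := hf.truncated_mean h ht
  have hf'0 : ∀ x, 0 ≤ f' x := fun x =>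
    Set.indicator_nonneg (fun x hx => h.mean_nonneg hf hf0 ht hx) x
  have hf'A : ∀ x, 0 < x → f' x ≤ g₀ * A * e * Real.exp (c * x) := fun x hx => by
    have : f' x = meanSemigroup α p G f t x := Set.indicator_of_mem hx _
    rw [this]
    exact (le_abs_self _).trans (h.abs_mean_le hf hf0 hA hfA ht hx)
  have hpf' : ∀ ν : PopMeasure, pairing ν.toM (meanSemigroup α p G f t) = pairing ν.toM f' :=
    fun ν => pairing_congr fun x hx => (Set.indicator_of_mem (s := Set.Ioi (0 : ℝ)) hx _).symm
  obtain ⟨j1, -, j2, j3⟩ := hmom f' (g₀ * A * e) hf' hf'0 (by positivity) hf'A s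
  obtain ⟨-, -, i2, i3⟩ := hmom f A hf hf0 hA hfA s
  -- The mean formula with an arbitrary starting population ν, namely the state at time s.
  have hinner : ∀ ν, ∫ ν', F (ν, ν') ∂(P t ν) =
      (pairing ν.toM f - a) * (pairing ν.toM f' + (I - a)) := fun ν => by
    obtain ⟨_, _, hmomν⟩ := exists_moment_bound hd hg2 h hW hW2 hP ν
    obtain ⟨k1, k2, -, -⟩ := hmomν f A hf hf0 hA hfA t
    have : IsProbabilityMeasure (P t ν) := hmk.isProbabilityMeasure ν
    simp only [hF]
    rw [integral_const_mul, integral_sub k1 (integrable_const _), k2, processMean, hpf']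
    simp only [integral_const, probReal_univ, smul_eq_mul, one_mul]
    ring
  have hIa : (I - a) ^ 2 ≤ (D * e) ^ 2 := by
    rw [← sq_abs]
    exact pow_le_pow_left₀ (abs_nonneg _) (htail t ht) 2
  have hpt : ∀ ν : PopMeasure, (pairing ν.toM f - a) * (pairing ν.toM f' + (I - a)) ≤
      e * (pairing ν.toM f ^ 2 + a ^ 2) + e⁻¹ * (pairing ν.toM f' ^ 2 + (D * e) ^ 2) := fun ν => by
    -- Young's inequality weighted by e = e^{-ct}. The second factor is of size e in L², so e⁻¹
    -- times its square is again of order e, and both terms decay alike.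
    have hx : ∀ x y : ℝ, x * y ≤ e / 2 * x ^ 2 + e⁻¹ / 2 * y ^ 2 := fun x y => by
      have h1 : 0 ≤ (e * x - y) ^ 2 * (e⁻¹ / 2) := by positivity
      have h2 : (e * x - y) ^ 2 * (e⁻¹ / 2) =
          (e * e⁻¹) * e / 2 * x ^ 2 - (e * e⁻¹) * (x * y) + e⁻¹ / 2 * y ^ 2 := by ring
      rw [mul_inv_cancel₀ he0.ne'] at h2
      linarith
    refine (hx _ _).trans (add_le_add ?_ ?_)
    · have : (pairing ν.toM f - a) ^ 2 ≤ 2 * (pairing ν.toM f ^ 2 + a ^ 2) := by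
        nlinarith [sq_nonneg (pairing ν.toM f + a)]
      calc _ ≤ e / 2 * (2 * (pairing ν.toM f ^ 2 + a ^ 2)) := by gcongr
        _ = _ := by ring
    · have : (pairing ν.toM f' + (I - a)) ^ 2 ≤ 2 * (pairing ν.toM f' ^ 2 + (D * e) ^ 2) := by
        nlinarith [sq_nonneg (pairing ν.toM f' - (I - a))]
      calc _ ≤ e⁻¹ / 2 * (2 * (pairing ν.toM f' ^ 2 + (D * e) ^ 2)) := by gcongr
        _ = _ := by ring
  have q1 : Integrable (fun ν => e * (pairing ν.toM f ^ 2 + a ^ 2)) (P s σ) :=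
    (i2.add (integrable_const _)).const_mul _
  have q2 : Integrable (fun ν => e⁻¹ * (pairing ν.toM f' ^ 2 + (D * e) ^ 2)) (P s σ) :=
    (j2.add (integrable_const _)).const_mul _
  calc ∫ ω, F (Y s ω, Y (s + t) ω) ∂Pr = ∫ q, F q ∂((P s σ) ⊗ₘ (P t)) := by
        rw [← hjoint, integral_map hpm.aemeasurable hFm.aestronglyMeasurable]
    _ = ∫ ν, (pairing ν.toM f - a) * (pairing ν.toM f' + (I - a)) ∂(P s σ) := by
        rw [Measure.integral_compProd hFi']
        simp only [hinner]
    _ ≤ ∫ ν, (e * (pairing ν.toM f ^ 2 + a ^ 2) + e⁻¹ * (pairing ν.toM f' ^ 2 + (D * e) ^ 2))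
          ∂(P s σ) := by
        refine integral_mono ?_ (q1.add q2) hpt
        have h1 : Integrable (fun ν : PopMeasure => (pairing ν.toM f' + (I - a)) ^ 2) (P s σ) := by
          have : (fun ν : PopMeasure => (pairing ν.toM f' + (I - a)) ^ 2) = fun ν =>
              pairing ν.toM f' ^ 2 + 2 * (I - a) * pairing ν.toM f' + (I - a) ^ 2 := by
            funext ν; ring
          rw [this]
          exact (j2.add (j1.const_mul _)).add (integrable_const _)
        refine ((hsqP s).add h1).mono' ((hfm.sub_const a).mul
          ((measurable_pairing hf'.measurable).add_const (I - a))).aestronglyMeasurable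
          (Eventually.of_forall fun ν => ?_)
        exact abs_mul_le_sq_add_sq _ _
    _ = e * (∫ ν, pairing ν.toM f ^ 2 ∂(P s σ) + a ^ 2) +
          e⁻¹ * (∫ ν, pairing ν.toM f' ^ 2 ∂(P s σ) + (D * e) ^ 2) := by
        rw [integral_add q1 q2, integral_const_mul, integral_const_mul,
          integral_add i2 (integrable_const _), integral_add j2 (integrable_const _)]
        simp
    _ ≤ e * (M * A ^ 2 + a ^ 2) + e⁻¹ * (M * (g₀ * A * e) ^ 2 + (D * e) ^ 2) := by gcongr
    _ = (M * A ^ 2 + a ^ 2 + (M * (g₀ * A) ^ 2 + D ^ 2)) * e := by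
        have : e⁻¹ * (M * (g₀ * A * e) ^ 2 + (D * e) ^ 2) =
            (e⁻¹ * e) * ((M * (g₀ * A) ^ 2 + D ^ 2) * e) := by ring
        rw [this, inv_mul_cancel₀ he0.ne']
        ring

end AgeBranching

/-! ### A strong law from decaying correlations -/

namespace AgeBranching

/-- For n² ≤ t ≤ (n+1)² monotonicity squeezes Z t / t between the averages at both squares, up to
the factor (n/(n+1))² or its inverse, which tends to 1. -/
lemma tendsto_inv_mul_of_squares {Z : ℝ → ℝ} {a : ℝ} (hmono : MonotoneOn Z (Set.Ici 0))
    (h0 : ∀ t, 0 ≤ t → 0 ≤ Z t)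
    (hlim : Tendsto (fun n : ℕ => ((n : ℝ) ^ 2)⁻¹ * Z ((n : ℝ) ^ 2)) atTop (𝓝 a)) :
    Tendsto (fun t => t⁻¹ * Z t) atTop (𝓝 a) := by
  have hfloor : Tendsto (fun t : ℝ => ⌊Real.sqrt t⌋₊) atTop atTop :=
    tendsto_nat_floor_atTop.comp Real.tendsto_sqrt_atTop
  have hratio : Tendsto (fun n : ℕ => ((n : ℝ) / (n + 1)) ^ 2) atTop (𝓝 1) := by
    simpa using (tendsto_natCast_div_add_atTop (1 : ℝ)).pow 2
  have hlow : Tendsto (fun n : ℕ => ((n : ℝ) / (n + 1)) ^ 2 * (((n : ℝ) ^ 2)⁻¹ * Z ((n : ℝ) ^ 2)))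
      atTop (𝓝 a) := by simpa using hratio.mul hlim
  have hup : Tendsto (fun n : ℕ => (((n : ℝ) / (n + 1)) ^ 2)⁻¹ *
      ((((n + 1 : ℕ) : ℝ) ^ 2)⁻¹ * Z (((n + 1 : ℕ) : ℝ) ^ 2))) atTop (𝓝 a) := by
    simpa using (hratio.inv₀ one_ne_zero).mul (hlim.comp (tendsto_add_atTop_nat 1))
  refine tendsto_of_tendsto_of_tendsto_of_le_of_le' (hlow.comp hfloor) (hup.comp hfloor) ?_ ?_
  all_goals
    filter_upwards [eventually_ge_atTop (1 : ℝ)] with t ht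
    have ht0 : 0 ≤ t := by linarith
    have hs1 : 1 ≤ Real.sqrt t := Real.one_le_sqrt.2 ht
    have hsq : Real.sqrt t ^ 2 = t := Real.sq_sqrt ht0
    have hn1 : 1 ≤ ⌊Real.sqrt t⌋₊ := Nat.one_le_floor_iff _ |>.2 hs1
    have hnle : (⌊Real.sqrt t⌋₊ : ℝ) ≤ Real.sqrt t := Nat.floor_le (Real.sqrt_nonneg t)
    have hnlt : Real.sqrt t ≤ (⌊Real.sqrt t⌋₊ : ℝ) + 1 := (Nat.lt_floor_add_one _).le
    simp only [Function.comp]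
    generalize ⌊Real.sqrt t⌋₊ = n at *
    have hn : (0 : ℝ) < n := by exact_mod_cast hn1
    have h1 : (n : ℝ) ^ 2 ≤ t := by rw [← hsq]; exact pow_le_pow_left₀ hn.le hnle 2
    have h2 : t ≤ ((n : ℝ) + 1) ^ 2 := by
      rw [← hsq]; exact pow_le_pow_left₀ (Real.sqrt_nonneg t) hnlt 2
  · have e : ((n : ℝ) / (n + 1)) ^ 2 * (((n : ℝ) ^ 2)⁻¹ * Z ((n : ℝ) ^ 2)) =
        (((n : ℝ) + 1) ^ 2)⁻¹ * Z ((n : ℝ) ^ 2) := by field_simp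
    rw [e]
    exact mul_le_mul (inv_anti₀ (by linarith) h2)
      (hmono (Set.mem_Ici.2 (by positivity)) (Set.mem_Ici.2 ht0) h1) (h0 _ (by positivity))
      (by positivity)
  · have e : (((n : ℝ) / (n + 1)) ^ 2)⁻¹ * ((((n + 1 : ℕ) : ℝ) ^ 2)⁻¹ * Z (((n + 1 : ℕ) : ℝ) ^ 2)) =
        ((n : ℝ) ^ 2)⁻¹ * Z (((n : ℝ) + 1) ^ 2) := by push_cast; field_simp
    rw [e]
    exact mul_le_mul (inv_anti₀ (by positivity) h1)
      (hmono (Set.mem_Ici.2 ht0) (Set.mem_Ici.2 (by positivity)) h2) (h0 _ ht0) (by positivity)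

/-- The series of the g n has finite integral, hence converges almost everywhere, and its terms tend
to 0. This takes the place of Chebyshev and Borel–Cantelli. -/
lemma ae_tendsto_zero_of_summable {S : Type*} [MeasurableSpace S] {μ : Measure S}
    {g : ℕ → S → ℝ} {B : ℕ → ℝ} (hg0 : ∀ n q, 0 ≤ g n q) (hg : ∀ n, Integrable (g n) μ)
    (hle : ∀ n, ∫ q, g n q ∂μ ≤ B n) (hB : Summable B) :
    ∀ᵐ q ∂μ, Tendsto (fun n => g n q) atTop (𝓝 0) := by
  have h1 : ∫⁻ q, ∑' n, ENNReal.ofReal (g n q) ∂μ ≠ ⊤ := by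
    rw [lintegral_tsum fun n => (hg n).aemeasurable.ennreal_ofReal]
    have hB0 : ∀ n, 0 ≤ B n := fun n => (integral_nonneg (hg0 n)).trans (hle n)
    refine ne_top_of_le_ne_top (hB.tsum_ofReal_ne_top) (ENNReal.tsum_le_tsum fun n => ?_)
    rw [← ofReal_integral_eq_lintegral_ofReal (hg n) (Eventually.of_forall (hg0 n))]
    exact ENNReal.ofReal_le_ofReal (hle n)
  have h2 := ae_lt_top' (AEMeasurable.tsum
    fun n => (hg n).aemeasurable.ennreal_ofReal) h1
  filter_upwards [h2] with q hq
  have h3 := ENNReal.tendsto_atTop_zero_of_tsum_ne_top hq.ne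
  have h4 := (ENNReal.tendsto_toReal ENNReal.zero_ne_top).comp h3
  refine h4.congr fun n => ?_
  simp [ENNReal.toReal_ofReal (hg0 n q)]

lemma integrable_exp_neg_abs {c : ℝ} (hc : 0 < c) :
    Integrable fun r : ℝ => Real.exp (-(c * |r|)) := by
  rw [← integrableOn_univ, ← Set.Iic_union_Ioi (a := (0 : ℝ))]
  refine IntegrableOn.union ?_ ?_
  · refine (integrableOn_exp_mul_Iic hc 0).congr_fun (fun r hr => ?_) measurableSet_Iic
    simp only [abs_of_nonpos (Set.mem_Iic.1 hr)]
    ring_nf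
  · refine (integrableOn_exp_neg hc 0).congr_fun (fun r hr => ?_) measurableSet_Ioi
    simp only [abs_of_pos (Set.mem_Ioi.1 hr)]

section Ergodic

variable {Ω : Type*} {mΩ : MeasurableSpace Ω} {Pr : Measure Ω} [IsProbabilityMeasure Pr]
  {ξ : ℝ → Ω → ℝ} {C c : ℝ}

lemma integrable_prod_of_sq_bound (hξ : Measurable (Function.uncurry ξ))
    (hsq : ∀ s, 0 ≤ s → Integrable (fun ω => ξ s ω ^ 2) Pr)
    (hC : ∀ s, 0 ≤ s → ∫ ω, ξ s ω ^ 2 ∂Pr ≤ C) (T : ℝ) :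
    Integrable (Function.uncurry ξ) ((volume.restrict (Set.Ioc 0 T)).prod Pr) := by
  rw [integrable_prod_iff hξ.aestronglyMeasurable]
  have hle : ∀ s ω, ‖ξ s ω‖ ≤ 1 + ξ s ω ^ 2 := fun s ω => by
    rw [Real.norm_eq_abs]
    nlinarith [sq_abs (ξ s ω), sq_nonneg (|ξ s ω| - 1), abs_nonneg (ξ s ω)]
  have hi : ∀ s, 0 ≤ s → Integrable (fun ω => 1 + ξ s ω ^ 2) Pr := fun s hs =>
    (integrable_const _).add (hsq s hs)
  have hξi : ∀ s, 0 ≤ s → Integrable (fun ω => ξ s ω) Pr := fun s hs =>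
    (hi s hs).mono' (hξ.comp (measurable_const.prodMk measurable_id)).aestronglyMeasurable
      (Eventually.of_forall (hle s))
  have hmem : ∀ᵐ s ∂(volume.restrict (Set.Ioc 0 T)), s ∈ Set.Ioc 0 T :=
    ae_restrict_mem measurableSet_Ioc
  refine ⟨hmem.mono fun s hs => hξi s hs.1.le, ?_⟩
  refine Integrable.of_bound (hξ.norm.stronglyMeasurable.integral_prod_right').aestronglyMeasurable
    (1 + C) (hmem.mono fun s hs => ?_)
  rw [Real.norm_eq_abs, abs_of_nonneg (integral_nonneg fun ω => norm_nonneg _)]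
  calc ∫ ω, ‖ξ s ω‖ ∂Pr ≤ ∫ ω, (1 + ξ s ω ^ 2) ∂Pr :=
        integral_mono (hξi s hs.1.le).norm (hi s hs.1.le) (hle s)
    _ = 1 + ∫ ω, ξ s ω ^ 2 ∂Pr := by
        rw [integral_add (integrable_const _) (hsq s hs.1.le)]; simp
    _ ≤ 1 + C := by linarith [hC s hs.1.le]

/-- The square is a double integral of correlations, at most C e^{-c|r-s|}; integrating out r over
the whole line leaves a constant for each s, hence linear growth in T. Upper bounds on the
correlations suffice. -/
lemma second_moment_integral_le (hc : 0 < c) (hξ : Measurable (Function.uncurry ξ))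
    (hsq : ∀ s, 0 ≤ s → Integrable (fun ω => ξ s ω ^ 2) Pr)
    (hcorr : ∀ s t, 0 ≤ s → 0 ≤ t → ∫ ω, ξ s ω * ξ (s + t) ω ∂Pr ≤ C * Real.exp (-(c * t)))
    {T : ℝ} (hT : 0 ≤ T) :
    Integrable (fun ω => (∫ s in Set.Ioc 0 T, ξ s ω) ^ 2) Pr ∧
      ∫ ω, (∫ s in Set.Ioc 0 T, ξ s ω) ^ 2 ∂Pr ≤ C * (∫ r, Real.exp (-(c * |r|))) * T := by
  set μ := (volume : Measure ℝ).restrict (Set.Ioc 0 T) with hμ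
  have hC : ∀ s, 0 ≤ s → ∫ ω, ξ s ω ^ 2 ∂Pr ≤ C := fun s hs => by
    have := hcorr s 0 hs le_rfl
    simpa [← sq] using this
  have hC0 : 0 ≤ C := (integral_nonneg fun ω => sq_nonneg _).trans (hC 0 le_rfl)
  set F : (ℝ × ℝ) × Ω → ℝ := fun z => ξ z.1.1 z.2 * ξ z.1.2 z.2 with hF
  have hFm : Measurable F :=
    (hξ.comp ((measurable_fst.comp measurable_fst).prodMk measurable_snd)).mul
      (hξ.comp ((measurable_snd.comp measurable_fst).prodMk measurable_snd))
  have hmem1 : ∀ᵐ s ∂μ, s ∈ Set.Ioc 0 T := ae_restrict_mem measurableSet_Ioc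
  have hmem : ∀ᵐ q ∂(μ.prod μ), q.1 ∈ Set.Ioc 0 T ∧ q.2 ∈ Set.Ioc 0 T :=
    (Measure.quasiMeasurePreserving_fst.ae hmem1).and (Measure.quasiMeasurePreserving_snd.ae hmem1)
  have hFω : ∀ s r, 0 ≤ s → 0 ≤ r → Integrable (fun ω => ξ s ω * ξ r ω) Pr := fun s r hs hr =>
    ((hsq s hs).add (hsq r hr)).mono'
      ((hξ.comp (measurable_const.prodMk measurable_id)).mul
        (hξ.comp (measurable_const.prodMk measurable_id))).aestronglyMeasurable
      (Eventually.of_forall fun ω => abs_mul_le_sq_add_sq _ _)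
  have hFi : Integrable F ((μ.prod μ).prod Pr) := by
    rw [integrable_prod_iff hFm.aestronglyMeasurable]
    refine ⟨hmem.mono fun q hq => hFω _ _ hq.1.1.le hq.2.1.le, ?_⟩
    refine Integrable.of_bound
      (hFm.norm.stronglyMeasurable.integral_prod_right').aestronglyMeasurable (C + C)
      (hmem.mono fun q hq => ?_)
    rw [Real.norm_eq_abs, abs_of_nonneg (integral_nonneg fun ω => norm_nonneg _)]
    calc ∫ ω, ‖F (q, ω)‖ ∂Pr ≤ ∫ ω, (ξ q.1 ω ^ 2 + ξ q.2 ω ^ 2) ∂Pr :=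
          integral_mono (hFω _ _ hq.1.1.le hq.2.1.le).norm
            ((hsq _ hq.1.1.le).add (hsq _ hq.2.1.le)) fun ω => abs_mul_le_sq_add_sq _ _
      _ = ∫ ω, ξ q.1 ω ^ 2 ∂Pr + ∫ ω, ξ q.2 ω ^ 2 ∂Pr :=
          integral_add (hsq _ hq.1.1.le) (hsq _ hq.2.1.le)
      _ ≤ C + C := add_le_add (hC _ hq.1.1.le) (hC _ hq.2.1.le)
  have hsquare : ∀ ω, (∫ s, ξ s ω ∂μ) ^ 2 = ∫ q, F (q, ω) ∂(μ.prod μ) := fun ω => by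
    rw [sq]; exact (integral_prod_mul (fun s => ξ s ω) (fun s => ξ s ω)).symm
  have hcorr' : ∀ s r, 0 ≤ s → 0 ≤ r → ∫ ω, ξ s ω * ξ r ω ∂Pr ≤ C * Real.exp (-(c * |r - s|)) := by
    have key : ∀ s r, 0 ≤ s → s ≤ r →
        ∫ ω, ξ s ω * ξ r ω ∂Pr ≤ C * Real.exp (-(c * |r - s|)) := fun s r hs hsr => by
      have := hcorr s (r - s) hs (sub_nonneg.2 hsr)
      rwa [add_sub_cancel, ← abs_of_nonneg (sub_nonneg.2 hsr)] at this
    intro s r hs hr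
    rcases le_total s r with hsr | hsr
    · exact key s r hs hsr
    · have := key r s hr hsr
      rw [abs_sub_comm] at this
      simpa only [mul_comm] using this
  have hJ := integrable_exp_neg_abs hc
  have hexpm : Measurable fun q : ℝ × ℝ => C * Real.exp (-(c * |q.2 - q.1|)) := by fun_prop
  have hexpi : Integrable (fun q : ℝ × ℝ => C * Real.exp (-(c * |q.2 - q.1|))) (μ.prod μ) := by
    refine Integrable.of_bound hexpm.aestronglyMeasurable C (Eventually.of_forall fun q => ?_)
    rw [Real.norm_eq_abs, abs_of_nonneg (by positivity)]
    exact mul_le_of_le_one_right hC0 (Real.exp_le_one_iff.2 (by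
      have : 0 ≤ c * |q.2 - q.1| := by positivity
      linarith))
  simp only [hsquare]
  refine ⟨hFi.integral_prod_right, ?_⟩
  have hinner : ∀ s, ∫ r, C * Real.exp (-(c * |r - s|)) ∂μ ≤ C * ∫ r, Real.exp (-(c * |r|)) :=
    fun s => by
      rw [integral_const_mul]
      gcongr
      calc ∫ r, Real.exp (-(c * |r - s|)) ∂μ ≤ ∫ r, Real.exp (-(c * |r - s|)) :=
            setIntegral_le_integral (hJ.comp_sub_right s)
              (Eventually.of_forall fun r => (Real.exp_pos _).le)
        _ = _ := integral_sub_right_eq_self (fun r => Real.exp (-(c * |r|))) s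
  calc ∫ ω, ∫ q, F (q, ω) ∂(μ.prod μ) ∂Pr = ∫ q, ∫ ω, F (q, ω) ∂Pr ∂(μ.prod μ) :=
        (integral_integral_swap (f := fun q ω => F (q, ω)) hFi).symm
    _ ≤ ∫ q, C * Real.exp (-(c * |q.2 - q.1|)) ∂(μ.prod μ) :=
        integral_mono_ae hFi.integral_prod_left hexpi
          (hmem.mono fun q hq => hcorr' q.1 q.2 hq.1.1.le hq.2.1.le)
    _ = ∫ s, ∫ r, C * Real.exp (-(c * |r - s|)) ∂μ ∂μ := integral_prod _ hexpi
    _ ≤ ∫ _, C * (∫ r, Real.exp (-(c * |r|))) ∂μ :=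
        integral_mono hexpi.integral_prod_left (integrable_const _) hinner
    _ = C * (∫ r, Real.exp (-(c * |r|))) * T := by
        simp [hμ, hT, mul_comm]

/-- Strong law of large numbers for a nonnegative measurable process whose fluctuations around a
constant have exponentially decaying correlations. -/
theorem ae_tendsto_time_average {X : ℝ → Ω → ℝ} {a : ℝ} (hc : 0 < c)
    (hX : Measurable (Function.uncurry X)) (hX0 : ∀ s ω, 0 ≤ X s ω)
    (hsq : ∀ s, 0 ≤ s → Integrable (fun ω => (X s ω - a) ^ 2) Pr)
    (hcorr : ∀ s t, 0 ≤ s → 0 ≤ t →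
      ∫ ω, (X s ω - a) * (X (s + t) ω - a) ∂Pr ≤ C * Real.exp (-(c * t))) :
    ∀ᵐ ω ∂Pr, (∀ t, 0 ≤ t → IntervalIntegrable (fun s => X s ω) volume 0 t) ∧
      Tendsto (fun t => t⁻¹ * ∫ s in (0 : ℝ)..t, X s ω) atTop (𝓝 a) := by
  have hξ : Measurable (Function.uncurry fun s ω => X s ω - a) := hX.sub_const a
  have hC : ∀ s, 0 ≤ s → ∫ ω, (X s ω - a) ^ 2 ∂Pr ≤ C := fun s hs => by
    have := hcorr s 0 hs le_rfl
    simpa [← sq] using this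
  have hint : ∀ᵐ ω ∂Pr, ∀ n : ℕ, IntegrableOn (fun s => X s ω - a) (Set.Ioc 0 (n : ℝ)) :=
    ae_all_iff.2 fun n => (integrable_prod_of_sq_bound hξ hsq hC n).prod_left_ae
  set J := ∫ r : ℝ, Real.exp (-(c * |r|))
  have hlim : ∀ᵐ ω ∂Pr, Tendsto (fun n : ℕ =>
      (((n : ℝ) ^ 2)⁻¹ * ∫ s in Set.Ioc 0 ((n : ℝ) ^ 2), (X s ω - a)) ^ 2) atTop (𝓝 0) := by
    -- With T = n² the second moment of the average is at most n⁻⁴ · CJn², which is summable. For n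
    -- = 0 both sides vanish by the convention on division by zero.
    refine ae_tendsto_zero_of_summable (B := fun n : ℕ => C * J * (1 / (n : ℝ) ^ 2))
      (fun n ω => sq_nonneg _) (fun n => ?_) (fun n => ?_)
      ((Real.summable_one_div_nat_pow.2 one_lt_two).mul_left _)
    · simp only [mul_pow]
      exact (second_moment_integral_le hc hξ hsq hcorr (by positivity)).1.const_mul _
    · simp only [mul_pow]
      rw [integral_const_mul]
      have h1 := (second_moment_integral_le hc hξ hsq hcorr
        (by positivity : (0 : ℝ) ≤ (n : ℝ) ^ 2)).2
      refine (mul_le_mul_of_nonneg_left h1 (by positivity)).trans (le_of_eq ?_)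
      rcases Nat.eq_zero_or_pos n with rfl | hn
      · simp
      · have : (n : ℝ) ≠ 0 := by positivity
        field_simp
        rfl
  filter_upwards [hint, hlim] with ω h1 h2
  have hXi : ∀ t, 0 ≤ t → IntervalIntegrable (fun s => X s ω) volume 0 t := by
    intro t ht
    obtain ⟨n, hn⟩ := exists_nat_ge t
    rw [intervalIntegrable_iff_integrableOn_Ioc_of_le ht]
    have h3 : IntegrableOn (fun s => X s ω - a + a) (Set.Ioc 0 t) :=
      ((h1 n).mono_set (Set.Ioc_subset_Ioc_right hn)).add (integrable_const _)
    simpa using h3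
  -- Nonnegativity of X enters here: it makes the time integral monotone.
  refine ⟨hXi, tendsto_inv_mul_of_squares (fun t ht r hr htr => ?_)
    (fun t ht => intervalIntegral.integral_nonneg ht fun s _ => hX0 s ω) ?_⟩
  · exact intervalIntegral.integral_mono_interval le_rfl (Set.mem_Ici.1 ht) htr
      (Eventually.of_forall fun s => hX0 s ω) (hXi r hr)
  · have h3 : Tendsto (fun n : ℕ => ((n : ℝ) ^ 2)⁻¹ *
        ∫ s in Set.Ioc 0 ((n : ℝ) ^ 2), (X s ω - a)) atTop (𝓝 0) := by
      have h4 := h2.sqrt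
      simp only [Real.sqrt_sq_eq_abs, Real.sqrt_zero] at h4
      exact (tendsto_zero_iff_abs_tendsto_zero _).2 h4
    have h5 := h3.add_const a
    rw [zero_add] at h5
    refine h5.congr' ?_
    filter_upwards [eventually_ge_atTop 1] with n hn
    have hn0 : (n : ℝ) ≠ 0 := by positivity
    have hT : (0 : ℝ) ≤ (n : ℝ) ^ 2 := by positivity
    rw [← intervalIntegral.integral_of_le hT,
      intervalIntegral.integral_sub (hXi _ hT) (by simp)]
    simp only [intervalIntegral.integral_const, sub_zero, smul_eq_mul]
    field_simp
    ring

end Ergodic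

end AgeBranching

/-! ### The reproduction mass at half the Malthusian exponent -/

namespace AgeBranching

variable {α : ℝ → ℝ} {p : ℝ → ℕ → ℝ} {G : Measure Pos} {α₁ : ℝ}
  {L : Measure PopMeasure}

lemma reproduction_eq (hd : BranchingData α p) (c : ℝ) :
    reproduction α p G c = ∫⁻ s in Set.Ioi (0 : ℝ), ENNReal.ofReal (Real.exp (c * s)) *
      ∫⁻ x : Pos, ENNReal.ofReal (birthRate α p (x - s)) ∂G := by
  unfold reproduction
  congr 1
  funext s
  congr 1
  have hS : MeasurableSet {x : Pos | s < (x : ℝ)} :=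
    measurableSet_lt measurable_const measurable_subtype_coe
  rw [← lintegral_indicator hS]
  congr 1
  funext x
  by_cases hx : x ∈ {x : Pos | s < (x : ℝ)}
  · rw [Set.indicator_of_mem hx]; rfl
  · rw [Set.indicator_of_notMem hx, hd.birthRate_zero _ (sub_nonpos.2 (not_lt.1 hx)),
      ENNReal.ofReal_zero]

variable [IsProbabilityMeasure G]

lemma measurable_lintegral_birthRate (hd : BranchingData α p) :
    Measurable fun s : ℝ => ∫⁻ x : Pos, ENNReal.ofReal (birthRate α p (x - s)) ∂G := by
  have h1 : Measurable fun q : ℝ × Pos => ENNReal.ofReal (birthRate α p (q.2 - q.1)) :=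
    (hd.measurable_birthRate.comp
      ((measurable_subtype_coe.comp measurable_snd).sub measurable_fst)).ennreal_ofReal
  exact h1.lintegral_prod_right'

/-- Convexity in the exponent, in the form 2e^{cs/2} ≤ 1 + e^{cs}. -/
lemma reproduction_half_le (hd : BranchingData α p) (c : ℝ) :
    reproduction α p G (c / 2) ≤ 2⁻¹ * reproduction α p G 0 + 2⁻¹ * reproduction α p G c := by
  have hm := measurable_lintegral_birthRate (G := G) hd
  have hE : ∀ c : ℝ, Measurable fun s : ℝ => ENNReal.ofReal (Real.exp (c * s)) := fun c => by
    fun_prop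
  have hk : ∀ c : ℝ, Measurable fun s : ℝ => ENNReal.ofReal (Real.exp (c * s)) *
      ∫⁻ x : Pos, ENNReal.ofReal (birthRate α p (x - s)) ∂G := fun c => (hE c).mul hm
  simp only [reproduction_eq hd]
  rw [← lintegral_const_mul _ (hk 0), ← lintegral_const_mul _ (hk c),
    ← lintegral_add_left ((hk 0).const_mul _)]
  refine lintegral_mono fun s => ?_
  simp only
  rw [← mul_assoc, ← mul_assoc, ← add_mul]
  gcongr
  have h2 : (2⁻¹ : ℝ≥0∞) = ENNReal.ofReal (2⁻¹) := by
    rw [ENNReal.ofReal_inv_of_pos two_pos]; simp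
  rw [h2, ← ENNReal.ofReal_mul (by norm_num), ← ENNReal.ofReal_mul (by norm_num),
    ← ENNReal.ofReal_add (by positivity) (by positivity)]
  refine ENNReal.ofReal_le_ofReal ?_
  have h3 : Real.exp (c * s) = Real.exp (c / 2 * s) ^ 2 := by
    rw [← Real.exp_nat_mul]; congr 1; push_cast; ring
  rw [h3, zero_mul, Real.exp_zero]
  nlinarith [sq_nonneg (Real.exp (c / 2 * s) - 1)]

/-- Tonelli, after which the time interval [0, t] is enlarged to (0, ∞). -/
lemma ofReal_mass_le_reproduction (hd : BranchingData α p) {c t : ℝ} (hc : 0 ≤ c) (ht : 0 ≤ t) :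
    ENNReal.ofReal (pairing G fun x => ∫ s in (0 : ℝ)..t, Real.exp (c * s) *
      birthRate α p (x - s)) ≤ reproduction α p G c := by
  have hβ := hd.measurable_birthRate
  obtain ⟨K, hK⟩ := hd.exists_birthRate_bound
  have hm : Measurable (Function.uncurry fun x s : ℝ => Real.exp (c * s) * birthRate α p (x - s)) :=
    (Real.measurable_exp.comp (measurable_const.mul measurable_snd)).mul
      (hβ.comp (measurable_fst.sub measurable_snd))
  have h0 : ∀ x s : ℝ, 0 ≤ Real.exp (c * s) * birthRate α p (x - s) := fun x s =>
    mul_nonneg (Real.exp_pos _).le (hd.birthRate_nonneg _)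
  have hb : ∀ x s : ℝ, s ≤ t → Real.exp (c * s) * birthRate α p (x - s) ≤ Real.exp (c * t) * K :=
    fun x s hs => mul_le_mul (Real.exp_le_exp.2 (mul_le_mul_of_nonneg_left hs hc)) (hK _)
      (hd.birthRate_nonneg _) (Real.exp_pos _).le
  have hi : ∀ x : ℝ, IntervalIntegrable (fun s => Real.exp (c * s) * birthRate α p (x - s))
      volume 0 t := fun x =>
    intervalIntegrable_of_bound (hm.comp (measurable_const.prodMk measurable_id)) ht
      fun s _ hs => by rw [abs_of_nonneg (h0 x s)]; exact hb x s hs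
  have hI0 : ∀ x : ℝ, 0 ≤ ∫ s in (0 : ℝ)..t, Real.exp (c * s) * birthRate α p (x - s) := fun x =>
    intervalIntegral.integral_nonneg ht fun s _ => h0 x s
  have hIi : Integrable (fun x : Pos => ∫ s in (0 : ℝ)..t, Real.exp (c * s) *
      birthRate α p (x - s)) G := by
    refine integrable_of_bound (C := Real.exp (c * t) * K * t)
      (g := fun x => ∫ s in (0 : ℝ)..t, Real.exp (c * s) * birthRate α p (x - s))
      (measurable_intervalIntegral measurable_const hm) fun x _ => ?_
    rw [abs_of_nonneg (hI0 x)]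
    refine (intervalIntegral.integral_mono_on ht (hi x) (by simp)
      fun s hs => hb x s hs.2).trans (le_of_eq ?_)
    rw [intervalIntegral.integral_const, sub_zero, smul_eq_mul, mul_comm]
  have hin : ∀ x : ℝ, ENNReal.ofReal (∫ s in (0 : ℝ)..t, Real.exp (c * s) *
      birthRate α p (x - s)) = ∫⁻ s in Set.Ioc 0 t, ENNReal.ofReal (Real.exp (c * s) *
        birthRate α p (x - s)) := fun x => by
    rw [intervalIntegral.integral_of_le ht]
    exact ofReal_integral_eq_lintegral_ofReal
      ((intervalIntegrable_iff_integrableOn_Ioc_of_le ht).1 (hi x))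
      (Eventually.of_forall fun s => h0 x s)
  unfold pairing
  rw [ofReal_integral_eq_lintegral_ofReal hIi (Eventually.of_forall fun x => hI0 x),
    reproduction_eq hd]
  simp only [hin]
  rw [lintegral_lintegral_swap]
  · refine (lintegral_mono_set Set.Ioc_subset_Ioi_self).trans (le_of_eq ?_)
    congr 1
    funext s
    rw [← lintegral_const_mul]
    · simp only [ENNReal.ofReal_mul (Real.exp_pos _).le]
    · exact (hβ.comp (measurable_subtype_coe.sub_const s)).ennreal_ofReal
  · exact (hm.comp ((measurable_subtype_coe.comp measurable_fst).prodMk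
      measurable_snd)).ennreal_ofReal.aemeasurable

/-- At α₁ itself the mass is 1 and the contraction is lost; at α₁/2 convexity leaves κ = (R(0) +
1)/2 < 1, where R(0) is the unweighted mass. The smaller rate still gives exponential decay. -/
lemma exists_subcriticalKernel (hd : BranchingData α p) (hcond : SubcriticalMalthus α p G α₁)
    (hG2 : ∫⁻ x : Pos, ENNReal.ofReal (Real.exp (2 * α₁ * (x : ℝ))) ∂G < ⊤) :
    ∃ κ K : ℝ, SubcriticalKernel (birthRate α p) G (α₁ / 2) κ K := by
  obtain ⟨K, hK⟩ := hd.exists_birthRate_bound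
  have hpos := hcond.pos
  have h0 := hcond.subcritical
  have h0t : reproduction α p G 0 ≠ ⊤ := (h0.trans ENNReal.one_lt_top).ne
  have hR : (reproduction α p G 0).toReal < 1 := by
    rw [← ENNReal.toReal_one]
    exact (ENNReal.toReal_lt_toReal h0t ENNReal.one_ne_top).2 h0
  refine ⟨((reproduction α p G 0).toReal + 1) / 2, K, hd.measurable_birthRate,
    hd.birthRate_nonneg, hK, hd.birthRate_zero, by linarith, by linarith, fun t ht => ?_, ?_⟩
  · have h1 := (ofReal_mass_le_reproduction (G := G) hd (c := α₁ / 2) (by linarith) ht).trans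
      (reproduction_half_le hd α₁)
    rw [hcond.malthus] at h1
    have h2 : (2⁻¹ : ℝ≥0∞) * reproduction α p G 0 + 2⁻¹ * 1 =
        ENNReal.ofReal (((reproduction α p G 0).toReal + 1) / 2) := by
      rw [← mul_add, ENNReal.ofReal_div_of_pos two_pos,
        ENNReal.ofReal_add ENNReal.toReal_nonneg zero_le_one, ENNReal.ofReal_toReal h0t,
        ENNReal.div_eq_inv_mul]
      simp
    rw [h2] at h1
    exact (ENNReal.ofReal_le_ofReal_iff (by positivity)).1 h1
  · have hm : Measurable fun x : Pos => Real.exp (2 * (α₁ / 2) * x) :=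
      Real.measurable_exp.comp (measurable_subtype_coe.const_mul _)
    refine ⟨hm.aestronglyMeasurable, ?_⟩
    rw [hasFiniteIntegral_iff_ofReal (Eventually.of_forall fun x => (Real.exp_pos _).le)]
    refine lt_of_le_of_lt (lintegral_mono fun x => ENNReal.ofReal_le_ofReal ?_) hG2
    have hx : 0 < (x : ℝ) := x.2
    exact Real.exp_le_exp.2 (by nlinarith)

lemma integrable_expWeight_sq (hα : 0 < α₁)
    (hL2 : ∫⁻ ν, (∫⁻ x : Pos, ENNReal.ofReal (Real.exp (α₁ * (x : ℝ))) ∂ν.toM) ^ 2 ∂L < ⊤) :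
    Integrable (fun ν => expWeight (α₁ / 2) ν ^ 2) L := by
  refine ⟨((measurable_expWeight _).pow_const 2).aestronglyMeasurable, ?_⟩
  rw [hasFiniteIntegral_iff_ofReal (Eventually.of_forall fun ν => sq_nonneg _)]
  refine lt_of_le_of_lt (lintegral_mono fun ν => ?_) hL2
  simp only
  rw [ENNReal.ofReal_pow (expWeight_nonneg _ _)]
  gcongr
  unfold expWeight pairing
  rw [ofReal_integral_eq_lintegral_ofReal (ν.integrable_exp _ (by linarith))
    (Eventually.of_forall fun x => (Real.exp_pos _).le)]
  refine lintegral_mono fun x => ENNReal.ofReal_le_ofReal (Real.exp_le_exp.2 ?_)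
  have hx : 0 < (x : ℝ) := x.2
  nlinarith

lemma integrable_expWeight [IsFiniteMeasure L] {c : ℝ}
    (hW2 : Integrable (fun ν => expWeight c ν ^ 2) L) : Integrable (expWeight c) L := by
  refine ((integrable_const (1 : ℝ)).add hW2).mono' (measurable_expWeight c).aestronglyMeasurable
    (Eventually.of_forall fun ν => ?_)
  rw [Real.norm_eq_abs, abs_of_nonneg (expWeight_nonneg c ν)]
  simp only [Pi.add_apply]
  nlinarith [sq_nonneg (expWeight c ν - 1), expWeight_nonneg c ν]

lemma BddBorel.exists_exp_bound {f : ℝ → ℝ} (hf : BddBorel f) {c : ℝ} (hc : 0 ≤ c) :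
    ∃ A : ℝ, 0 ≤ A ∧ ∀ x, 0 < x → f x ≤ A * Real.exp (c * x) := by
  obtain ⟨A, hA'⟩ := hf.bounded
  have hA : 0 ≤ A := (abs_nonneg _).trans (hA' 0)
  exact ⟨A, hA, fun x hx => ((le_abs_self _).trans (hA' x)).trans
    (le_mul_of_one_le_right hA (Real.one_le_exp (by positivity)))⟩

lemma BddBorel.integrable {f : ℝ → ℝ} (hf : BddBorel f) (μ : Measure Pos) [IsFiniteMeasure μ] :
    Integrable (fun x : Pos => f x) μ := by
  obtain ⟨C, hC⟩ := hf.bounded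
  exact integrable_of_bound hf.measurable fun x _ => hC x

/-! ### The strong law for occupation times -/

variable {Ω : Type*} {mΩ : MeasurableSpace Ω} {Pr : Measure Ω} {ℱ : Filtration ℝ≥0 mΩ}
  {σ : PopMeasure} {Y : ℝ≥0 → Ω → PopMeasure} {f : ℝ → ℝ} {c κ K : ℝ}

/-- The strong law for the occupation time tested against a nonnegative function. -/
theorem occupation_strong_law_nonneg [IsProbabilityMeasure Pr] [IsFiniteMeasure L]
    (hd : BranchingData α p) (hg2 : BddSecondMoment p)
    (h : SubcriticalKernel (birthRate α p) G c κ K)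
    (hW : Integrable (expWeight c) L) (hW2 : Integrable (fun ν => expWeight c ν ^ 2) L)
    (hY : IsProcess Pr ℱ α p G L σ Y) (hf : BddBorel f) (hf0 : ∀ x, 0 ≤ f x) :
    ∀ᵐ ω ∂Pr, (∀ t : ℝ, 0 ≤ t → IntervalIntegrable
        (fun s : ℝ => pairing (Y s.toNNReal ω).toM f) volume 0 t) ∧
      Tendsto (fun t : ℝ => t⁻¹ * occupation Y f t ω) atTop
        (𝓝 (∫ ν, pairing ν.toM (totalMean α p G f) ∂L)) := by
  obtain ⟨C, -, hC⟩ := exists_correlation_bound hd hg2 h hW hW2 hY hf hf0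
  have hYm := measurable_uncurry_of_rightContinuous hY.measurable hY.right_continuous
  have hX : Measurable (Function.uncurry fun (s : ℝ) ω => pairing (Y s.toNNReal ω).toM f) :=
    (measurable_pairing hf.measurable).comp (hYm.comp
      ((measurable_real_toNNReal.comp measurable_fst).prodMk measurable_snd))
  refine ae_tendsto_time_average (C := C) h.c_pos hX
    (fun s ω => pairing_nonneg fun x _ => hf0 x) (fun s _ => (hC _).1) fun s t hs ht => ?_
  have := (hC s.toNNReal).2 t.toNNReal
  rwa [← Real.toNNReal_add hs ht, Real.coe_toNNReal t ht] at this

lemma SubcriticalKernel.totalMean_sub {f₁ f₂ : ℝ → ℝ} (h : SubcriticalKernel (birthRate α p) G c κ K)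
    (h₁ : BddBorel f₁) (h₂ : BddBorel f₂) (hf : BddBorel fun x => f₁ x - f₂ x)
    (hn₁ : ∀ x, 0 ≤ f₁ x) (hn₂ : ∀ x, 0 ≤ f₂ x) {x : ℝ} (hx : 0 < x) :
    IntegrableOn (fun s => meanSemigroup α p G (fun x => f₁ x - f₂ x) s x) (Set.Ioi 0) ∧
      totalMean α p G (fun x => f₁ x - f₂ x) x = totalMean α p G f₁ x - totalMean α p G f₂ x := by
  obtain ⟨A₁, hA₁, hfA₁⟩ := h₁.exists_exp_bound h.c_pos.le
  obtain ⟨A₂, hA₂, hfA₂⟩ := h₂.exists_exp_bound h.c_pos.le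
  have i₁ := h.integrableOn_mean h₁ hn₁ hA₁ hfA₁ hx
  have i₂ := h.integrableOn_mean h₂ hn₂ hA₂ hfA₂ hx
  have he : Set.EqOn (fun s => meanSemigroup α p G (fun x => f₁ x - f₂ x) s x)
      (fun s => meanSemigroup α p G f₁ s x - meanSemigroup α p G f₂ s x) (Set.Ioi 0) :=
    fun s hs => h.mean_sub h₁ h₂ hf (le_of_lt hs) hx
  refine ⟨(integrableOn_congr_fun he measurableSet_Ioi).2 (i₁.sub i₂), ?_⟩
  unfold totalMean
  rw [setIntegral_congr_fun measurableSet_Ioi he, integral_sub i₁ i₂]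

lemma SubcriticalKernel.pairing_totalMean_sub {f₁ f₂ : ℝ → ℝ}
    (h : SubcriticalKernel (birthRate α p) G c κ K)
    (h₁ : BddBorel f₁) (h₂ : BddBorel f₂) (hf : BddBorel fun x => f₁ x - f₂ x)
    (hn₁ : ∀ x, 0 ≤ f₁ x) (hn₂ : ∀ x, 0 ≤ f₂ x) (ν : PopMeasure) :
    Integrable (fun x : Pos => totalMean α p G (fun x => f₁ x - f₂ x) x) ν.toM ∧
      pairing ν.toM (totalMean α p G fun x => f₁ x - f₂ x) =
        pairing ν.toM (totalMean α p G f₁) - pairing ν.toM (totalMean α p G f₂) := by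
  obtain ⟨A₁, hA₁, hfA₁⟩ := h₁.exists_exp_bound h.c_pos.le
  obtain ⟨A₂, hA₂, hfA₂⟩ := h₂.exists_exp_bound h.c_pos.le
  have i₁ := h.integrable_totalMean h₁ hn₁ hA₁ hfA₁ ν
  have i₂ := h.integrable_totalMean h₂ hn₂ hA₂ hfA₂ ν
  have he : (fun x : Pos => totalMean α p G (fun x => f₁ x - f₂ x) x) =
      fun x : Pos => totalMean α p G f₁ x - totalMean α p G f₂ x :=
    funext fun x => (h.totalMean_sub h₁ h₂ hf hn₁ hn₂ x.2).2
  unfold pairing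
  rw [he, integral_sub i₁ i₂]
  exact ⟨i₁.sub i₂, rfl⟩

/-- The strong law for the occupation time tested against a difference of nonnegative functions,
with the absolute convergence of the integrals that define its limit. -/
theorem occupation_strong_law_sub [IsProbabilityMeasure Pr] [IsFiniteMeasure L] {f₁ f₂ : ℝ → ℝ}
    (hd : BranchingData α p) (hg2 : BddSecondMoment p)
    (h : SubcriticalKernel (birthRate α p) G c κ K)
    (hW : Integrable (expWeight c) L) (hW2 : Integrable (fun ν => expWeight c ν ^ 2) L)
    (hY : IsProcess Pr ℱ α p G L σ Y)
    (h₁ : BddBorel f₁) (h₂ : BddBorel f₂) (hn₁ : ∀ x, 0 ≤ f₁ x) (hn₂ : ∀ x, 0 ≤ f₂ x)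
    (hf : BddBorel f) (hfe : f = fun x => f₁ x - f₂ x) :
    SolvesMean α p G f (meanSemigroup α p G f) ∧
    (∀ x : ℝ, 0 < x → IntegrableOn (fun s => meanSemigroup α p G f s x) (Set.Ioi 0)) ∧
    (∀ᵐ ν ∂L, Integrable (fun x : Pos => totalMean α p G f x) ν.toM) ∧
    Integrable (fun ν : PopMeasure => pairing ν.toM (totalMean α p G f)) L ∧
    ∀ᵐ ω ∂Pr,
      (∀ t : ℝ, 0 ≤ t → IntervalIntegrable
        (fun s : ℝ => pairing (Y s.toNNReal ω).toM f) volume 0 t) ∧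
      Tendsto (fun t : ℝ => t⁻¹ * occupation Y f t ω) atTop
        (𝓝 (∫ ν, pairing ν.toM (totalMean α p G f) ∂L)) := by
  subst hfe
  obtain ⟨A₁, hA₁, hfA₁⟩ := h₁.exists_exp_bound h.c_pos.le
  obtain ⟨A₂, hA₂, hfA₂⟩ := h₂.exists_exp_bound h.c_pos.le
  have i₁ := h.integrable_pairing_totalMean h₁ hn₁ hA₁ hfA₁ hW
  have i₂ := h.integrable_pairing_totalMean h₂ hn₂ hA₂ hfA₂ hW
  have he : (fun ν : PopMeasure => pairing ν.toM (totalMean α p G fun x => f₁ x - f₂ x)) =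
      fun ν => pairing ν.toM (totalMean α p G f₁) - pairing ν.toM (totalMean α p G f₂) :=
    funext fun ν => (h.pairing_totalMean_sub h₁ h₂ hf hn₁ hn₂ ν).2
  have hp : ∀ ν : PopMeasure, pairing ν.toM (fun x => f₁ x - f₂ x) =
      pairing ν.toM f₁ - pairing ν.toM f₂ := fun ν =>
    haveI : IsFiniteMeasure ν.toM := inferInstanceAs (IsFiniteMeasure (ν.1 : Measure Pos))
    integral_sub (h₁.integrable _) (h₂.integrable _)
  refine ⟨h.solvesMean hf, fun x hx => (h.totalMean_sub h₁ h₂ hf hn₁ hn₂ hx).1,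
    Eventually.of_forall fun ν => (h.pairing_totalMean_sub h₁ h₂ hf hn₁ hn₂ ν).1, ?_, ?_⟩
  · rw [he]
    exact i₁.sub i₂
  rw [he, integral_sub i₁ i₂]
  filter_upwards [occupation_strong_law_nonneg hd hg2 h hW hW2 hY h₁ hn₁,
    occupation_strong_law_nonneg hd hg2 h hW hW2 hY h₂ hn₂] with ω ho₁ ho₂
  simp only [hp, occupation]
  refine ⟨fun t ht => (ho₁.1 t ht).sub (ho₂.1 t ht), (ho₁.2.sub ho₂.2).congr' ?_⟩
  filter_upwards [eventually_ge_atTop 0] with t ht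
  rw [intervalIntegral.integral_sub (ho₁.1 t ht) (ho₂.1 t ht), mul_sub]
  rfl

end AgeBranching

/-! ### The main theorem -/

open AgeBranching

theorem mainTheorem5 {Ω : Type*} {mΩ : MeasurableSpace Ω}
    (Pr : Measure Ω) [IsProbabilityMeasure Pr] (ℱ : Filtration ℝ≥0 mΩ)
    (α : ℝ → ℝ) (p : ℝ → ℕ → ℝ) (hdata : BranchingData α p)
    (G : Measure Pos) [IsProbabilityMeasure G]
    (L : Measure PopMeasure) [IsFiniteMeasure L]
    (hL0 : L {ν : PopMeasure | ν.toM = 0} = 0)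
    (α₁ : ℝ) (hcond : SubcriticalMalthus α p G α₁)
    (hG2 : ∫⁻ x : Pos, ENNReal.ofReal (Real.exp (2 * α₁ * (x : ℝ))) ∂G < ⊤)
    (hg2 : BddSecondMoment p)
    (hL2 : ∫⁻ ν, (∫⁻ x : Pos, ENNReal.ofReal (Real.exp (α₁ * (x : ℝ))) ∂ν.toM) ^ 2 ∂L < ⊤)
    (σ : PopMeasure) (Y : ℝ≥0 → Ω → PopMeasure) (hY : IsProcess Pr ℱ α p G L σ Y)
    (f : ℝ → ℝ) (hf : BddBorel f) :
    SolvesMean α p G f (meanSemigroup α p G f) ∧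
    (∀ x : ℝ, 0 < x → IntegrableOn (fun s => meanSemigroup α p G f s x) (Set.Ioi 0)) ∧
    (∀ᵐ ν ∂L, Integrable (fun x : Pos => totalMean α p G f x) ν.toM) ∧
    Integrable (fun ν : PopMeasure => pairing ν.toM (totalMean α p G f)) L ∧
    ∀ᵐ ω ∂Pr,
      (∀ t : ℝ, 0 ≤ t → IntervalIntegrable
        (fun s : ℝ => pairing (Y s.toNNReal ω).toM f) volume 0 t) ∧
      Tendsto (fun t : ℝ => t⁻¹ * occupation Y f t ω) atTop
        (𝓝 (∫ ν, pairing ν.toM (totalMean α p G f) ∂L)) := by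
  obtain ⟨κ, K, h⟩ := exists_subcriticalKernel hdata hcond hG2
  have hW2 := integrable_expWeight_sq hcond.pos hL2
  have hW := integrable_expWeight hW2
  -- Positive minus negative part; the nonnegative case is the one where the occupation time is
  -- monotone.
  have hfe : f = fun x => max (f x) 0 - max (-1 * f x) 0 := by
    funext x
    rcases le_total (f x) 0 with hx | hx
    · rw [max_eq_right hx, max_eq_left (by linarith)]; ring
    · rw [max_eq_left hx, max_eq_right (by linarith)]; ring
  exact occupation_strong_law_sub hdata hg2 h hW hW2 hY hf.pos_part (hf.const_mul (-1)).pos_part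
    (fun x => le_max_right _ _) (fun x => le_max_right _ _) hf hfe
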